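/- **Setting.** Let $\alpha\in(0,1)$, let $Y\in\mathbb R^d$ and $Z\in\mathbb R^q$ be independent random variables and let $\varphi:\mathbb R^d\times\mathbb R^q\to\mathbb R$ be measurable with $\mathbb E[|\varphi(Y,Z)|^{2+\delta}]<\infty$ for some $\delta>0$. Put $X_0=\mathbb E[\varphi(Y,Z)\mid Y]$, let $\mathcal H=\{1/K : K\in\mathbb N,\ K\ge1\}$ and, for $h=1/K\in\mathcal H$, put $X_h=\frac1K\sum_{k=1}^K\varphi(Y,Z^{(k)})$, where $Z^{(1)},Z^{(2)},\dots$ are i.i.d. copies of $Z$ that are jointly independent of $Y$. For $h\in\mathcal H\cup\{0\}$ let $F_{X_h}$ be the distribution function of $X_h$ and $V_h(\xi)=\xi+\frac1{1-\alpha}\mathbb E[(X_h-\xi)^+]$. Let $$\xi^0_\star=\mathrm{VaR}_\alpha(X_0),\qquad \chi^0_\star=\frac1{1-\alpha}\int_\alpha^1\mathrm{VaR}_a(X_0)\,da,\qquad \mathrm{VaR}_a(X_0)=\inf\{\xi\in\mathbb R:\mathbb P(X_0\le\xi)\ge a\}.$$ **Assumption on the laws.** (i) There are functions $v$ and $w(\cdot,h):\mathbb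 R\to\mathbb R$, $h\in\mathcal H$, with $F_{X_h}(\xi)-F_{X_0}(\xi)=v(\xi)h+w(\xi,h)h$ for all $\xi\in\mathbb R$, $h\in\mathcal H$, and such that, for every minimizer $x$ of $V_0$, $v$ is integrable on $(x,\infty)$ and $w(x,h)\to0$, $\int_x^\infty w(\xi,h)\,d\xi\to0$ as $\mathcal H\ni h\downarrow0$. (ii) For every $h\in\mathcal H\cup\{0\}$ the law of $X_h$ has a continuous density $f_{X_h}$, and $f_{X_h}\to f_{X_0}$ locally uniformly as $\mathcal H\ni h\downarrow0$. (iii) For every $R>0$, $\inf\{f_{X_h}(\xi): h\in\mathcal H\cup\{0\},\ |\xi-\xi^0_\star|<R\}>0$. (iv) The $f_{X_h}$, $h\in\mathcal H\cup\{0\}$, are uniformly bounded and Lipschitz with a common constant. Under this assumption $V_h$ is twice continuously differentiable with a unique minimizer $\xi^h_\star$ for each $h\in\mathcal H\cup\{0\}$ (and it is $\xi^0_\star$ for $h=0$). Set $$\lambda=\inf_{h\in\mathcal H\cup\{0\}}\min\Big(\tfrac38V_h''(\xi^h_\star),\ \|V_h''\|_\infty\frac{V_h''(\xi^h_\star)^4}{4[V_h'']_{\mathrm{Lip}}^2}\Big),$$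 where $[\,\cdot\,]_{\mathrm{Lip}}$ is the best Lipschitz constant. **Scheme.** Let $\gamma_n=\gamma_1n^{-\beta}$ for $n\ge1$, with $\gamma_1>0$ and $\beta\in(\frac12,1]$, and suppose $\lambda\gamma_1>1$ if $\beta=1$. For $h\in\mathcal H$ let $X_h^{(1)},X_h^{(2)},\dots$ be i.i.d. copies of $X_h$ and let $\xi^h_0$ be a real random variable independent of them; let $\chi^h_0=0$ and, for $n\ge0$, $$\xi^h_{n+1}=\xi^h_n-\gamma_{n+1}\Big(1-\tfrac1{1-\alpha}\mathbf 1_{X_h^{(n+1)}\ge\xi^h_n}\Big),\qquad \chi^h_{n+1}=\chi^h_n-\tfrac1{n+1}\Big(\chi^h_n-\xi^h_n-\tfrac1{1-\alpha}(X_h^{(n+1)}-\xi^h_n)^+\Big).$$ Suppose that, with $c_\alpha=\max(1,\frac{\alpha}{1-\alpha})$, $$\sup_{h\in\mathcal H}\mathbb E\Big[|\xi^h_0|^2\exp\Big(\tfrac4{1-\alpha}c_\alpha\sup_{h'\in\mathcal H}\|f_{X_{h'}}\|_\infty|\xi^h_0|\Big)\Big]<\infty .$$ **Conclusion.** The matrix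 $$\Sigma_\beta=\begin{pmatrix}\dfrac{\alpha\gamma_1}{2f_{X_0}(\xi^0_\star)-\gamma_1^{-1}(1-\alpha)\mathbf 1_{\beta=1}}&\alpha\dfrac{\chi^0_\star-\xi^0_\star}{f_{X_0}(\xi^0_\star)}\mathbf 1_{\beta=1}\\[2mm]\alpha\dfrac{\chi^0_\star-\xi^0_\star}{f_{X_0}(\xi^0_\star)}\mathbf 1_{\beta=1}&\dfrac{\mathrm{Var}((X_0-\xi^0_\star)^+)}{(1-\alpha)^2}\end{pmatrix}$$ is positive semidefinite and, as $\mathcal H\ni h\downarrow0$, $$\begin{pmatrix}h^{-\beta}\big(\xi^h_{\lceil h^{-2}\rceil}-\xi^0_\star\big)\\ h^{-1}\big(\chi^h_{\lceil h^{-2}\rceil}-\chi^0_\star\big)\end{pmatrix}\ \xrightarrow{\ \mathcal L\ }\ \mathcal N\left(\begin{pmatrix}-\dfrac{v(\xi^0_\star)}{f_{X_0}(\xi^0_\star)}\mathbf 1_{\beta=1}\\[2mm]-\displaystyle\int_{\xi^0_\star}^\infty\frac{v(\xi)}{1-\alpha}\,d\xi\end{pmatrix},\ \Sigma_\beta\right).$$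 -/

import Mathlib

open MeasureTheory ProbabilityTheory Filter Topology
open scoped NNReal

namespace NestedSA

noncomputable section

/-! ### Risk measures -/

/-- The value-at-risk (lower quantile) of `X` at level `a`. -/
def valueAtRisk {Ω : Type*} [MeasurableSpace Ω] (P : Measure Ω) (X : Ω → ℝ) (a : ℝ) : ℝ :=
  sInf {ξ : ℝ | a ≤ P.real {ω | X ω ≤ ξ}}

/-- The expected shortfall of `X` at level `α`, as the average of the value-at-risk over the levels
between `α` and `1`. -/
def expectedShortfall {Ω : Type*} [MeasurableSpace Ω] (P : Measure Ω) (X : Ω → ℝ) (α : ℝ) : ℝ :=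
  1 / (1 - α) * ∫ a in α..1, valueAtRisk P X a

/-- The Rockafellar-Uryasev objective `V(ξ) = ξ + E[(X - ξ)⁺] / (1 - α)`. -/
def objective {Ω : Type*} [MeasurableSpace Ω] (P : Measure Ω) (α : ℝ) (X : Ω → ℝ) (ξ : ℝ) : ℝ :=
  ξ + 1 / (1 - α) * ∫ ω, max (X ω - ξ) 0 ∂P

/-- The set of global minimizers of a real function. -/
def Argmin (V : ℝ → ℝ) : Set ℝ := {x | ∀ y, V x ≤ V y}

/-! ### The nested model -/

/-- The set of bias parameters `1 / K`, `K` a positive integer. -/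
def biasSet : Set ℝ := {h | ∃ K : ℕ, 0 < K ∧ h = 1 / (K : ℝ)}

/-- The nested loss. At `h = 0` it is `E[φ(Y, Z) | Y]`; at `h = 1 / K` (so that `⌊1 / h⌋₊ = K`) it is
the empirical mean of `φ(Y, Z⁽¹⁾), …, φ(Y, Z⁽ᴷ⁾)`, where `Zs k` is `Z⁽ᵏ⁺¹⁾`. -/
def loss {Ω : Type*} [MeasurableSpace Ω] (P : Measure Ω) {d q : ℕ}
    (φ : (Fin d → ℝ) × (Fin q → ℝ) → ℝ) (Y : Ω → Fin d → ℝ) (Z : Ω → Fin q → ℝ)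
    (Zs : ℕ → Ω → Fin q → ℝ) (h : ℝ) : Ω → ℝ :=
  if h = 0 then P[fun ω => φ (Y ω, Z ω) | MeasurableSpace.comap Y inferInstance]
  else fun ω => h * ∑ k ∈ Finset.range ⌊1 / h⌋₊, φ (Y ω, Zs k ω)

/-- `f` is a continuous probability density function of the law of `X`. -/
def IsContinuousPDF {Ω : Type*} [MeasurableSpace Ω] (P : Measure Ω) (X : Ω → ℝ)
    (f : ℝ → ℝ) : Prop :=
  Continuous f ∧ (∀ x, 0 ≤ f x) ∧
    P.map X = (volume : Measure ℝ).withDensity (fun x => ENNReal.ofReal (f x))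

/-! ### The stochastic approximation scheme -/

/-- `H₁(ξ, x) = 1 - 1_{x ≥ ξ} / (1 - α)`. -/
def H₁ (α ξ x : ℝ) : ℝ := 1 - 1 / (1 - α) * (if ξ ≤ x then 1 else 0)

/-- `H₂(ξ, χ, x) = χ - (ξ + (x - ξ)⁺ / (1 - α))`. -/
def H₂ (α ξ χ x : ℝ) : ℝ := χ - (ξ + 1 / (1 - α) * max (x - ξ) 0)

/-- The VaR iterates with steps `γ 1, γ 2, …`, initial value `ξ₀` and innovations `x 0, x 1, …`
(the innovation used in the `(n+1)`-st update is `x n`). -/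
def varIter (α : ℝ) (γ : ℕ → ℝ) (ξ₀ : ℝ) (x : ℕ → ℝ) : ℕ → ℝ
  | 0 => ξ₀
  | n + 1 => varIter α γ ξ₀ x n - γ (n + 1) * H₁ α (varIter α γ ξ₀ x n) (x n)

/-- The ES iterates, with steps `1 / (n + 1)` and initial value `0`, driven by the same innovations
as the VaR iterates. -/
def esIter (α : ℝ) (γ : ℕ → ℝ) (ξ₀ : ℝ) (x : ℕ → ℝ) : ℕ → ℝ
  | 0 => 0
  | n + 1 => esIter α γ ξ₀ x n
      - 1 / ((n : ℝ) + 1) * H₂ α (varIter α γ ξ₀ x n) (esIter α γ ξ₀ x n) (x n)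

/-- The learning rate `γ_n = γ₁ n^{-β}`. -/
def learningRate (γ₁ β : ℝ) (n : ℕ) : ℝ := γ₁ * (n : ℝ) ^ (-β)

/-- The renormalized VaR and ES errors at bias parameter `h`, after `⌈h⁻²⌉` iterations, centred
at `(ξ, χ)`. -/
def scaledError (α γ₁ β h ξ χ ξ₀ : ℝ) (x : ℕ → ℝ) : EuclideanSpace ℝ (Fin 2) :=
  !₂[h ^ (-β) * (varIter α (learningRate γ₁ β) ξ₀ x ⌈(h ^ 2)⁻¹⌉₊ - ξ),
     h⁻¹ * (esIter α (learningRate γ₁ β) ξ₀ x ⌈(h ^ 2)⁻¹⌉₊ - χ)]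

/-! ### Assumptions -/

/-- Regularity of the laws of the losses `X h`, `h ∈ biasSet ∪ {0}`: `f h` is the density of `X h`,
and `v`, `w` are the coefficient and the remainder of the expansion of the distribution functions.
As `X h` and `X 0` are integrable, integrability of `v` on a half-line `(x, ∞)` entails that of
`w · h`, so that the integrals of `w` below are genuine ones. -/
structure RegularLaws {Ω : Type*} [MeasurableSpace Ω] (P : Measure Ω) (α : ℝ) (X : ℝ → Ω → ℝ)
    (f : ℝ → ℝ → ℝ) (v : ℝ → ℝ) (w : ℝ → ℝ → ℝ) : Prop where
  expansion : ∀ h ∈ biasSet, ∀ ξ : ℝ,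
    P.real {ω | X h ω ≤ ξ} - P.real {ω | X 0 ω ≤ ξ} = v ξ * h + w ξ h * h
  integrable_v : ∀ x ∈ Argmin (objective P α (X 0)), IntegrableOn v (Set.Ioi x)
  remainder : ∀ x ∈ Argmin (objective P α (X 0)),
    Tendsto (fun h => w x h) (𝓝[biasSet] 0) (𝓝 0)
  remainder_integral : ∀ x ∈ Argmin (objective P α (X 0)),
    Tendsto (fun h => ∫ ξ in Set.Ioi x, w ξ h) (𝓝[biasSet] 0) (𝓝 0)
  pdf : ∀ h ∈ insert 0 biasSet, IsContinuousPDF P (X h) (f h)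
  pdf_tendsto : TendstoLocallyUniformly f (f 0) (𝓝[biasSet] 0)
  pdf_lower : ∀ R > 0, ∃ c > 0, ∀ h ∈ insert 0 biasSet,
    ∀ ξ ∈ Metric.ball (valueAtRisk P (X 0) α) R, c ≤ f h ξ
  pdf_bounded_lipschitz : ∃ C : ℝ≥0, ∀ h ∈ insert 0 biasSet,
    (∀ ξ, |f h ξ| ≤ C) ∧ LipschitzWith C (f h)

/-- The supremum norm of a real function. -/
def supNorm (g : ℝ → ℝ) : ℝ := ⨆ x, |g x|

/-- The (best) Lipschitz constant of a real function. -/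
def lipConst (g : ℝ → ℝ) : ℝ := ⨆ p : ℝ × ℝ, |g p.1 - g p.2| / |p.1 - p.2|

/-- The uniform exponential moment condition on the initial values `ξ₀ h`, `h ∈ biasSet`. -/
def InitialMoment {Ω : Type*} [MeasurableSpace Ω] (P : Measure Ω) (α : ℝ) (f : ℝ → ℝ → ℝ)
    (ξ₀ : ℝ → Ω → ℝ) : Prop :=
  ∃ C : ℝ≥0, ∀ h ∈ biasSet,
    ∫⁻ ω, ENNReal.ofReal (|ξ₀ h ω| ^ 2 * Real.exp (4 / (1 - α) * max 1 (α / (1 - α)) *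
      (⨆ h' : biasSet, supNorm (f h')) * |ξ₀ h ω|)) ∂P ≤ C

/-- The constant `λ`: the infimum, over `h ∈ biasSet ∪ {0}` and the minimizer `x` of `V_h`, of
`min (3/8 V_h''(x)) (‖V_h''‖_∞ V_h''(x)⁴ / (4 [V_h'']_Lip²))`. -/
def lam {Ω : Type*} [MeasurableSpace Ω] (P : Measure Ω) (α : ℝ) (X : ℝ → Ω → ℝ) : ℝ :=
  sInf {r : ℝ | ∃ h ∈ insert 0 biasSet, ∃ x ∈ Argmin (objective P α (X h)),
    r = min (3 / 8 * iteratedDeriv 2 (objective P α (X h)) x)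
      (supNorm (iteratedDeriv 2 (objective P α (X h))) *
        (iteratedDeriv 2 (objective P α (X h)) x ^ 4 /
          (4 * lipConst (iteratedDeriv 2 (objective P α (X h))) ^ 2)))}

/-! ### The limit law -/

/-- The indicator of `β = 1`. -/
def indOne (β : ℝ) : ℝ := if β = 1 then 1 else 0

/-- The asymptotic covariance matrix; `ξ`, `χ` are the VaR and ES of `X₀` and `fξ` is the density of
`X₀` at `ξ`. -/
def asympCov {Ω : Type*} [MeasurableSpace Ω] (P : Measure Ω) (α γ₁ β : ℝ) (X₀ : Ω → ℝ)
    (ξ χ fξ : ℝ) : Matrix (Fin 2) (Fin 2) ℝ :=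
  !![α * γ₁ / (2 * fξ - γ₁⁻¹ * (1 - α) * indOne β), α * ((χ - ξ) / fξ) * indOne β;
     α * ((χ - ξ) / fξ) * indOne β,
       variance (fun ω => max (X₀ ω - ξ) 0) P / (1 - α) ^ 2]

/-- The asymptotic mean; `ξ` is the VaR of `X₀` and `fξ` is the density of `X₀` at `ξ`. -/
def asympMean (α β : ℝ) (v : ℝ → ℝ) (ξ fξ : ℝ) : EuclideanSpace ℝ (Fin 2) :=
  !₂[-(v ξ / fξ) * indOne β, -∫ x in Set.Ioi ξ, v x / (1 - α)]

end

end NestedSA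

/-!
# A central limit theorem for nested stochastic approximation of the VaR and the ES

Write `F_h`, `f_h` and `z_h` for the distribution function, the density and the value-at-risk of
`X_h`, and `n = ⌈h⁻²⌉`. The value-at-risk is the root of the derivative `(F_h - α) / (1 - α)` of the
objective `V_h`, and the expected shortfall is the minimum of `V_h` (`expectedShortfall_eq`). The
argument replaces the scheme by weighted sums of i.i.d. variables, at an error that vanishes in `L¹`
after renormalization, so that neither stopping times nor a martingale central limit theorem are
needed.

*Mean square rate.* The function `cosh (a (ξ - z_h)) - 1`, with `a` the exponential rate of the
moment condition on the initial value, is a Lyapunov function for the value-at-risk iterates. Its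
drift rate `c` does not depend on `h`, and is `λ` when `β = 1` (`exists_drift`); this is the only
place where the second term in the definition of `λ` plays a role. Hence
`E (ξ_n - z_h)² = O(n^{-β})` uniformly in `h` (`lyapunov_bound`,
`exists_integral_varProc_sub_sq_le`).

*Linearization.* Freezing the noise at `z_h` and the slope of the drift at `m = f_0(z_0) / (1 - α)`
turns the value-at-risk recursion into a linear one, driven by i.i.d. bounded variables. The three
errors so made are estimated with the mean square rate (`integral_abs_varProc_sub_linRec_le`). As
`λ ≤ 3 m / 8`, the condition `λ γ₁ > 1` leaves ample room for the rates required at `β = 1`. The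
expected shortfall iterates are averages, compared with an i.i.d. mean in the same way
(`integral_abs_esIter_sub_le`). Altogether the renormalized error is a deterministic bias plus
weighted i.i.d. sums, up to `o(1)` in `L¹` (`exists_scaledError_sub_linearized_le`).

*Bias.* The expansion of `F_h - F_0` gives `z_h - z_0 = -(v(z_0) / f_0(z_0)) h + o(h)`
(`tendsto_valueAtRisk_sub_div`). Integrated over `(z_0, ∞)`, and combined with the fact that `V_h`
is flat to second order at its minimizer, it gives the bias of the expected shortfall
(`tendsto_objective_sub_div`).

*Limit law.* By independence, the characteristic function of the linearized scheme is a product.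
The law of `X_h` may be replaced by that of `X_0` in each factor, because
`E (X_h - X_0)² = O(h)` by conditional independence of the inner samples
(`exists_integral_loss_sub_sq_le`); then second order Taylor expansion gives a Gaussian limit
(`tendsto_prod_charFun`). Its covariance comes from the asymptotics of the weights
(`tendsto_sum_coeff_sq_div`, `tendsto_sum_coeff`), the bound on their fourth powers
(`exists_sum_coeff_pow_four_le`) making them uniformly negligible. The limiting quadratic form is a
limit of variances, which also shows that the covariance matrix is positive semidefinite
(`posSemidef_asympCov`). Lévy's continuity theorem and Slutsky's lemma conclude
(`tendstoInDistribution_scaledError`).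
-/

open MeasureTheory ProbabilityTheory Filter Topology
open scoped NNReal

namespace NestedSA

noncomputable section

/-! ### Step sizes and linear recursions -/

/-- The step `γ_{n+1} = γ₁ (n + 1)^{-β}` used in the update from time `n` to time `n + 1`. -/
def step (γ₁ β : ℝ) (n : ℕ) : ℝ := γ₁ * ((n : ℝ) + 1) ^ (-β)

lemma learningRate_succ (γ₁ β : ℝ) (n : ℕ) : learningRate γ₁ β (n + 1) = step γ₁ β n := by
  simp [learningRate, step]

section Deterministic

variable {γ₁ β : ℝ}

lemma step_pos (hγ₁ : 0 < γ₁) (n : ℕ) : 0 < step γ₁ β n := by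
  unfold step; positivity

lemma step_le (hγ₁ : 0 < γ₁) (hβ : 0 ≤ β) (n : ℕ) : step γ₁ β n ≤ γ₁ := by
  unfold step
  have : ((n : ℝ) + 1) ^ (-β) ≤ 1 :=
    Real.rpow_le_one_of_one_le_of_nonpos (by linarith [n.cast_nonneg (α := ℝ)]) (by linarith)
  nlinarith

lemma tendsto_succ_rpow_neg {p : ℝ} (hp : 0 < p) :
    Tendsto (fun n : ℕ => ((n : ℝ) + 1) ^ (-p)) atTop (𝓝 0) :=
  (tendsto_rpow_neg_atTop hp).comp
    (tendsto_atTop_add_const_right _ _ tendsto_natCast_atTop_atTop)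

lemma tendsto_step (hβ : 0 < β) : Tendsto (step γ₁ β) atTop (𝓝 0) := by
  have := (tendsto_succ_rpow_neg hβ).const_mul γ₁
  rw [mul_zero] at this
  exact this

/-- `RateBound γ₁ β c C s K` says that a nonnegative sequence which contracts by a factor
`1 - c γ + C γ²` at each step, up to a forcing term `D n^{-β(1+s)}`, is bounded by
`K D n^{-βs}`. The constant `K` serves all sequences simultaneously. -/
def RateBound (γ₁ β c C s K : ℝ) : Prop :=
  0 ≤ K ∧ ∀ D : ℝ, 0 ≤ D → ∀ y : ℕ → ℝ, (∀ n, 0 ≤ y n) → y 0 ≤ D →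
    (∀ n, y (n + 1) ≤ (1 - c * step γ₁ β n + C * step γ₁ β n ^ 2) * y n
      + D * ((n : ℝ) + 1) ^ (-(β * (1 + s)))) →
    ∀ n, y n ≤ K * D * ((n : ℝ) + 1) ^ (-(β * s))

lemma succ_rpow_neg_ge {p : ℝ} (hp : 0 ≤ p) (n : ℕ) :
    ((n : ℝ) + 1) ^ (-p) * (1 - p / ((n : ℝ) + 1)) ≤ (((n + 1 : ℕ) : ℝ) + 1) ^ (-p) := by
  have hn : (0 : ℝ) < (n : ℝ) + 1 := by positivity
  have e : (((n + 1 : ℕ) : ℝ) + 1) = ((n : ℝ) + 1) * (1 + 1 / ((n : ℝ) + 1)) := by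
    push_cast; field_simp
  rw [e, Real.mul_rpow hn.le (by positivity)]
  gcongr
  have hx : (0 : ℝ) < 1 + 1 / ((n : ℝ) + 1) := by positivity
  rw [Real.rpow_def_of_pos hx]
  have h1 := Real.log_le_sub_one_of_pos hx
  have h2 := Real.add_one_le_exp (Real.log (1 + 1 / ((n : ℝ) + 1)) * -p)
  have h3 : p * Real.log (1 + 1 / ((n : ℝ) + 1)) ≤ p * (1 / ((n : ℝ) + 1)) := by
    gcongr; linarith
  have : p * (1 / ((n : ℝ) + 1)) = p / ((n : ℝ) + 1) := by ring
  linarith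

lemma tendsto_succ_rpow_sub_one (hβ : β ∈ Set.Ioc (0 : ℝ) 1) :
    Tendsto (fun n : ℕ => ((n : ℝ) + 1) ^ (β - 1)) atTop (𝓝 (indOne β)) := by
  unfold indOne
  split_ifs with h
  · simp [h]
  · have : 0 < 1 - β := by have := lt_of_le_of_ne hβ.2 h; linarith
    simpa using tendsto_succ_rpow_neg this

/-- A constant as in `RateBound` exists if `s < c γ₁` in the critical case `β = 1`: the sequence
`n^{-βs}` decays at relative rate `βs / n`, which is slower than the contraction `c γ`. -/
theorem exists_rateBound {c C s : ℝ} (hγ₁ : 0 < γ₁) (hβ : β ∈ Set.Ioc (0 : ℝ) 1) (hs : 0 < s)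
    (hc : 0 < c) (hC : 0 ≤ C) (hcrit : β = 1 → s < c * γ₁) :
    ∃ K, RateBound γ₁ β c C s K := by
  set r : ℕ → ℝ := fun n => ((n : ℝ) + 1) ^ (-(β * s)) with hr
  have hr0 : ∀ n, 0 < r n := fun n => by simp only [hr]; positivity
  have hβs : 0 < β * s := mul_pos hβ.1 hs
  -- any fixed number of iterations is harmless
  have hfin : ∀ n : ℕ, ∃ B : ℝ, 0 ≤ B ∧ ∀ D : ℝ, 0 ≤ D → ∀ y : ℕ → ℝ, (∀ n, 0 ≤ y n) → y 0 ≤ D →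
      (∀ n, y (n + 1) ≤ (1 - c * step γ₁ β n + C * step γ₁ β n ^ 2) * y n
        + D * ((n : ℝ) + 1) ^ (-(β * (1 + s)))) → y n ≤ B * D := by
    intro n
    induction n with
    | zero => exact ⟨1, zero_le_one, fun D hD y hy h0 _ => by simpa using h0⟩
    | succ n ih =>
      obtain ⟨B, hB, h⟩ := ih
      refine ⟨(1 + C * step γ₁ β n ^ 2) * B + ((n : ℝ) + 1) ^ (-(β * (1 + s))), by positivity, ?_⟩
      intro D hD y hy h0 hrec
      have h1 := h D hD y hy h0 hrec
      have h2 := hrec n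
      have h3 : (1 - c * step γ₁ β n + C * step γ₁ β n ^ 2) * y n
          ≤ (1 + C * step γ₁ β n ^ 2) * (B * D) := by
        have : 0 ≤ c * step γ₁ β n := mul_nonneg hc.le (step_pos hγ₁ n).le
        calc _ ≤ (1 + C * step γ₁ β n ^ 2) * y n := by
              apply mul_le_mul_of_nonneg_right _ (hy n); linarith
          _ ≤ _ := by gcongr
      linarith
  choose B hB hBy using hfin
  -- the asymptotic contraction beats the decay of `r`
  have hlim : Tendsto (fun n : ℕ => β * s / γ₁ * ((n : ℝ) + 1) ^ (β - 1) + C * step γ₁ β n) atTop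
      (𝓝 (β * s / γ₁ * indOne β + C * 0)) :=
    ((tendsto_succ_rpow_sub_one hβ).const_mul _).add ((tendsto_step hβ.1).const_mul _)
  have hLc : β * s / γ₁ * indOne β + C * 0 < c := by
    unfold indOne
    split_ifs with h
    · have := hcrit h
      rw [h, mul_one, mul_zero, add_zero, one_mul, div_lt_iff₀ hγ₁]; exact this
    · simpa using hc
  set L := β * s / γ₁ * indOne β + C * 0
  have hη : 0 < (c - L) / 2 := by linarith
  have hev1 := hlim.eventually_lt_const (show L < c - (c - L) / 2 by linarith)
  have hev2 : ∀ᶠ n in atTop, c * step γ₁ β n < 1 := by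
    have : Tendsto (fun n => c * step γ₁ β n) atTop (𝓝 (c * 0)) := (tendsto_step hβ.1).const_mul _
    exact this.eventually_lt_const (by simp)
  obtain ⟨N, hN⟩ := eventually_atTop.1 (hev1.and hev2)
  set η := (c - L) / 2
  have hstep : ∀ n ≥ N, (1 - c * step γ₁ β n + C * step γ₁ β n ^ 2) * r n + η * step γ₁ β n * r n
      ≤ r (n + 1) := by
    intro n hn
    have h1 := (hN n hn).1
    have hg := step_pos (β := β) hγ₁ n
    have hn1 : (0 : ℝ) < (n : ℝ) + 1 := by positivity
    have e : step γ₁ β n * (β * s / γ₁ * ((n : ℝ) + 1) ^ (β - 1)) = β * s / ((n : ℝ) + 1) := by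
      unfold step
      have : ((n : ℝ) + 1) ^ (-β) * ((n : ℝ) + 1) ^ (β - 1) = ((n : ℝ) + 1)⁻¹ := by
        rw [← Real.rpow_add hn1, ← Real.rpow_neg_one]; congr 1; ring
      calc _ = (γ₁ / γ₁) * (β * s) * (((n : ℝ) + 1) ^ (-β) * ((n : ℝ) + 1) ^ (β - 1)) := by ring
        _ = _ := by rw [this, div_self hγ₁.ne']; ring
    have h2 := mul_lt_mul_of_pos_left h1 hg
    have h3 := succ_rpow_neg_ge hβs.le n
    have h4 : 1 - c * step γ₁ β n + C * step γ₁ β n ^ 2 + η * step γ₁ β n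
        ≤ 1 - β * s / ((n : ℝ) + 1) := by
      rw [mul_add, e] at h2; nlinarith
    calc _ = r n * (1 - c * step γ₁ β n + C * step γ₁ β n ^ 2 + η * step γ₁ β n) := by ring
      _ ≤ r n * (1 - β * s / ((n : ℝ) + 1)) := mul_le_mul_of_nonneg_left h4 (hr0 n).le
      _ ≤ r (n + 1) := h3
  have hK0 : ∀ n, 0 ≤ B n / r n := fun n => div_nonneg (hB n) (hr0 n).le
  set K := 1 / (γ₁ * η) + ∑ n ∈ Finset.range (N + 1), B n / r n with hK
  have hKpos : 0 ≤ K := add_nonneg (by positivity) (Finset.sum_nonneg fun n _ => hK0 n)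
  refine ⟨K, hKpos, fun D hD y hy h0 hrec => ?_⟩
  have hsmall : ∀ n ≤ N, y n ≤ K * D * r n := by
    intro n hn
    have h1 := hBy n D hD y hy h0 hrec
    have h2 : B n / r n ≤ K := by
      have := Finset.single_le_sum (f := fun n => B n / r n) (fun n _ => hK0 n)
        (Finset.mem_range.2 (Nat.lt_succ_of_le hn))
      have : 0 ≤ 1 / (γ₁ * η) := by positivity
      linarith
    have h3 : B n ≤ K * r n := by rwa [div_le_iff₀ (hr0 n)] at h2
    nlinarith
  intro n
  rcases le_total n N with hn | hn
  · exact hsmall n hn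
  induction n, hn using Nat.le_induction with
  | base => exact hsmall N le_rfl
  | succ n hn ih =>
    have hg := step_pos (β := β) hγ₁ n
    have hF : 0 ≤ 1 - c * step γ₁ β n + C * step γ₁ β n ^ 2 := by
      have := (hN n hn).2
      have : 0 ≤ C * step γ₁ β n ^ 2 := by positivity
      linarith
    have e : ((n : ℝ) + 1) ^ (-(β * (1 + s))) = step γ₁ β n / γ₁ * r n := by
      simp only [step, hr]
      rw [mul_div_cancel_left₀ _ hγ₁.ne', ← Real.rpow_add (by positivity)]
      congr 1; ring
    have hKη : 1 / γ₁ ≤ K * η := by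
      have : 1 / (γ₁ * η) ≤ K := le_add_of_nonneg_right (Finset.sum_nonneg fun n _ => hK0 n)
      calc 1 / γ₁ = 1 / (γ₁ * η) * η := by field_simp
        _ ≤ K * η := by gcongr
    have h6 : D * (step γ₁ β n / γ₁ * r n) ≤ K * D * (η * step γ₁ β n * r n) := by
      have : 0 ≤ D * step γ₁ β n * r n := by have := hr0 n; positivity
      calc _ = (D * step γ₁ β n * r n) * (1 / γ₁) := by ring
        _ ≤ (D * step γ₁ β n * r n) * (K * η) := by gcongr
        _ = _ := by ring
    have h7 := mul_le_mul_of_nonneg_left ih hF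
    have h8 := mul_le_mul_of_nonneg_left (hstep n hn) (mul_nonneg hKpos hD)
    have h9 := hrec n
    rw [e] at h9
    calc y (n + 1) ≤ _ := h9
      _ ≤ (1 - c * step γ₁ β n + C * step γ₁ β n ^ 2) * (K * D * r n)
          + K * D * (η * step γ₁ β n * r n) := add_le_add h7 h6
      _ = K * D * ((1 - c * step γ₁ β n + C * step γ₁ β n ^ 2) * r n + η * step γ₁ β n * r n) := by
          ring
      _ ≤ _ := h8

/-- A sequence that contracts by `1 - c γ` at each step up to a forcing term `o(γ)` vanishes. -/
theorem tendsto_zero_of_contraction {c : ℝ} (hγ₁ : 0 < γ₁) (hβ : β ∈ Set.Ioc (0 : ℝ) 1)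
    (hc : 0 < c) {y e : ℕ → ℝ} (hy : ∀ n, 0 ≤ y n) (he : Tendsto e atTop (𝓝 0))
    (hrec : ∀ᶠ n in atTop, y (n + 1) ≤ (1 - c * step γ₁ β n) * y n + step γ₁ β n * e n) :
    Tendsto y atTop (𝓝 0) := by
  have key : ∀ ε > 0, ∀ᶠ n in atTop, y n < 2 * ε := by
    intro ε hε
    have hev2 : ∀ᶠ n in atTop, c * step γ₁ β n < 1 := by
      have : Tendsto (fun n => c * step γ₁ β n) atTop (𝓝 (c * 0)) :=
        (tendsto_step hβ.1).const_mul _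
      exact this.eventually_lt_const (by simp)
    obtain ⟨N, hN⟩ := eventually_atTop.1
      ((hrec.and (he.eventually_lt_const (show 0 < c * ε by positivity))).and hev2)
    -- the excess over `ε` contracts from time `N` on
    set w : ℕ → ℝ := fun n => max (y n - ε) 0 with hw
    have hw0 : ∀ n, 0 ≤ w n := fun n => le_max_right _ _
    have hwrec : ∀ n ≥ N, w (n + 1) ≤ (1 - c * step γ₁ β n) * w n := by
      intro n hn
      obtain ⟨⟨h1, h2⟩, h3⟩ := hN n hn
      have hg := step_pos (β := β) hγ₁ n
      have h4 : 0 ≤ (1 - c * step γ₁ β n) * w n := mul_nonneg (by linarith) (hw0 n)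
      refine max_le ?_ h4
      have h5 : (1 - c * step γ₁ β n) * (y n - ε) ≤ (1 - c * step γ₁ β n) * w n :=
        mul_le_mul_of_nonneg_left (le_max_left _ _) (by linarith)
      nlinarith
    set s : ℝ := c * γ₁ / 2 with hs
    have hs0 : 0 < s := by positivity
    set C : ℝ := c ^ 2
    obtain ⟨K, hK0, hK⟩ :=
      exists_rateBound (γ₁ := γ₁) (β := β) (c := c) (C := C) (s := s) hγ₁ hβ hs0
      hc (by positivity) (fun _ => by rw [hs]; have : 0 < c * γ₁ := by positivity
                                      linarith)
    -- the finitely many terms before `N` are absorbed in the forcing constant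
    set b : ℕ → ℝ := fun n => ((n : ℝ) + 1) ^ (-(β * (1 + s))) with hb
    have hb0 : ∀ n, 0 < b n := fun n => by simp only [hb]; positivity
    set D : ℝ := w 0 + ∑ n ∈ Finset.range N, w (n + 1) / b n with hD
    have hsum : ∀ n ∈ Finset.range N, 0 ≤ w (n + 1) / b n :=
      fun n _ => div_nonneg (hw0 _) (hb0 n).le
    have hD0 : 0 ≤ D := add_nonneg (hw0 0) (Finset.sum_nonneg hsum)
    have hwb := hK D hD0 w hw0 (le_add_of_nonneg_right (Finset.sum_nonneg hsum)) (fun n => by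
      have hF : 0 ≤ 1 - c * step γ₁ β n + C * step γ₁ β n ^ 2 := by
        simp only [C]; nlinarith [sq_nonneg (c * step γ₁ β n - 1), sq_nonneg (c * step γ₁ β n)]
      rcases lt_or_ge n N with hn | hn
      · have h1 := Finset.single_le_sum hsum (Finset.mem_range.2 hn)
        have h2 : w (n + 1) / b n ≤ D := h1.trans (le_add_of_nonneg_left (hw0 0))
        rw [div_le_iff₀ (hb0 n)] at h2
        have := mul_nonneg hF (hw0 n)
        exact h2.trans (le_add_of_nonneg_left this)
      · have h1 := hwrec n hn
        have h2 : 0 ≤ C * step γ₁ β n ^ 2 * w n :=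
          mul_nonneg (by positivity) (hw0 n)
        have h3 : 0 ≤ D * b n := mul_nonneg hD0 (hb0 n).le
        change w (n + 1) ≤ _ + D * b n
        nlinarith)
    have hlim : Tendsto (fun n : ℕ => K * D * ((n : ℝ) + 1) ^ (-(β * s))) atTop (𝓝 (K * D * 0)) :=
      (tendsto_succ_rpow_neg (mul_pos hβ.1 hs0)).const_mul _
    filter_upwards [hlim.eventually_lt_const (show K * D * 0 < ε by simpa using hε)] with n hn
    have := (le_max_left (y n - ε) 0).trans (hwb n)
    linarith
  rw [Metric.tendsto_atTop]
  intro ε hε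
  obtain ⟨N, hN⟩ := eventually_atTop.1 (key (ε / 2) (by positivity))
  refine ⟨N, fun n hn => ?_⟩
  rw [Real.dist_eq, sub_zero, abs_of_nonneg (hy n)]
  linarith [hN n hn]

end Deterministic

/-- The solution of `y_{n+1} = (1 - g_n m) y_n + g_n e_n` started at `y₀`. -/
def linRec (m : ℝ) (g : ℕ → ℝ) (y₀ : ℝ) (e : ℕ → ℝ) : ℕ → ℝ
  | 0 => y₀
  | n + 1 => (1 - g n * m) * linRec m g y₀ e n + g n * e n

/-- The weight of `e_k` in the value at time `n` of `linRec m g 0 e`. -/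
def coeff (m : ℝ) (g : ℕ → ℝ) (n k : ℕ) : ℝ := g k * ∏ j ∈ Finset.Ico (k + 1) n, (1 - g j * m)

lemma coeff_succ (m : ℝ) (g : ℕ → ℝ) {n k : ℕ} (h : k < n) :
    coeff m g (n + 1) k = (1 - g n * m) * coeff m g n k := by
  unfold coeff
  rw [Finset.prod_Ico_succ_top (by omega)]; ring

lemma coeff_succ_self (m : ℝ) (g : ℕ → ℝ) (n : ℕ) : coeff m g (n + 1) n = g n := by
  simp [coeff]

lemma sum_coeff_pow_succ (m : ℝ) (g : ℕ → ℝ) (p n : ℕ) :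
    ∑ k ∈ Finset.range (n + 1), coeff m g (n + 1) k ^ p =
      (1 - g n * m) ^ p * ∑ k ∈ Finset.range n, coeff m g n k ^ p + g n ^ p := by
  rw [Finset.sum_range_succ, coeff_succ_self, Finset.mul_sum]
  congr 1
  refine Finset.sum_congr rfl fun k hk => ?_
  rw [coeff_succ m g (Finset.mem_range.1 hk), mul_pow]

lemma linRec_zero_eq_sum (m : ℝ) (g : ℕ → ℝ) (e : ℕ → ℝ) (n : ℕ) :
    linRec m g 0 e n = ∑ k ∈ Finset.range n, coeff m g n k * e k := by
  induction n with
  | zero => simp [linRec]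
  | succ n ih =>
    rw [linRec, Finset.sum_range_succ, coeff_succ_self, ih, Finset.mul_sum]
    congr 1
    refine Finset.sum_congr rfl fun k hk => ?_
    rw [coeff_succ m g (Finset.mem_range.1 hk), mul_assoc]

section Deterministic

variable {γ₁ β : ℝ}

lemma step_ratio (hγ₁ : 0 < γ₁) (n : ℕ) :
    step γ₁ β n / step γ₁ β (n + 1) = (1 + 1 / ((n : ℝ) + 1)) ^ β := by
  unfold step
  have hn : (0 : ℝ) < (n : ℝ) + 1 := by positivity
  have e : (((n + 1 : ℕ) : ℝ) + 1) = ((n : ℝ) + 1) * (1 + 1 / ((n : ℝ) + 1)) := by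
    push_cast; field_simp
  rw [e, Real.mul_rpow hn.le (by positivity), mul_div_mul_left _ _ hγ₁.ne',
    Real.rpow_neg (x := 1 + 1 / ((n : ℝ) + 1)) (by positivity)]
  have : (0 : ℝ) < ((n : ℝ) + 1) ^ (-β) := by positivity
  field_simp

lemma step_ratio_mem (hγ₁ : 0 < γ₁) (hβ : β ∈ Set.Ioc (0 : ℝ) 1) (n : ℕ) :
    1 ≤ step γ₁ β n / step γ₁ β (n + 1) ∧
      step γ₁ β n / step γ₁ β (n + 1) ≤ 1 + 1 / ((n : ℝ) + 1) := by
  rw [step_ratio hγ₁]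
  have h1 : (1 : ℝ) ≤ 1 + 1 / ((n : ℝ) + 1) := le_add_of_nonneg_right (by positivity)
  refine ⟨Real.one_le_rpow h1 hβ.1.le, ?_⟩
  calc _ ≤ (1 + 1 / ((n : ℝ) + 1)) ^ (1 : ℝ) := Real.rpow_le_rpow_of_exponent_le h1 hβ.2
    _ = _ := Real.rpow_one _

lemma tendsto_one_div_succ : Tendsto (fun n : ℕ => 1 / ((n : ℝ) + 1)) atTop (𝓝 0) :=
  tendsto_one_div_add_atTop_nhds_zero_nat

lemma tendsto_step_ratio (hγ₁ : 0 < γ₁) (hβ : β ∈ Set.Ioc (0 : ℝ) 1) :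
    Tendsto (fun n => step γ₁ β n / step γ₁ β (n + 1)) atTop (𝓝 1) := by
  refine tendsto_of_tendsto_of_tendsto_of_le_of_le tendsto_const_nhds
    (h := fun n : ℕ => 1 + 1 / ((n : ℝ) + 1)) ?_ (fun n => (step_ratio_mem hγ₁ hβ n).1)
    (fun n => (step_ratio_mem hγ₁ hβ n).2)
  simpa using tendsto_one_div_succ.const_add 1

lemma tendsto_step_ratio_sub_one_div (hγ₁ : 0 < γ₁) (hβ : β ∈ Set.Ioc (0 : ℝ) 1) :
    Tendsto (fun n => (step γ₁ β n / step γ₁ β (n + 1) - 1) / step γ₁ β n) atTop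
      (𝓝 (γ₁⁻¹ * indOne β)) := by
  by_cases h : β = 1
  · subst h
    have : ∀ n : ℕ, (step γ₁ 1 n / step γ₁ 1 (n + 1) - 1) / step γ₁ 1 n = γ₁⁻¹ := by
      intro n
      rw [step_ratio hγ₁, Real.rpow_one, step, Real.rpow_neg_one]
      field_simp; ring
    simp only [this, indOne, if_true, mul_one]
    exact tendsto_const_nhds
  · have h0 : indOne β = 0 := by simp [indOne, h]
    have hl := tendsto_succ_rpow_sub_one hβ
    rw [h0] at hl
    have hl' := hl.const_mul γ₁⁻¹
    rw [h0]
    rw [mul_zero] at hl' ⊢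
    refine squeeze_zero (fun n => ?_) (fun n => ?_) hl'
    · exact div_nonneg (by linarith [(step_ratio_mem hγ₁ hβ n).1]) (step_pos hγ₁ n).le
    · have h1 := (step_ratio_mem hγ₁ hβ n).2
      rw [div_le_iff₀ (step_pos hγ₁ n)]
      have hn1 : (0 : ℝ) < (n : ℝ) + 1 := by positivity
      have e : γ₁⁻¹ * ((n : ℝ) + 1) ^ (β - 1) * step γ₁ β n = 1 / ((n : ℝ) + 1) := by
        unfold step
        have : ((n : ℝ) + 1) ^ (β - 1) * ((n : ℝ) + 1) ^ (-β) = ((n : ℝ) + 1)⁻¹ := by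
          rw [← Real.rpow_add hn1, ← Real.rpow_neg_one]; congr 1; ring
        calc _ = (γ₁⁻¹ * γ₁) * (((n : ℝ) + 1) ^ (β - 1) * ((n : ℝ) + 1) ^ (-β)) := by ring
          _ = _ := by rw [this, inv_mul_cancel₀ hγ₁.ne']; ring
      rw [e]; linarith

/-- The variance of the linear recursion driven by white noise is asymptotically proportional to the
step. In the critical case `β = 1` the decrease of the steps contributes the term `γ₁⁻¹`. -/
theorem tendsto_sum_coeff_sq_div {m : ℝ} (hγ₁ : 0 < γ₁) (hβ : β ∈ Set.Ioc (0 : ℝ) 1)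
    (hm : 0 < 2 * m - γ₁⁻¹ * indOne β) :
    Tendsto (fun n => (∑ k ∈ Finset.range n, coeff m (step γ₁ β) n k ^ 2) / step γ₁ β n) atTop
      (𝓝 (2 * m - γ₁⁻¹ * indOne β)⁻¹) := by
  set κ := 2 * m - γ₁⁻¹ * indOne β with hκ
  set g := step γ₁ β with hg
  set q : ℕ → ℝ := fun n => ∑ k ∈ Finset.range n, coeff m g n k ^ 2 with hq
  have hg0 : ∀ n, 0 < g n := step_pos hγ₁
  have hgt : Tendsto g atTop (𝓝 0) := tendsto_step hβ.1
  set A : ℕ → ℝ := fun n => (1 - g n * m) ^ 2 * (g n / g (n + 1)) with hA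
  have hA0 : ∀ n, 0 ≤ A n := fun n => mul_nonneg (sq_nonneg _) (div_pos (hg0 _) (hg0 _)).le
  have hρ := tendsto_step_ratio hγ₁ hβ
  have hAlim : Tendsto (fun n => (A n - 1) / g n) atTop (𝓝 (-κ)) := by
    have h1 : Tendsto (fun n => (-2 * m + g n * m ^ 2) * (g n / g (n + 1))
        + (g n / g (n + 1) - 1) / g n) atTop
        (𝓝 ((-2 * m + 0 * m ^ 2) * 1 + γ₁⁻¹ * indOne β)) :=
      (((hgt.mul_const _).const_add _).mul hρ).add (tendsto_step_ratio_sub_one_div hγ₁ hβ)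
    have e : (-2 * m + 0 * m ^ 2) * 1 + γ₁⁻¹ * indOne β = -κ := by rw [hκ]; ring
    rw [e] at h1
    refine h1.congr fun n => ?_
    have := (hg0 n).ne'
    simp only [hA]
    generalize g n / g (n + 1) = ρ
    field_simp; ring
  set e : ℕ → ℝ := fun n => |(A n - 1) / g n * κ⁻¹ + g n / g (n + 1)| with he
  have helim : Tendsto e atTop (𝓝 0) := by
    have h1 := ((hAlim.mul_const κ⁻¹).add hρ).abs
    have e1 : |(-κ * κ⁻¹ + 1)| = 0 := by
      rw [neg_mul, mul_inv_cancel₀ hm.ne']; simp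
    rwa [e1] at h1
  have hz := tendsto_zero_of_contraction (γ₁ := γ₁) (β := β) (c := κ / 2)
    (y := fun n => |q n / g n - κ⁻¹|) (e := e) hγ₁ hβ (by positivity)
    (fun n => abs_nonneg _) helim ?_
  · have h1 := (tendsto_zero_iff_abs_tendsto_zero _).2 hz
    simpa using h1.add_const κ⁻¹
  · filter_upwards [hAlim.eventually_lt_const (show -κ < -(κ / 2) by linarith)] with n hn
    have hgn := hg0 n
    have hgn1 := hg0 (n + 1)
    have hA1 : A n ≤ 1 - κ / 2 * g n := by
      rw [div_lt_iff₀ hgn] at hn; linarith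
    have hrec : q (n + 1) / g (n + 1) - κ⁻¹
        = A n * (q n / g n - κ⁻¹) + g n * ((A n - 1) / g n * κ⁻¹ + g n / g (n + 1)) := by
      simp only [hq, hA]
      rw [sum_coeff_pow_succ]
      field_simp
      ring
    rw [hrec]
    refine (abs_add_le _ _).trans ?_
    rw [abs_mul (A n), abs_mul (g n), abs_of_nonneg (hA0 n), abs_of_pos hgn]
    gcongr

theorem tendsto_sum_coeff {m : ℝ} (hγ₁ : 0 < γ₁) (hβ : β ∈ Set.Ioc (0 : ℝ) 1) (hm : 0 < m) :
    Tendsto (fun n => ∑ k ∈ Finset.range n, coeff m (step γ₁ β) n k) atTop (𝓝 m⁻¹) := by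
  have hgt : Tendsto (fun n => step γ₁ β n * m) atTop (𝓝 (0 * m)) := (tendsto_step hβ.1).mul_const m
  have hz := tendsto_zero_of_contraction (γ₁ := γ₁) (β := β) (c := m)
    (y := fun n => |∑ k ∈ Finset.range n, coeff m (step γ₁ β) n k - m⁻¹|) (e := fun _ => 0)
    hγ₁ hβ hm (fun n => abs_nonneg _) tendsto_const_nhds ?_
  · simpa using ((tendsto_zero_iff_abs_tendsto_zero _).2 hz).add_const m⁻¹
  · filter_upwards [hgt.eventually_lt_const (show 0 * m < 1 by simp)] with n hn
    have h1 := sum_coeff_pow_succ m (step γ₁ β) 1 n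
    simp only [pow_one] at h1
    have e : (1 - step γ₁ β n * m) * ∑ k ∈ Finset.range n, coeff m (step γ₁ β) n k + step γ₁ β n
        - m⁻¹ = (1 - step γ₁ β n * m) * (∑ k ∈ Finset.range n, coeff m (step γ₁ β) n k - m⁻¹) := by
      field_simp; ring
    rw [h1, e, abs_mul, abs_of_pos (by linarith), mul_zero, add_zero, mul_comm m]

/-- The weights are uniformly negligible compared with their `ℓ²` norm: their fourth powers add up
to `O(n^{-3β})`, whereas their squares add up to a multiple of `n^{-β}`. -/
theorem exists_sum_coeff_pow_four_le {m : ℝ} (hγ₁ : 0 < γ₁) (hβ : β ∈ Set.Ioc (0 : ℝ) 1)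
    (hm : 0 < m) (hcrit : β = 1 → 3 < 4 * m * γ₁) :
    ∃ K, ∀ n, ∑ k ∈ Finset.range n, coeff m (step γ₁ β) n k ^ 4 ≤
      K * ((n : ℝ) + 1) ^ (-(β * 3)) := by
  obtain ⟨K, hK0, hK⟩ := exists_rateBound (γ₁ := γ₁) (β := β) (c := 4 * m)
    (C := 6 * m ^ 2 + m ^ 4 * γ₁ ^ 2) (s := 3) hγ₁ hβ (by norm_num) (by positivity) (by positivity)
    hcrit
  refine ⟨K * γ₁ ^ 4, hK (γ₁ ^ 4) (by positivity) _
    (fun n => Finset.sum_nonneg fun k _ => by positivity)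
    (by simp; positivity) fun n => ?_⟩
  rw [sum_coeff_pow_succ]
  have hg := step_pos (β := β) hγ₁ n
  have hg1 := step_le hγ₁ hβ.1.le n
  have h4 : step γ₁ β n ^ 4 = γ₁ ^ 4 * ((n : ℝ) + 1) ^ (-(β * (1 + 3))) := by
    rw [step, mul_pow, ← Real.rpow_natCast, ← Real.rpow_natCast, ← Real.rpow_mul (by positivity)]
    congr 2; push_cast; ring
  rw [h4]
  gcongr
  set x := step γ₁ β n
  have h5 : x ^ 2 ≤ γ₁ ^ 2 := by gcongr
  have h6 : m ^ 4 * x ^ 2 * x ^ 2 ≤ m ^ 4 * γ₁ ^ 2 * x ^ 2 := by gcongr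
  have h7 : 0 ≤ 4 * (x * m) ^ 3 := by positivity
  nlinarith

end Deterministic

/-! ### Independent innovations and orthogonality of martingale increments -/

section Innovations

variable {Ω E 𝒳 : Type*} {mΩ : MeasurableSpace Ω} [MeasurableSpace E] [m𝒳 : MeasurableSpace 𝒳]
  {P : Measure Ω}

/-- The sequence `x` consists of innovations of law `ρ` for the filtration `ℱ`: `x n` is
`ℱ (n + 1)`-measurable, independent of `ℱ n`, and has law `ρ`. -/
structure Innovations (P : Measure Ω) (ρ : Measure 𝒳) (ℱ : Filtration ℕ mΩ) (x : ℕ → Ω → 𝒳) :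
    Prop where
  adapted : ∀ n, Measurable[ℱ (n + 1)] (x n)
  indep : ∀ n, Indep (ℱ n) (MeasurableSpace.comap (x n) m𝒳) P
  map_eq : ∀ n, P.map (x n) = ρ

lemma indepFun_prodMk_left [IsProbabilityMeasure P] {F G : Type*}
    [MeasurableSpace F] [MeasurableSpace G] {A : Ω → E}
    {B : Ω → F} {C : Ω → G} (hA : Measurable A) (hB : Measurable B) (hC : Measurable C)
    (h₁ : IndepFun A (fun ω => (B ω, C ω)) P) (h₂ : IndepFun B C P) :
    IndepFun (fun ω => (A ω, B ω)) C P := by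
  rw [indepFun_iff_map_prod_eq_prod_map_map (hA.prodMk hB).aemeasurable hC.aemeasurable]
  have e₂ := (indepFun_iff_map_prod_eq_prod_map_map hB.aemeasurable hC.aemeasurable).1 h₂
  have e₁ := (indepFun_iff_map_prod_eq_prod_map_map hA.aemeasurable
    (hB.prodMk hC).aemeasurable).1 h₁
  have h₃ : IndepFun A B P := h₁.comp measurable_id measurable_fst
  have e₃ := (indepFun_iff_map_prod_eq_prod_map_map hA.aemeasurable hB.aemeasurable).1 h₃
  have := Measure.isProbabilityMeasure_map (μ := P) hA.aemeasurable
  have := Measure.isProbabilityMeasure_map (μ := P) hB.aemeasurable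
  have := Measure.isProbabilityMeasure_map (μ := P) hC.aemeasurable
  rw [e₃]
  rw [e₂, ← (measurePreserving_prodAssoc (P.map A) (P.map B) (P.map C)).map_eq] at e₁
  have h4 : P.map (fun ω => ((A ω, B ω), C ω)) =
      (P.map (fun ω => (A ω, (B ω, C ω)))).map MeasurableEquiv.prodAssoc.symm := by
    rw [Measure.map_map MeasurableEquiv.prodAssoc.symm.measurable (hA.prodMk (hB.prodMk hC))]
    rfl
  rw [h4, e₁, MeasurableEquiv.map_symm_map]

/-- An i.i.d. sequence independent of `ξ₀` has measurable versions which are innovations for a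
filtration whose initial σ-algebra contains that of `ξ₀`. -/
theorem exists_innovations [IsProbabilityMeasure P] {ξ₀ : Ω → E}
    {x : ℕ → Ω → 𝒳} {ρ : Measure 𝒳} (hξ₀ : Measurable ξ₀)
    (hx : ∀ n, AEMeasurable (x n) P) (hρ : ∀ n, P.map (x n) = ρ) (hind : iIndepFun x P)
    (hind₀ : IndepFun ξ₀ (fun ω n => x n ω) P) :
    ∃ x' : ℕ → Ω → 𝒳, (∀ n, Measurable (x' n)) ∧ (∀ n, x' n =ᵐ[P] x n) ∧ iIndepFun x' P ∧
      ∃ ℱ : Filtration ℕ mΩ, Measurable[ℱ 0] ξ₀ ∧ Innovations P ρ ℱ x' := by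
  set x' : ℕ → Ω → 𝒳 := fun n => (hx n).mk (x n) with hx'
  have hm : ∀ n, Measurable (x' n) := fun n => (hx n).measurable_mk
  have hae : ∀ n, x' n =ᵐ[P] x n := fun n => (hx n).ae_eq_mk.symm
  have hind' : iIndepFun x' P := hind.congr fun n => (hae n).symm
  have hind₀' : IndepFun ξ₀ (fun ω n => x' n ω) P := by
    refine hind₀.congr (EventuallyEq.refl _ _) ?_
    filter_upwards [ae_all_iff.2 hae] with ω hω
    funext n; exact (hω n).symm
  set W : ∀ n : ℕ, Ω → E × (Finset.range n → 𝒳) := fun n ω => (ξ₀ ω, fun k => x' k ω) with hW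
  have hWm : ∀ n, Measurable (W n) := fun n =>
    hξ₀.prodMk (measurable_pi_lambda _ fun k => hm k)
  let ℱ : Filtration ℕ mΩ :=
    { seq := fun n => MeasurableSpace.comap (W n) inferInstance
      mono' := by
        intro i j hij
        let π : E × (Finset.range j → 𝒳) → E × (Finset.range i → 𝒳) :=
          fun p => (p.1, fun k => p.2 ⟨k, Finset.mem_range.2
            ((Finset.mem_range.1 k.2).trans_le hij)⟩)
        have hπ : Measurable π := measurable_fst.prodMk
          (measurable_pi_lambda _ fun k => (measurable_pi_apply _).comp measurable_snd)
        have e : W i = π ∘ W j := rfl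
        change MeasurableSpace.comap (W i) _ ≤ MeasurableSpace.comap (W j) _
        rw [e, ← MeasurableSpace.comap_comp]
        exact MeasurableSpace.comap_mono hπ.comap_le
      le' := fun n => (hWm n).comap_le }
  refine ⟨x', hm, hae, hind', ℱ, ?_, ?_, ?_, ?_⟩
  · exact measurable_fst.comp (comap_measurable (W 0))
  · intro n
    exact ((measurable_pi_apply (⟨n, Finset.self_mem_range_succ n⟩ : Finset.range (n + 1))).comp
      measurable_snd).comp (comap_measurable (W (n + 1)))
  · intro n
    have h2 : IndepFun (fun ω (k : Finset.range n) => x' k ω) (x' n) P := by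
      have := hind'.indepFun_finset (Finset.range n) {n} (by simp) hm
      exact this.comp measurable_id (measurable_pi_apply (⟨n, by simp⟩ : ({n} : Finset ℕ)))
    have h1 : IndepFun ξ₀ (fun ω => ((fun k : Finset.range n => x' k ω), x' n ω)) P := by
      have hφ : Measurable (fun z : ℕ → 𝒳 => ((fun k : Finset.range n => z k), z n)) := by
        fun_prop
      exact hind₀'.comp measurable_id hφ
    have hB : Measurable (fun ω (k : Finset.range n) => x' k ω) :=
      measurable_pi_lambda _ fun k => hm k
    exact indepFun_prodMk_left hξ₀ hB (hm n) h1 h2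
  · intro n
    rw [← hρ n]; exact Measure.map_congr (hae n)

namespace Innovations

variable {ρ : Measure 𝒳} {ℱ : Filtration ℕ mΩ} {x : ℕ → Ω → 𝒳} (hI : Innovations P ρ ℱ x)

include hI

lemma measurable (n : ℕ) : Measurable (x n) := (hI.adapted n).mono (ℱ.le _) le_rfl

variable [IsProbabilityMeasure P]

lemma isProbabilityMeasure : IsProbabilityMeasure ρ := by
  rw [← hI.map_eq 0]; exact Measure.isProbabilityMeasure_map (hI.measurable 0).aemeasurable

lemma map_prodMk {n : ℕ} {W : Ω → E} (hW : Measurable[ℱ n] W) :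
    P.map (fun ω => (W ω, x n ω)) = (P.map W).prod ρ := by
  have hW' : Measurable W := hW.mono (ℱ.le _) le_rfl
  have : IndepFun W (x n) P := indep_of_indep_of_le_left (hI.indep n) hW.comap_le
  rw [(indepFun_iff_map_prod_eq_prod_map_map hW'.aemeasurable (hI.measurable n).aemeasurable).1 this,
    hI.map_eq]

/-- An innovation may be integrated out, the past being frozen. -/
lemma integral_comp {n : ℕ} {W : Ω → E} (hW : Measurable[ℱ n] W) {g : E × 𝒳 → ℝ}
    (hg : Measurable g) (hint : Integrable (fun ω => g (W ω, x n ω)) P) :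
    ∫ ω, g (W ω, x n ω) ∂P = ∫ ω, ∫ y, g (W ω, y) ∂ρ ∂P := by
  have hW' : Measurable W := hW.mono (ℱ.le _) le_rfl
  have hpair : Measurable (fun ω => (W ω, x n ω)) := hW'.prodMk (hI.measurable n)
  have := hI.isProbabilityMeasure
  have := Measure.isProbabilityMeasure_map (μ := P) hW'.aemeasurable
  have hint' : Integrable g ((P.map W).prod ρ) := by
    rw [← hI.map_prodMk hW]
    exact (integrable_map_measure hg.aestronglyMeasurable hpair.aemeasurable).2 hint
  rw [← integral_map hpair.aemeasurable hg.aestronglyMeasurable (f := g), hI.map_prodMk hW,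
    integral_prod _ hint', integral_map hW'.aemeasurable]
  exact (hg.stronglyMeasurable.integral_prod_right').aestronglyMeasurable

lemma integral_comp_le {n : ℕ} {W : Ω → E} (hW : Measurable[ℱ n] W) {g : E × 𝒳 → ℝ}
    (hg : Measurable g) (hint : Integrable (fun ω => g (W ω, x n ω)) P) {b : E → ℝ}
    (hb : ∀ w, ∫ y, g (w, y) ∂ρ ≤ b w) (hb0 : ∀ w y, 0 ≤ g (w, y))
    (hbi : Integrable (fun ω => b (W ω)) P) :
    ∫ ω, g (W ω, x n ω) ∂P ≤ ∫ ω, b (W ω) ∂P := by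
  rw [hI.integral_comp hW hg hint]
  exact integral_mono_of_nonneg (ae_of_all _ fun ω => integral_nonneg fun y => hb0 _ _) hbi
    (ae_of_all _ fun ω => hb _)

/-- A function of the past is orthogonal to a conditionally centred function of the innovation. -/
lemma integral_mul_eq_zero {n : ℕ} {M : Ω → ℝ} (hM : Measurable[ℱ n] M) {W : Ω → E}
    (hW : Measurable[ℱ n] W) {g : E × 𝒳 → ℝ} (hg : Measurable g)
    (hg0 : ∀ w, ∫ y, g (w, y) ∂ρ = 0) :
    ∫ ω, M ω * g (W ω, x n ω) ∂P = 0 := by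
  by_cases hint : Integrable (fun ω => M ω * g (W ω, x n ω)) P
  · have h1 := hI.integral_comp (W := fun ω => (M ω, W ω)) (hM.prodMk hW)
      (g := fun p => p.1.1 * g (p.1.2, p.2)) (by fun_prop) hint
    simp only [integral_const_mul, hg0, mul_zero, integral_zero] at h1
    exact h1
  · exact integral_undef hint

lemma integral_add_sq {n : ℕ} {M : Ω → ℝ} (hM : Measurable[ℱ n] M) (hM2 : MemLp M 2 P) {W : Ω → E}
    (hW : Measurable[ℱ n] W) {g : E × 𝒳 → ℝ} (hg : Measurable g)
    (hg0 : ∀ w, ∫ y, g (w, y) ∂ρ = 0) (hg2 : MemLp (fun ω => g (W ω, x n ω)) 2 P) :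
    ∫ ω, (M ω + g (W ω, x n ω)) ^ 2 ∂P = ∫ ω, M ω ^ 2 ∂P + ∫ ω, g (W ω, x n ω) ^ 2 ∂P := by
  have h1 := hI.integral_mul_eq_zero hM hW hg hg0
  have e : ∀ ω, (M ω + g (W ω, x n ω)) ^ 2 =
      M ω ^ 2 + g (W ω, x n ω) ^ 2 + 2 * (M ω * g (W ω, x n ω)) := fun ω => by ring
  simp only [e]
  have i1 : Integrable (fun ω => M ω ^ 2 + g (W ω, x n ω) ^ 2) P :=
    hM2.integrable_sq.add hg2.integrable_sq
  have i2 : Integrable (fun ω => 2 * (M ω * g (W ω, x n ω))) P :=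
    (hM2.integrable_mul hg2).const_mul 2
  rw [integral_add i1 i2, integral_add hM2.integrable_sq hg2.integrable_sq, integral_const_mul, h1]
  ring

lemma integral_sum_sq {W : ℕ → Ω → E} (hW : ∀ n, Measurable[ℱ n] (W n)) {g : E × 𝒳 → ℝ}
    (hg : Measurable g) (hg0 : ∀ w, ∫ y, g (w, y) ∂ρ = 0)
    (hg2 : ∀ n, MemLp (fun ω => g (W n ω, x n ω)) 2 P) (n : ℕ) :
    ∫ ω, (∑ k ∈ Finset.range n, g (W k ω, x k ω)) ^ 2 ∂P =
      ∑ k ∈ Finset.range n, ∫ ω, g (W k ω, x k ω) ^ 2 ∂P := by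
  induction n with
  | zero => simp
  | succ n ih =>
    simp only [Finset.sum_range_succ]
    rw [hI.integral_add_sq (M := fun ω => ∑ k ∈ Finset.range n, g (W k ω, x k ω)) ?_ ?_ (hW n) hg
      hg0 (hg2 n), ih]
    · refine Finset.measurable_sum _ fun k hk => hg.comp (Measurable.prodMk ?_ ?_)
      · exact (hW k).mono (ℱ.mono (Finset.mem_range.1 hk).le) le_rfl
      · exact (hI.adapted k).mono (ℱ.mono (Finset.mem_range.1 hk)) le_rfl
    · exact memLp_finsetSum _ fun k _ => hg2 k

end Innovations

end Innovations

/-! ### Moment bounds for the iterates -/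

lemma exp_sub_one_sub_le {t : ℝ} (ht : 0 ≤ t) : Real.exp t - 1 - t ≤ t ^ 2 * Real.exp t := by
  have h1 := Real.add_one_le_exp (-t)
  have h2 : Real.exp (-t) * Real.exp t = 1 := by rw [← Real.exp_add]; simp
  have h3 := Real.exp_pos t
  have h4 : Real.exp t - 1 ≤ t * Real.exp t := by nlinarith
  nlinarith

lemma cosh_add_le (z t : ℝ) : Real.cosh (z + t) ≤ Real.cosh z * Real.exp |t| := by
  rw [Real.cosh_eq, Real.cosh_eq]
  have h1 : Real.exp (z + t) ≤ Real.exp z * Real.exp |t| := by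
    rw [← Real.exp_add]; exact Real.exp_le_exp.2 (by linarith [le_abs_self t])
  have h2 : Real.exp (-(z + t)) ≤ Real.exp (-z) * Real.exp |t| := by
    rw [← Real.exp_add]; exact Real.exp_le_exp.2 (by linarith [neg_abs_le t])
  linarith

lemma cosh_add_le_taylor (z t : ℝ) :
    Real.cosh (z + t) ≤
      Real.cosh z + t * Real.sinh z + t ^ 2 * Real.exp |t| * Real.cosh z := by
  rw [Real.cosh_add]
  have h1 : |Real.sinh z| ≤ Real.cosh z := by
    rw [Real.abs_sinh]
    exact (Real.sinh_lt_cosh _).le.trans_eq (Real.cosh_abs z)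
  have h2 : Real.cosh t - 1 + |Real.sinh t - t| ≤ t ^ 2 * Real.exp |t| := by
    have e1 : Real.cosh t = Real.cosh |t| := (Real.cosh_abs t).symm
    have e2 : |Real.sinh t - t| = Real.sinh |t| - |t| := by
      rcases le_total 0 t with h | h
      · rw [abs_of_nonneg h, abs_of_nonneg (by linarith [Real.self_le_sinh_iff.2 h])]
      · rw [abs_of_nonpos h, Real.sinh_neg,
          abs_of_nonpos (by linarith [Real.sinh_le_self_iff.2 h])]
        ring
    have h3 := exp_sub_one_sub_le (abs_nonneg t)
    have h4 := Real.cosh_add_sinh |t|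
    rw [sq_abs] at h3
    rw [e1, e2]; linarith
  have h5 : Real.sinh z * (Real.sinh t - t) ≤ Real.cosh z * |Real.sinh t - t| := by
    calc _ ≤ |Real.sinh z * (Real.sinh t - t)| := le_abs_self _
      _ = |Real.sinh z| * |Real.sinh t - t| := abs_mul _ _
      _ ≤ _ := by gcongr
  have h6 := mul_le_mul_of_nonneg_left h2 (Real.cosh_pos z).le
  nlinarith

lemma sq_div_two_le_cosh_sub_one (t : ℝ) : t ^ 2 / 2 ≤ Real.cosh t - 1 := by
  have h1 : Real.cosh t = 1 + 2 * Real.sinh (t / 2) ^ 2 := by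
    have h := Real.cosh_two_mul (t / 2)
    have h' := Real.cosh_sq (t / 2)
    rw [mul_div_cancel₀ t (two_ne_zero)] at h
    linarith
  have h2 : |t / 2| ≤ |Real.sinh (t / 2)| := by
    rw [Real.abs_sinh]; exact Real.self_le_sinh_iff.2 (abs_nonneg _)
  have h3 := sq_le_sq.2 h2
  rw [h1]; nlinarith

lemma abs_H₁_le {α : ℝ} (hα : α ∈ Set.Ioo (0 : ℝ) 1) (ξ x : ℝ) : |H₁ α ξ x| ≤ 1 / (1 - α) := by
  have h0 : 0 < 1 - α := by linarith [hα.2]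
  have h1 : 1 ≤ 1 / (1 - α) := by rw [le_div_iff₀ h0]; linarith [hα.1]
  unfold H₁
  split_ifs <;> rw [abs_le] <;> constructor <;> linarith

lemma measurable_H₁ (α : ℝ) : Measurable (fun p : ℝ × ℝ => H₁ α p.1 p.2) := by
  unfold H₁
  refine measurable_const.sub (measurable_const.mul ?_)
  exact Measurable.ite (measurableSet_le measurable_fst measurable_snd) measurable_const
    measurable_const

section Iterates

variable {Ω : Type*} {mΩ : MeasurableSpace Ω} {P : Measure Ω} [IsProbabilityMeasure P]
  {α γ₁ β : ℝ}

/-- The VaR iterates as a stochastic process. -/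
def varProc (α γ₁ β : ℝ) (ξ₀ : Ω → ℝ) (x : ℕ → Ω → ℝ) (n : ℕ) (ω : Ω) : ℝ :=
  varIter α (learningRate γ₁ β) (ξ₀ ω) (fun k => x k ω) n

omit mΩ in
lemma varProc_succ (ξ₀ : Ω → ℝ) (x : ℕ → Ω → ℝ) (n : ℕ) (ω : Ω) :
    varProc α γ₁ β ξ₀ x (n + 1) ω = varProc α γ₁ β ξ₀ x n ω
      - step γ₁ β n * H₁ α (varProc α γ₁ β ξ₀ x n ω) (x n ω) := by
  simp [varProc, varIter, learningRate_succ]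

variable {ρ : Measure ℝ} {ℱ : Filtration ℕ mΩ} {x : ℕ → Ω → ℝ} {ξ₀ : Ω → ℝ}

omit [IsProbabilityMeasure P] in
lemma measurable_varProc (hI : Innovations P ρ ℱ x) (hξ₀ : Measurable[ℱ 0] ξ₀) (n : ℕ) :
    Measurable[ℱ n] (varProc α γ₁ β ξ₀ x n) := by
  induction n with
  | zero => exact hξ₀
  | succ n ih =>
    have h1 : Measurable[ℱ (n + 1)] (varProc α γ₁ β ξ₀ x n) :=
      ih.mono (ℱ.mono n.le_succ) le_rfl
    have e : varProc α γ₁ β ξ₀ x (n + 1) = fun ω => varProc α γ₁ β ξ₀ x n ω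
      - step γ₁ β n * H₁ α (varProc α γ₁ β ξ₀ x n ω) (x n ω) := by
      funext ω; exact varProc_succ ξ₀ x n ω
    rw [e]
    exact h1.sub (((measurable_H₁ α).comp (h1.prodMk (hI.adapted n))).const_mul _)

/-- The Lyapunov function `cosh (a (ξ - z)) - 1` of the VaR iterates decays at the rate of the
steps. It is quadratic at the root `z` of the drift and exponential at infinity, which makes the
drift condition `hdrift` a global one. -/
theorem lyapunov_bound {a c C K D z : ℝ} (hα : α ∈ Set.Ioo (0 : ℝ) 1) (hγ₁ : 0 < γ₁)
    (hβ : β ∈ Set.Ioc (0 : ℝ) 1) (hI : Innovations P ρ ℱ x) (hξ₀ : Measurable[ℱ 0] ξ₀) (ha : 0 < a)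
    (hC : (a / (1 - α)) ^ 2 * Real.exp (a * γ₁ / (1 - α)) ≤ C)
    (hK : RateBound γ₁ β c C 1 K)
    (hdrift : ∀ ξ, c * (Real.cosh (a * (ξ - z)) - 1) ≤
      a * (∫ y, H₁ α ξ y ∂ρ) * Real.sinh (a * (ξ - z)))
    (h0 : Integrable (fun ω => Real.cosh (a * (ξ₀ ω - z))) P)
    (h0D : ∫ ω, (Real.cosh (a * (ξ₀ ω - z)) - 1) ∂P ≤ D) (hCD : C * γ₁ ^ 2 ≤ D) (n : ℕ) :
    Integrable (fun ω => Real.cosh (a * (varProc α γ₁ β ξ₀ x n ω - z))) P ∧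
    ∫ ω, (Real.cosh (a * (varProc α γ₁ β ξ₀ x n ω - z)) - 1) ∂P
      ≤ K * D * ((n : ℝ) + 1) ^ (-(β * 1)) := by
  have hα1 : 0 < 1 - α := by linarith [hα.2]
  have hC0 : 0 ≤ C := le_trans (by positivity) hC
  set X := varProc α γ₁ β ξ₀ x with hX
  have hXm : ∀ n, Measurable[ℱ n] (X n) := measurable_varProc hI hξ₀
  have hXm' : ∀ n, Measurable (X n) := fun n => (hXm n).mono (ℱ.le n) le_rfl
  have hHm : ∀ n, Measurable (fun ω => H₁ α (X n ω) (x n ω)) := fun n =>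
    (measurable_H₁ α).comp ((hXm' n).prodMk (hI.measurable n))
  have hg0 := step_pos (β := β) hγ₁
  have hg1 := step_le hγ₁ hβ.1.le
  -- one update moves the argument of `cosh` by at most `a γ / (1 - α)`
  have hincr : ∀ n ω, |-(a * step γ₁ β n * H₁ α (X n ω) (x n ω))| ≤ a * step γ₁ β n / (1 - α) := by
    intro n ω
    rw [abs_neg, abs_mul, abs_of_pos (mul_pos ha (hg0 n)), div_eq_mul_one_div]
    exact mul_le_mul_of_nonneg_left (abs_H₁_le hα _ _) (mul_pos ha (hg0 n)).le
  have hstep : ∀ n ω, a * (X (n + 1) ω - z)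
      = a * (X n ω - z) + -(a * step γ₁ β n * H₁ α (X n ω) (x n ω)) := by
    intro n ω
    rw [hX, varProc_succ]; ring
  have hint : ∀ n, Integrable (fun ω => Real.cosh (a * (X n ω - z))) P := by
    intro n
    induction n with
    | zero => exact h0
    | succ n ih =>
      refine (ih.mul_const (Real.exp (a * step γ₁ β n / (1 - α)))).mono' ?_ (ae_of_all _ fun ω => ?_)
      · exact (Real.measurable_cosh.comp
          (((hXm' (n + 1)).sub_const z).const_mul a)).aestronglyMeasurable
      · rw [Real.norm_of_nonneg (Real.cosh_pos _).le, hstep]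
        refine (cosh_add_le _ _).trans ?_
        have := hincr n ω
        have h1 := (Real.cosh_pos (a * (X n ω - z))).le
        gcongr
  refine ⟨hint n, ?_⟩
  have hnn : ∀ n, 0 ≤ ∫ ω, (Real.cosh (a * (X n ω - z)) - 1) ∂P := fun n =>
    integral_nonneg fun ω => sub_nonneg.2 (Real.one_le_cosh _)
  refine hK.2 D ((hnn 0).trans h0D) (fun n => ∫ ω, (Real.cosh (a * (X n ω - z)) - 1) ∂P) hnn h0D
    (fun n => ?_) n
  -- the one-step inequality
  have hsinh : Integrable (fun ω => Real.sinh (a * (X n ω - z))) P := by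
    refine (hint n).mono' (Real.measurable_sinh.comp
          (((hXm' n).sub_const z).const_mul a)).aestronglyMeasurable (ae_of_all _ fun ω => ?_)
    rw [Real.norm_eq_abs, Real.abs_sinh]
    exact (Real.sinh_lt_cosh _).le.trans_eq (Real.cosh_abs _)
  have hHs : Integrable (fun ω => H₁ α (X n ω) (x n ω) * Real.sinh (a * (X n ω - z))) P :=
    hsinh.bdd_mul (hHm n).aestronglyMeasurable (ae_of_all _ fun ω => abs_H₁_le hα _ _)
  have hfreeze := hI.integral_comp (hXm n)
    (g := fun p : ℝ × ℝ => H₁ α p.1 p.2 * Real.sinh (a * (p.1 - z)))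
    ((measurable_H₁ α).mul (Real.measurable_sinh.comp (by fun_prop))) hHs
  simp only [integral_mul_const] at hfreeze
  have hpt : ∀ ω, Real.cosh (a * (X (n + 1) ω - z)) - 1 ≤ (Real.cosh (a * (X n ω - z)) - 1)
      - a * step γ₁ β n * (H₁ α (X n ω) (x n ω) * Real.sinh (a * (X n ω - z)))
      + C * step γ₁ β n ^ 2 * (Real.cosh (a * (X n ω - z)) - 1) + C * step γ₁ β n ^ 2 := by
    intro ω
    rw [hstep]
    have h1 := cosh_add_le_taylor (a * (X n ω - z)) (-(a * step γ₁ β n * H₁ α (X n ω) (x n ω)))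
    set t := -(a * step γ₁ β n * H₁ α (X n ω) (x n ω)) with ht
    have h2 : t ^ 2 * Real.exp |t| ≤ C * step γ₁ β n ^ 2 := by
      have h3 := hincr n ω
      rw [← ht] at h3
      have h4 : t ^ 2 ≤ (a * step γ₁ β n / (1 - α)) ^ 2 := by
        rw [← sq_abs t]; gcongr
      have h5 : |t| ≤ a * γ₁ / (1 - α) := h3.trans (by have := hg1 n; gcongr)
      calc t ^ 2 * Real.exp |t|
          ≤ (a * step γ₁ β n / (1 - α)) ^ 2 * Real.exp (a * γ₁ / (1 - α)) := by gcongr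
        _ = ((a / (1 - α)) ^ 2 * Real.exp (a * γ₁ / (1 - α))) * step γ₁ β n ^ 2 := by ring
        _ ≤ _ := by gcongr
    have h6 := mul_le_mul_of_nonneg_right h2 (Real.cosh_pos (a * (X n ω - z))).le
    nlinarith
  have hcosh1 : ∀ n, Integrable (fun ω => Real.cosh (a * (X n ω - z)) - 1) P := fun n =>
    (hint n).sub (integrable_const 1)
  have hI1 := hcosh1 n
  have hA : Integrable (fun ω => (Real.cosh (a * (X n ω - z)) - 1)
      - a * step γ₁ β n * (H₁ α (X n ω) (x n ω) * Real.sinh (a * (X n ω - z)))) P :=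
    hI1.sub (hHs.const_mul _)
  have hB : Integrable (fun ω => C * step γ₁ β n ^ 2 * (Real.cosh (a * (X n ω - z)) - 1)) P :=
    hI1.const_mul _
  have hAB : Integrable (fun ω => (Real.cosh (a * (X n ω - z)) - 1)
      - a * step γ₁ β n * (H₁ α (X n ω) (x n ω) * Real.sinh (a * (X n ω - z)))
      + C * step γ₁ β n ^ 2 * (Real.cosh (a * (X n ω - z)) - 1)) P := hA.add hB
  have hmono := integral_mono (hcosh1 (n + 1)) (hAB.add (integrable_const _)) hpt
  have e : ∫ ω, ((Real.cosh (a * (X n ω - z)) - 1)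
      - a * step γ₁ β n * (H₁ α (X n ω) (x n ω) * Real.sinh (a * (X n ω - z)))
      + C * step γ₁ β n ^ 2 * (Real.cosh (a * (X n ω - z)) - 1) + C * step γ₁ β n ^ 2) ∂P
      = (1 + C * step γ₁ β n ^ 2) * ∫ ω, (Real.cosh (a * (X n ω - z)) - 1) ∂P
        - step γ₁ β n * (a * ∫ ω, (∫ y, H₁ α (X n ω) y ∂ρ) * Real.sinh (a * (X n ω - z)) ∂P)
        + C * step γ₁ β n ^ 2 := by
    rw [integral_add hAB (integrable_const _), integral_add hA hB,
      integral_sub hI1 (hHs.const_mul _), integral_const_mul, integral_const_mul, hfreeze]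
    simp only [integral_const, probReal_univ, one_smul]
    ring
  have hdr : c * ∫ ω, (Real.cosh (a * (X n ω - z)) - 1) ∂P ≤
      a * ∫ ω, (∫ y, H₁ α (X n ω) y ∂ρ) * Real.sinh (a * (X n ω - z)) ∂P := by
    rw [← integral_const_mul, ← integral_const_mul]
    refine integral_mono (hI1.const_mul _) (Integrable.const_mul ?_ _) fun ω => ?_
    · have := hI.isProbabilityMeasure
      refine hsinh.bdd_mul (c := 1 / (1 - α)) ?_ (ae_of_all _ fun ω => ?_)
      · have h1 : StronglyMeasurable (fun ξ : ℝ => ∫ y, H₁ α ξ y ∂ρ) :=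
          (measurable_H₁ α).stronglyMeasurable.integral_prod_right'
        exact (h1.comp_measurable (hXm' n)).aestronglyMeasurable
      · refine (norm_integral_le_of_norm_le_const (ae_of_all _ fun y => abs_H₁_le hα _ y)).trans ?_
        simp
    · have := hdrift (X n ω)
      simpa [mul_assoc] using this
  have h7 := mul_le_mul_of_nonneg_left hdr (hg0 n).le
  have h8 : C * step γ₁ β n ^ 2 ≤ D * ((n : ℝ) + 1) ^ (-(β * (1 + 1))) := by
    have e2 : step γ₁ β n ^ 2 = γ₁ ^ 2 * ((n : ℝ) + 1) ^ (-(β * (1 + 1))) := by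
      rw [step, mul_pow, ← Real.rpow_natCast (((n : ℝ) + 1) ^ (-β)), ← Real.rpow_mul (by positivity)]
      congr 2; push_cast; ring
    rw [e2, ← mul_assoc]; gcongr
  have hmono' := hmono.trans_eq e
  nlinarith

end Iterates

lemma step_sq_mul_rpow {γ₁ β : ℝ} (s : ℝ) (n : ℕ) :
    step γ₁ β n ^ 2 * ((n : ℝ) + 1) ^ (-(β * s)) =
      γ₁ ^ 2 * ((n : ℝ) + 1) ^ (-(β * (1 + (1 + s)))) := by
  rw [step, mul_pow, ← Real.rpow_natCast (((n : ℝ) + 1) ^ (-β)), ← Real.rpow_mul (by positivity),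
    mul_assoc, ← Real.rpow_add (by positivity)]
  congr 2; push_cast; ring

lemma step_mul_rpow {γ₁ β : ℝ} (s : ℝ) (n : ℕ) :
    step γ₁ β n * ((n : ℝ) + 1) ^ (-(β * s)) = γ₁ * ((n : ℝ) + 1) ^ (-(β * (1 + s))) := by
  rw [step, mul_assoc, ← Real.rpow_add (by positivity)]
  congr 2; ring

section LinearBounds

variable {Ω : Type*} {mΩ : MeasurableSpace Ω} {P : Measure Ω} [IsProbabilityMeasure P]
  {γ₁ β : ℝ}

omit [IsProbabilityMeasure P] in
lemma integrable_linRec {m : ℝ} {g : ℕ → ℝ} {y₀ : Ω → ℝ} {e : ℕ → Ω → ℝ} (hy₀ : Integrable y₀ P)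
    (he : ∀ n, Integrable (e n) P) (n : ℕ) :
    Integrable (fun ω => linRec m g (y₀ ω) (fun k => e k ω) n) P := by
  induction n with
  | zero => exact hy₀
  | succ n ih => exact (ih.const_mul _).add ((he n).const_mul _)

omit [IsProbabilityMeasure P] in
lemma integral_abs_linRec_le {m K D s : ℝ} (hγ₁ : 0 < γ₁)
    (hK : RateBound γ₁ β m (m ^ 2) s K) {y₀ : Ω → ℝ} {e : ℕ → Ω → ℝ} (hy₀ : Integrable y₀ P)
    (he : ∀ n, Integrable (e n) P) (hy₀D : ∫ ω, |y₀ ω| ∂P ≤ D)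
    (heD : ∀ n, γ₁ * ∫ ω, |e n ω| ∂P ≤ D * ((n : ℝ) + 1) ^ (-(β * s))) (n : ℕ) :
    ∫ ω, |linRec m (step γ₁ β) (y₀ ω) (fun k => e k ω) n| ∂P
      ≤ K * D * ((n : ℝ) + 1) ^ (-(β * s)) := by
  have hD : 0 ≤ D := (integral_nonneg fun ω => abs_nonneg _).trans hy₀D
  refine hK.2 D hD (fun n => ∫ ω, |linRec m (step γ₁ β) (y₀ ω) (fun k => e k ω) n| ∂P)
    (fun n => integral_nonneg fun ω => abs_nonneg _) hy₀D (fun n => ?_) n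
  have hg := step_pos (β := β) hγ₁ n
  have h1 := integrable_linRec (m := m) (g := step γ₁ β) hy₀ he n
  have hF : |1 - step γ₁ β n * m| ≤ 1 - m * step γ₁ β n + m ^ 2 * step γ₁ β n ^ 2 := by
    rw [abs_le]; constructor <;> nlinarith [sq_nonneg (m * step γ₁ β n - 1),
      sq_nonneg (m * step γ₁ β n)]
  calc ∫ ω, |linRec m (step γ₁ β) (y₀ ω) (fun k => e k ω) (n + 1)| ∂P
      ≤ ∫ ω, (|1 - step γ₁ β n * m| * |linRec m (step γ₁ β) (y₀ ω) (fun k => e k ω) n|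
          + step γ₁ β n * |e n ω|) ∂P := by
        refine integral_mono ((h1.const_mul _).add ((he n).const_mul _)).abs
          ((h1.abs.const_mul _).add ((he n).abs.const_mul _)) fun ω => ?_
        refine (abs_add_le _ _).trans_eq ?_
        rw [abs_mul, abs_mul, abs_of_pos hg]
    _ = |1 - step γ₁ β n * m| * ∫ ω, |linRec m (step γ₁ β) (y₀ ω) (fun k => e k ω) n| ∂P
          + step γ₁ β n * ∫ ω, |e n ω| ∂P := by
        rw [integral_add (h1.abs.const_mul _) ((he n).abs.const_mul _), integral_const_mul,
          integral_const_mul]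
    _ ≤ _ := by
        have h2 := heD n
        have h3 : step γ₁ β n * ∫ ω, |e n ω| ∂P ≤ D * ((n : ℝ) + 1) ^ (-(β * (1 + s))) := by
          have h4 : ∫ ω, |e n ω| ∂P ≤ D * ((n : ℝ) + 1) ^ (-(β * s)) / γ₁ := by
            rw [le_div_iff₀ hγ₁]; linarith
          calc _ ≤ step γ₁ β n * (D * ((n : ℝ) + 1) ^ (-(β * s)) / γ₁) := by gcongr
            _ = D / γ₁ * (step γ₁ β n * ((n : ℝ) + 1) ^ (-(β * s))) := by ring
            _ = _ := by rw [step_mul_rpow]; field_simp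
        have h5 : 0 ≤ ∫ ω, |linRec m (step γ₁ β) (y₀ ω) (fun k => e k ω) n| ∂P :=
          integral_nonneg fun ω => abs_nonneg _
        gcongr

/-- Second moment bound for a linear recursion driven by martingale increments `g (W k, x k)` whose
conditional second moments are of order `n^{-βs}`. -/
lemma integral_linRec_sq_le {E : Type*} [MeasurableSpace E] {ρ : Measure ℝ} {ℱ : Filtration ℕ mΩ}
    {x : ℕ → Ω → ℝ} {m K D s : ℝ} (hI : Innovations P ρ ℱ x)
    (hK : RateBound γ₁ β (2 * m) (m ^ 2) (1 + s) K) (hD : 0 ≤ D)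
    {W : ℕ → Ω → E} (hW : ∀ n, Measurable[ℱ n] (W n)) {g : E × ℝ → ℝ} (hg : Measurable g)
    (hg0 : ∀ w, ∫ y, g (w, y) ∂ρ = 0) (hg2 : ∀ n, MemLp (fun ω => g (W n ω, x n ω)) 2 P)
    (hgD : ∀ n, γ₁ ^ 2 * ∫ ω, g (W n ω, x n ω) ^ 2 ∂P ≤ D * ((n : ℝ) + 1) ^ (-(β * s))) (n : ℕ) :
    MemLp (fun ω => linRec m (step γ₁ β) 0 (fun k => g (W k ω, x k ω)) n) 2 P ∧
    ∫ ω, linRec m (step γ₁ β) 0 (fun k => g (W k ω, x k ω)) n ^ 2 ∂P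
      ≤ K * D * ((n : ℝ) + 1) ^ (-(β * (1 + s))) := by
  set R : ℕ → Ω → ℝ := fun n ω => linRec m (step γ₁ β) 0 (fun k => g (W k ω, x k ω)) n with hR
  have hRm : ∀ n, Measurable[ℱ n] (R n) := by
    intro n
    induction n with
    | zero => exact measurable_const
    | succ n ih =>
      have h1 : Measurable[ℱ (n + 1)] (R n) := ih.mono (ℱ.mono n.le_succ) le_rfl
      have h2 : Measurable[ℱ (n + 1)] (W n) := (hW n).mono (ℱ.mono n.le_succ) le_rfl
      exact (h1.const_mul _).add ((hg.comp (h2.prodMk (hI.adapted n))).const_mul _)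
  have hR2 : ∀ n, MemLp (R n) 2 P := by
    intro n
    induction n with
    | zero => simp [hR, linRec]
    | succ n ih => exact (ih.const_mul _).add ((hg2 n).const_mul _)
  refine ⟨hR2 n, ?_⟩
  refine hK.2 D hD (fun n => ∫ ω, R n ω ^ 2 ∂P) (fun n => integral_nonneg fun ω => sq_nonneg _)
    (by simp [hR, linRec, hD]) (fun n => ?_) n
  have h1 := hI.integral_add_sq (M := fun ω => (1 - step γ₁ β n * m) * R n ω)
    ((hRm n).const_mul _) ((hR2 n).const_mul _) (hW n) (g := fun p => step γ₁ β n * g p)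
    (hg.const_mul _) (fun w => by rw [integral_const_mul, hg0, mul_zero]) ((hg2 n).const_mul _)
  have e : ∫ ω, R (n + 1) ω ^ 2 ∂P = (1 - step γ₁ β n * m) ^ 2 * ∫ ω, R n ω ^ 2 ∂P
      + step γ₁ β n ^ 2 * ∫ ω, g (W n ω, x n ω) ^ 2 ∂P := by
    simp only [mul_pow, integral_const_mul] at h1
    exact h1
  rw [e]
  have h2 : step γ₁ β n ^ 2 * ∫ ω, g (W n ω, x n ω) ^ 2 ∂P
      ≤ D * ((n : ℝ) + 1) ^ (-(β * (1 + (1 + s)))) := by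
    have e1 : step γ₁ β n ^ 2 = γ₁ ^ 2 * ((n : ℝ) + 1) ^ (-(β * 2)) := by
      have := step_sq_mul_rpow (γ₁ := γ₁) (β := β) 0 n
      norm_num at this
      rw [this]
    have e2 : ((n : ℝ) + 1) ^ (-(β * (1 + (1 + s))))
        = ((n : ℝ) + 1) ^ (-(β * 2)) * ((n : ℝ) + 1) ^ (-(β * s)) := by
      rw [← Real.rpow_add (by positivity)]; congr 1; ring
    have h3 := mul_le_mul_of_nonneg_left (hgD n)
      (show (0 : ℝ) ≤ ((n : ℝ) + 1) ^ (-(β * 2)) by positivity)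
    rw [e1, e2]; linarith
  have h4 : (1 - step γ₁ β n * m) ^ 2 = 1 - 2 * m * step γ₁ β n + m ^ 2 * step γ₁ β n ^ 2 := by
    ring
  rw [h4]; gcongr

end LinearBounds

section ES

variable {α : ℝ}

/-- The ES iterate is the running mean of `ξ_k + (x_k - ξ_k)⁺ / (1 - α)`. -/
lemma mul_esIter (γ : ℕ → ℝ) (ξ₀ : ℝ) (x : ℕ → ℝ) (n : ℕ) :
    (n : ℝ) * esIter α γ ξ₀ x n = ∑ k ∈ Finset.range n,
      (varIter α γ ξ₀ x k + 1 / (1 - α) * max (x k - varIter α γ ξ₀ x k) 0) := by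
  induction n with
  | zero => simp
  | succ n ih =>
    rw [Finset.sum_range_succ, ← ih, esIter, H₂]
    have : (n : ℝ) + 1 ≠ 0 := by positivity
    push_cast
    field_simp
    ring

end ES

/-! ### Value-at-risk, expected shortfall and the objective for a law with a regular density -/

/-- The law `ρ` has the positive continuous density `f`, which is bounded and Lipschitz with
constant `C`, and has a finite first moment. -/
structure RegularDensity (ρ : Measure ℝ) (f : ℝ → ℝ) (C : ℝ≥0) : Prop where
  continuous : Continuous f
  pos : ∀ x, 0 < f x
  eq : ρ = (volume : Measure ℝ).withDensity (fun x => ENNReal.ofReal (f x))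
  le : ∀ x, f x ≤ C
  lipschitz : LipschitzWith C f
  integrable_id : Integrable (fun y => y) ρ

namespace RegularDensity

variable {ρ : Measure ℝ} {f : ℝ → ℝ} {C : ℝ≥0} {α : ℝ}

section

variable (hρ : RegularDensity ρ f C)

include hρ

lemma measurable_ofReal : Measurable (fun x => ENNReal.ofReal (f x)) :=
  ENNReal.measurable_ofReal.comp hρ.continuous.measurable

lemma integral_eq (g : ℝ → ℝ) : ∫ y, g y ∂ρ = ∫ y, f y * g y := by
  rw [hρ.eq, integral_withDensity_eq_integral_toReal_smul
    hρ.measurable_ofReal (by simp)]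
  simp [ENNReal.toReal_ofReal (hρ.pos _).le]

lemma integrable_iff (g : ℝ → ℝ) : Integrable g ρ ↔ Integrable (fun y => f y * g y) := by
  rw [hρ.eq, integrable_withDensity_iff_integrable_smul'
    hρ.measurable_ofReal (by simp)]
  simp [ENNReal.toReal_ofReal (hρ.pos _).le]

lemma nullSingletonClass : NullSingletonClass ρ := by
  refine ⟨fun x => ?_⟩
  rw [hρ.eq]
  exact withDensity_absolutelyContinuous _ _ (measure_singleton x)

lemma integrable_density [IsProbabilityMeasure ρ] : Integrable f := by
  simpa using (hρ.integrable_iff (fun _ => 1)).1 (integrable_const 1)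

lemma integrable_max_sub [IsProbabilityMeasure ρ] (ξ : ℝ) :
    Integrable (fun y => max (y - ξ) 0) ρ :=
  (hρ.integrable_id.sub (integrable_const ξ)).pos_part

lemma real_eq_setIntegral {s : Set ℝ} (hs : MeasurableSet s) : ρ.real s = ∫ y in s, f y := by
  have h1 : ρ.real s = ∫ y, s.indicator (fun _ => (1 : ℝ)) y ∂ρ := by
    rw [integral_indicator hs]; simp
  rw [h1, hρ.integral_eq, ← integral_indicator hs]
  congr 1; funext y
  by_cases hy : y ∈ s <;> simp [hy]

variable [IsProbabilityMeasure ρ]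

lemma cdf_sub_eq (a b : ℝ) : cdf ρ b - cdf ρ a = ∫ x in a..b, f x := by
  rw [cdf_eq_real, cdf_eq_real, hρ.real_eq_setIntegral measurableSet_Iic,
    hρ.real_eq_setIntegral measurableSet_Iic,
    intervalIntegral.integral_Iic_sub_Iic hρ.integrable_density.integrableOn
      hρ.integrable_density.integrableOn]

lemma hasDerivAt_cdf (x : ℝ) : HasDerivAt (cdf ρ) (f x) x := by
  have h1 : HasDerivAt (fun b => ∫ t in x..b, f t) (f x) x :=
    hρ.continuous.integral_hasStrictDerivAt x x |>.hasDerivAt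
  have h2 : (cdf ρ : ℝ → ℝ) = fun b => (∫ t in x..b, f t) + cdf ρ x := by
    funext b; rw [← hρ.cdf_sub_eq]; ring
  rw [h2]; exact h1.add_const _

lemma continuous_cdf : Continuous (cdf ρ) :=
  continuous_iff_continuousAt.2 fun x => (hρ.hasDerivAt_cdf x).continuousAt

lemma strictMono_cdf : StrictMono (cdf ρ) :=
  strictMono_of_hasDerivAt_pos hρ.hasDerivAt_cdf hρ.pos

lemma abs_cdf_sub_le (a b : ℝ) : |cdf ρ b - cdf ρ a| ≤ C * |b - a| := by
  rw [hρ.cdf_sub_eq]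
  have := intervalIntegral.norm_integral_le_of_norm_le_const (a := a) (b := b) (f := f) (C := C)
    (fun x _ => by rw [Real.norm_of_nonneg (hρ.pos x).le]; exact hρ.le x)
  simpa using this

lemma abs_cdf_sub_sub_le (a b : ℝ) : |cdf ρ b - cdf ρ a - f a * (b - a)| ≤ C * (b - a) ^ 2 := by
  have e : cdf ρ b - cdf ρ a - f a * (b - a) = ∫ x in a..b, (f x - f a) := by
    rw [intervalIntegral.integral_sub (hρ.continuous.intervalIntegrable _ _)
      intervalIntegrable_const, ← hρ.cdf_sub_eq]
    simp; ring
  rw [e]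
  have := intervalIntegral.norm_integral_le_of_norm_le_const (a := a) (b := b)
    (f := fun x => f x - f a) (C := C * |b - a|) (fun x hx => by
      have h1 := hρ.lipschitz.dist_le_mul x a
      rw [Real.dist_eq, Real.dist_eq] at h1
      refine h1.trans ?_
      have h2 : |x - a| ≤ |b - a| := by
        rw [Set.mem_uIoc] at hx
        rcases hx with hx | hx
        · rw [abs_of_pos (by linarith), abs_of_pos (by linarith)]; linarith
        · rw [abs_of_nonpos (by linarith), abs_of_neg (by linarith)]; linarith
      gcongr)
  rw [Real.norm_eq_abs] at this
  refine this.trans_eq ?_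
  rw [mul_assoc, ← sq, sq_abs]

lemma le_cdf_sub {c a b : ℝ} (hab : a ≤ b) (hc : ∀ x ∈ Set.Icc a b, c ≤ f x) :
    c * (b - a) ≤ cdf ρ b - cdf ρ a := by
  rw [hρ.cdf_sub_eq]
  have := intervalIntegral.integral_mono_on hab (intervalIntegrable_const (c := c))
    (hρ.continuous.intervalIntegrable (μ := volume) a b) hc
  simp at this; linarith

lemma exists_cdf_eq {a : ℝ} (ha : a ∈ Set.Ioo (0 : ℝ) 1) : ∃ z, cdf ρ z = a :=
  mem_range_of_exists_le_of_exists_ge hρ.continuous_cdf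
    (((tendsto_cdf_atBot ρ).eventually_lt_const ha.1).exists.imp fun _ => le_of_lt)
    (((tendsto_cdf_atTop ρ).eventually_const_lt ha.2).exists.imp fun _ => le_of_lt)

lemma valueAtRisk_cdf (z : ℝ) : valueAtRisk ρ id (cdf ρ z) = z := by
  have : {ξ : ℝ | cdf ρ z ≤ ρ.real {ω | id ω ≤ ξ}} = Set.Ici z := by
    ext ξ
    have : ρ.real {ω | id ω ≤ ξ} = cdf ρ ξ := by rw [cdf_eq_real]; rfl
    rw [Set.mem_ofPred_eq, this, hρ.strictMono_cdf.le_iff_le, Set.mem_Ici]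
  rw [valueAtRisk, this, csInf_Ici]

lemma cdf_valueAtRisk {a : ℝ} (ha : a ∈ Set.Ioo (0 : ℝ) 1) : cdf ρ (valueAtRisk ρ id a) = a := by
  obtain ⟨z, rfl⟩ := hρ.exists_cdf_eq ha
  rw [hρ.valueAtRisk_cdf]

lemma integral_H₁ (ξ : ℝ) (hα : α < 1) : ∫ y, H₁ α ξ y ∂ρ = (cdf ρ ξ - α) / (1 - α) := by
  have := hρ.nullSingletonClass
  have h1 : ∀ y, (if ξ ≤ y then (1 : ℝ) else 0) = (Set.Ici ξ).indicator (fun _ => 1) y := by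
    intro y; simp [Set.indicator_apply]
  have h2 : ∫ y, (if ξ ≤ y then (1 : ℝ) else 0) ∂ρ = 1 - cdf ρ ξ := by
    simp_rw [h1]
    rw [integral_indicator measurableSet_Ici, cdf_eq_real, ← probReal_compl_eq_one_sub
      measurableSet_Iic, Set.compl_Iic]
    simp [measureReal_def, measure_congr (Ioi_ae_eq_Ici (μ := ρ) (a := ξ))]
  have hi : Integrable (fun y => (if ξ ≤ y then (1 : ℝ) else 0)) ρ := by
    simp_rw [h1]; exact (integrable_const 1).indicator measurableSet_Ici
  have hα1 : 1 - α ≠ 0 := by linarith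
  unfold H₁
  rw [integral_sub (integrable_const 1) (hi.const_mul _), integral_const_mul, h2]
  simp
  field_simp; ring

/-- The indicators in `H₁ α w` and `H₁ α z` differ on an interval of length `|w - z|` only. -/
lemma integral_H₁_sub_sq_le (w z : ℝ) :
    ∫ y, (H₁ α w y - H₁ α z y) ^ 2 ∂ρ ≤ (1 / (1 - α)) ^ 2 * C * |w - z| := by
  have key : ∀ a b : ℝ, a ≤ b → ∫ y, (H₁ α a y - H₁ α b y) ^ 2 ∂ρ
      ≤ (1 / (1 - α)) ^ 2 * C * |b - a| := by
    intro a b hab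
    have e : ∀ y, (H₁ α a y - H₁ α b y) ^ 2
        = (Set.Ico a b).indicator (fun _ => (1 / (1 - α)) ^ 2) y := by
      intro y
      simp only [H₁, Set.indicator_apply, Set.mem_Ico]
      by_cases h1 : a ≤ y <;> by_cases h2 : b ≤ y
      · simp [h1, h2, not_lt.2 h2]
      · simp [h1, h2, not_le.1 h2]
      · exact absurd (hab.trans h2) h1
      · simp [h1, h2]
    simp_rw [e]
    rw [integral_indicator measurableSet_Ico]
    have h3 : ρ.real (Set.Ico a b) = cdf ρ b - cdf ρ a := by
      rw [hρ.cdf_sub_eq, hρ.real_eq_setIntegral measurableSet_Ico,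
        intervalIntegral.integral_of_le hab, integral_Ico_eq_integral_Ioc]
    rw [setIntegral_const, h3, smul_eq_mul]
    have h4 := (le_abs_self _).trans (hρ.abs_cdf_sub_le a b)
    have : 0 ≤ (1 / (1 - α)) ^ 2 := sq_nonneg _
    nlinarith
  rcases le_total w z with h | h
  · rw [abs_sub_comm]; exact key w z h
  · have := key z w h
    simpa only [sub_sq_comm] using this

/-- The subgradient inequality: the objective is an average of convex functions of `ξ`. -/
lemma objective_sub_ge (x y : ℝ) (hα : α < 1) :
    (cdf ρ x - α) / (1 - α) * (y - x) ≤ objective ρ α id y - objective ρ α id x := by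
  have hα1 : 0 < 1 - α := by linarith
  have h1 : ∀ t : ℝ, -(y - x) * (1 - (Set.Iic x).indicator (fun _ => (1 : ℝ)) t) ≤
      max (t - y) 0 - max (t - x) 0 := by
    intro t
    by_cases ht : t ≤ x
    · simp [ht]
    · rw [not_le] at ht
      rw [max_eq_left (show 0 ≤ t - x by linarith)]
      simp only [Set.indicator_apply, Set.mem_Iic, not_le.2 ht, if_false]
      linarith [le_max_left (t - y) 0]
  have hi : Integrable (fun t => (Set.Iic x).indicator (fun _ => (1 : ℝ)) t) ρ :=
    (integrable_const 1).indicator measurableSet_Iic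
  have h2 := integral_mono (((integrable_const 1).sub hi).const_mul (-(y - x)))
    ((hρ.integrable_max_sub y).sub (hρ.integrable_max_sub x)) h1
  simp only [Pi.sub_apply] at h2
  rw [integral_const_mul, integral_sub (hρ.integrable_max_sub y) (hρ.integrable_max_sub x),
    integral_sub (integrable_const 1) hi, integral_indicator measurableSet_Iic] at h2
  simp only [integral_const, probReal_univ, measureReal_restrict_apply, MeasurableSet.univ,
    Set.univ_inter, smul_eq_mul, mul_one, ← cdf_eq_real] at h2
  simp only [objective, id]
  have e : (y + 1 / (1 - α) * ∫ t, max (t - y) 0 ∂ρ) - (x + 1 / (1 - α) * ∫ t, max (t - x) 0 ∂ρ)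
      = (y - x) + 1 / (1 - α) * ((∫ t, max (t - y) 0 ∂ρ) - ∫ t, max (t - x) 0 ∂ρ) := by ring
  rw [e]
  have h3 := mul_le_mul_of_nonneg_left h2 (show 0 ≤ 1 / (1 - α) by positivity)
  have e2 : (cdf ρ x - α) / (1 - α) * (y - x)
      = (y - x) + 1 / (1 - α) * (-(y - x) * (1 - cdf ρ x)) := by
    field_simp; ring
  linarith

lemma hasDerivAt_objective (x : ℝ) (hα : α < 1) :
    HasDerivAt (objective ρ α id) ((cdf ρ x - α) / (1 - α)) x := by
  have hα1 : 0 < 1 - α := by linarith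
  rw [hasDerivAt_iff_isLittleO]
  have hb : ∀ y, ‖objective ρ α id y - objective ρ α id x - (y - x) • ((cdf ρ x - α) / (1 - α))‖
      ≤ C / (1 - α) * ‖(y - x) ^ 2‖ := by
    intro y
    have h1 := hρ.objective_sub_ge x y hα
    have h2 := hρ.objective_sub_ge y x hα
    rw [smul_eq_mul, Real.norm_eq_abs, abs_of_nonneg (by linarith), norm_pow, Real.norm_eq_abs]
    have h3 := hρ.abs_cdf_sub_le x y
    have h4 : (cdf ρ y - cdf ρ x) * (y - x) ≤ C * |y - x| * |y - x| := by
      calc _ ≤ |(cdf ρ y - cdf ρ x) * (y - x)| := le_abs_self _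
        _ = |cdf ρ y - cdf ρ x| * |y - x| := abs_mul _ _
        _ ≤ _ := by gcongr
    have e : (cdf ρ y - α) / (1 - α) * (y - x) - (y - x) * ((cdf ρ x - α) / (1 - α))
        = (cdf ρ y - cdf ρ x) * (y - x) / (1 - α) := by field_simp; ring
    have h5 : (cdf ρ y - cdf ρ x) * (y - x) / (1 - α) ≤ C * |y - x| * |y - x| / (1 - α) := by
      gcongr
    have e2 : C / (1 - α) * |y - x| ^ 2 = C * |y - x| * |y - x| / (1 - α) := by ring
    rw [e2]; linarith
  refine (Asymptotics.IsBigO.of_bound _ (Eventually.of_forall hb)).trans_isLittleO ?_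
  have := (Asymptotics.isLittleO_pow_id (𝕜 := ℝ) one_lt_two).comp_tendsto
    (show Tendsto (fun y => y - x) (𝓝 x) (𝓝 0) by
      simpa using (continuous_id.sub continuous_const).tendsto (x := x) (f := fun y : ℝ => y - x))
  exact this

lemma iteratedDeriv_two_objective (hα : α < 1) (x : ℝ) :
    iteratedDeriv 2 (objective ρ α id) x = f x / (1 - α) := by
  have h1 : deriv (objective ρ α id) = fun x => (cdf ρ x - α) / (1 - α) :=
    funext fun x => (hρ.hasDerivAt_objective x hα).deriv
  rw [iteratedDeriv_succ, iteratedDeriv_one, h1]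
  exact (((hρ.hasDerivAt_cdf x).sub_const α).div_const (1 - α)).deriv

lemma mem_Argmin {z : ℝ} (hz : cdf ρ z = α) (hα : α < 1) : z ∈ Argmin (objective ρ α id) := by
  intro y
  have := hρ.objective_sub_ge z y hα
  rw [hz] at this
  simp at this
  exact this

lemma objective_sub_le {z : ℝ} (hz : cdf ρ z = α) (hα : α < 1) (y : ℝ) :
    objective ρ α id y - objective ρ α id z ≤ C / (1 - α) * (y - z) ^ 2 := by
  have hα1 : 0 < 1 - α := by linarith
  have h2 := hρ.objective_sub_ge y z hα
  have h3 := hρ.abs_cdf_sub_le z y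
  have h4 : (cdf ρ y - cdf ρ z) * (y - z) ≤ C * |y - z| * |y - z| := by
    calc _ ≤ |(cdf ρ y - cdf ρ z) * (y - z)| := le_abs_self _
      _ = |cdf ρ y - cdf ρ z| * |y - z| := abs_mul _ _
      _ ≤ _ := by gcongr
  rw [mul_assoc, ← sq, sq_abs, hz] at h4
  have e : (cdf ρ y - α) / (1 - α) * (z - y) = -((cdf ρ y - α) * (y - z) / (1 - α)) := by ring
  have e2 : C / (1 - α) * (y - z) ^ 2 = C * (y - z) ^ 2 / (1 - α) := by ring
  have h5 : (cdf ρ y - α) * (y - z) / (1 - α) ≤ C * (y - z) ^ 2 / (1 - α) := by gcongr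
  rw [e2]; linarith

/-- The expected shortfall is the minimum of the objective. -/
lemma expectedShortfall_eq {z : ℝ} (hz : cdf ρ z = α) (hα : α < 1) :
    expectedShortfall ρ id α = objective ρ α id z := by
  have hα1 : 0 < 1 - α := by linarith
  have himage : cdf ρ '' Set.Ioi z = Set.Ioo α 1 := by
    ext a
    constructor
    · rintro ⟨x, hx, rfl⟩
      refine ⟨hz ▸ hρ.strictMono_cdf hx, lt_of_lt_of_le (hρ.strictMono_cdf (lt_add_one x))
        (cdf_le_one ρ _)⟩
    · rintro ⟨h1, h2⟩
      have hα0 : 0 ≤ α := hz ▸ cdf_nonneg ρ z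
      obtain ⟨x, hx⟩ := hρ.exists_cdf_eq ⟨hα0.trans_lt h1, h2⟩
      refine ⟨x, ?_, hx⟩
      rw [← hx, ← hz] at h1
      exact hρ.strictMono_cdf.lt_iff_lt.1 h1
  have h1 : ∫ a in α..1, valueAtRisk ρ id a = ∫ x in Set.Ioi z, f x * x := by
    rw [intervalIntegral.integral_of_le hα.le, ← integral_Ioc_eq_integral_Ioo.symm, ← himage,
      integral_image_eq_integral_abs_deriv_smul measurableSet_Ioi
        (fun x _ => (hρ.hasDerivAt_cdf x).hasDerivWithinAt) hρ.strictMono_cdf.injective.injOn]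
    simp only [hρ.valueAtRisk_cdf, abs_of_pos (hρ.pos _), smul_eq_mul]
  have h2 : ∫ y, max (y - z) 0 ∂ρ = (∫ x in Set.Ioi z, f x * x) - z * (1 - α) := by
    rw [hρ.integral_eq]
    have e : ∀ y, f y * max (y - z) 0 = (Set.Ioi z).indicator (fun y => f y * y - z * f y) y := by
      intro y
      by_cases hy : z < y
      · rw [max_eq_left (by linarith), Set.indicator_of_mem (by exact hy)]; ring
      · rw [max_eq_right (by linarith), Set.indicator_of_notMem (by simpa using hy)]; ring
    simp_rw [e]
    rw [integral_indicator measurableSet_Ioi, integral_sub, integral_const_mul,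
      ← hρ.real_eq_setIntegral measurableSet_Ioi]
    · rw [← Set.compl_Iic, probReal_compl_eq_one_sub measurableSet_Iic, ← cdf_eq_real, hz]
    · exact ((hρ.integrable_iff _).1 hρ.integrable_id).integrableOn
    · exact (hρ.integrable_density.const_mul z).integrableOn
  rw [expectedShortfall, objective, h1]
  simp only [id]
  rw [h2]; field_simp; ring

lemma tendsto_integral_max_sub : Tendsto (fun ξ => ∫ y, max (y - ξ) 0 ∂ρ) atTop (𝓝 0) := by
  have : Tendsto (fun ξ => ∫ y, max (y - ξ) 0 ∂ρ) atTop (𝓝 (∫ _, (0 : ℝ) ∂ρ)) := by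
    refine tendsto_integral_filter_of_dominated_convergence (fun y => |y|)
      (Eventually.of_forall fun ξ => (hρ.integrable_max_sub ξ).aestronglyMeasurable) ?_
      hρ.integrable_id.abs (ae_of_all _ fun y => ?_)
    · filter_upwards [eventually_ge_atTop (0 : ℝ)] with ξ hξ
      refine ae_of_all _ fun y => ?_
      rw [Real.norm_of_nonneg (le_max_right _ _)]
      exact max_le (by linarith [le_abs_self y]) (abs_nonneg y)
    · refine tendsto_const_nhds.congr' ?_
      filter_upwards [eventually_ge_atTop y] with ξ hξ
      rw [max_eq_right (by linarith)]
  simpa using this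

lemma hasDerivAt_neg_integral_max_sub (x : ℝ) :
    HasDerivAt (fun ξ => -∫ y, max (y - ξ) 0 ∂ρ) (1 - cdf ρ x) x := by
  have h := hρ.hasDerivAt_objective (α := 0) x one_pos
  have e : (fun ξ => -∫ y, max (y - ξ) 0 ∂ρ) = fun ξ => ξ - objective ρ 0 id ξ := by
    funext ξ; simp [objective]
  rw [e]
  have h2 := (hasDerivAt_id x).sub h
  rw [sub_zero, sub_zero, div_one] at h2
  exact h2

lemma integrableOn_one_sub_cdf (z : ℝ) : IntegrableOn (fun ξ => 1 - cdf ρ ξ) (Set.Ioi z) :=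
  integrableOn_Ioi_deriv_of_nonneg' (fun x _ => hρ.hasDerivAt_neg_integral_max_sub x)
    (fun x _ => sub_nonneg.2 (cdf_le_one ρ x)) (by simpa using hρ.tendsto_integral_max_sub.neg)

lemma integral_max_sub_eq (z : ℝ) :
    ∫ y, max (y - z) 0 ∂ρ = ∫ ξ in Set.Ioi z, (1 - cdf ρ ξ) := by
  rw [integral_Ioi_of_hasDerivAt_of_nonneg' (fun x _ => hρ.hasDerivAt_neg_integral_max_sub x)
    (fun x _ => sub_nonneg.2 (cdf_le_one ρ x)) (l := 0)
    (by simpa using hρ.tendsto_integral_max_sub.neg)]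
  simp

end

end RegularDensity

/-! ### Linearization of the scheme -/

section Moments

variable {Ω : Type*} {mΩ : MeasurableSpace Ω} {P : Measure Ω} [IsProbabilityMeasure P]

lemma integral_abs_le_sqrt {X : Ω → ℝ} (hX : MemLp X 2 P) :
    ∫ ω, |X ω| ∂P ≤ Real.sqrt (∫ ω, X ω ^ 2 ∂P) := by
  refine Real.le_sqrt_of_sq_le ?_
  have h1 := variance_nonneg |X| P
  rw [variance_eq_sub hX.abs] at h1
  simp only [Pi.pow_apply, Pi.abs_apply, sq_abs] at h1
  linarith

lemma integral_sub_integral_sq_le {X : Ω → ℝ} (hX : MemLp X 2 P) :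
    ∫ ω, (X ω - ∫ ω', X ω' ∂P) ^ 2 ∂P ≤ ∫ ω, X ω ^ 2 ∂P := by
  rw [← variance_eq_integral hX.aemeasurable]
  exact variance_le_expectation_sq hX.aestronglyMeasurable

end Moments

section Linearization

variable {Ω : Type*} {mΩ : MeasurableSpace Ω} {P : Measure Ω} [IsProbabilityMeasure P]
  {α γ₁ β : ℝ} {ρ : Measure ℝ} {ℱ : Filtration ℕ mΩ} {x : ℕ → Ω → ℝ} {ξ₀ : Ω → ℝ}
  {f : ℝ → ℝ} {C : ℝ≥0} {z M : ℝ}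

lemma rpow_half (β : ℝ) (n : ℕ) :
    Real.sqrt (((n : ℝ) + 1) ^ (-β)) = ((n : ℝ) + 1) ^ (-(β * (1 / 2))) := by
  rw [Real.sqrt_eq_rpow, ← Real.rpow_mul (by positivity)]
  congr 1; ring

/-- Comparison of the VaR iterates with the linear recursion driven by the i.i.d. variables
`-H₁ α z (x k)`, in mean. The three error terms come from the fluctuations of `H₁` around the root
`z`, the curvature of the mean field, and the replacement of its slope `f z / (1 - α)` by `m`. -/
theorem integral_abs_varProc_sub_linRec_le {m K₁ K₂ K₃ : ℝ} (hα : α ∈ Set.Ioo (0 : ℝ) 1)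
    (hγ₁ : 0 < γ₁) (hI : Innovations P ρ ℱ x)
    (hξ₀ : Measurable[ℱ 0] ξ₀) (hρ : RegularDensity ρ f C) (hz : cdf ρ z = α) (hM : 0 ≤ M)
    (hU2 : ∀ n, MemLp (fun ω => varProc α γ₁ β ξ₀ x n ω - z) 2 P)
    (hUM : ∀ n, ∫ ω, (varProc α γ₁ β ξ₀ x n ω - z) ^ 2 ∂P ≤ M * ((n : ℝ) + 1) ^ (-β))
    (hK₁ : RateBound γ₁ β m (m ^ 2) 1 K₁) (hK₂ : RateBound γ₁ β m (m ^ 2) (1 / 2) K₂)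
    (hK₃ : RateBound γ₁ β (2 * m) (m ^ 2) (1 + 1 / 2) K₃) (n : ℕ) :
    Integrable (fun ω => varProc α γ₁ β ξ₀ x n ω - z
        - linRec m (step γ₁ β) 0 (fun k => -H₁ α z (x k ω)) n) P ∧
    ∫ ω, |varProc α γ₁ β ξ₀ x n ω - z
        - linRec m (step γ₁ β) 0 (fun k => -H₁ α z (x k ω)) n| ∂P ≤
      Real.sqrt (K₃ * (γ₁ ^ 2 * ((1 / (1 - α)) ^ 2 * C * Real.sqrt M))
        * ((n : ℝ) + 1) ^ (-(β * (1 + 1 / 2))))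
      + K₁ * (Real.sqrt M + γ₁ * (C / (1 - α) * M)) * ((n : ℝ) + 1) ^ (-(β * 1))
      + K₂ * (γ₁ * (|f z / (1 - α) - m| * Real.sqrt M)) * ((n : ℝ) + 1) ^ (-(β * (1 / 2))) := by
  have hα1 : 0 < 1 - α := by linarith [hα.2]
  have := hI.isProbabilityMeasure
  set X := varProc α γ₁ β ξ₀ x with hX
  have hXm : ∀ n, Measurable[ℱ n] (X n) := measurable_varProc hI hξ₀
  have hXm' : ∀ n, Measurable (X n) := fun n => (hXm n).mono (ℱ.le n) le_rfl
  have hUi : ∀ n, Integrable (fun ω => X n ω - z) P := fun n => (hU2 n).integrable one_le_two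
  have hU1 : ∀ n : ℕ, ∫ ω, |X n ω - z| ∂P ≤ Real.sqrt M * ((n : ℝ) + 1) ^ (-(β * (1 / 2))) := by
    intro n
    refine (integral_abs_le_sqrt (hU2 n)).trans ?_
    rw [← rpow_half, ← Real.sqrt_mul hM]
    exact Real.sqrt_le_sqrt (hUM n)
  set dV : ℝ → ℝ := fun w => (cdf ρ w - α) / (1 - α) with hdV
  have hdVm : Measurable dV := (hρ.continuous_cdf.measurable.sub_const α).div_const _
  set mh := f z / (1 - α) with hmh
  -- the four driving sequences
  set g : ℝ × ℝ → ℝ := fun p => dV p.1 - H₁ α p.1 p.2 + H₁ α z p.2 with hg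
  have hHm := measurable_H₁ α
  have hHz : Measurable (fun y => H₁ α z y) := hHm.comp (measurable_const.prodMk measurable_id)
  have hgm : Measurable g :=
    ((hdVm.comp measurable_fst).sub hHm).add (hHz.comp measurable_snd)
  set e₁ : ℕ → Ω → ℝ := fun k ω => -(dV (X k ω) - mh * (X k ω - z)) with he₁
  set e₂ : ℕ → Ω → ℝ := fun k ω => -(mh - m) * (X k ω - z) with he₂
  have hHi : ∀ w, Integrable (fun y => H₁ α w y) ρ := fun w =>
    Integrable.of_bound ((hHm.comp (measurable_const.prodMk measurable_id)).aestronglyMeasurable)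
      (1 / (1 - α)) (ae_of_all _ fun y => abs_H₁_le hα w y)
  have hg0 : ∀ w, ∫ y, g (w, y) ∂ρ = 0 := by
    intro w
    have i1 : Integrable (fun y => dV w - H₁ α w y) ρ := (integrable_const _).sub (hHi w)
    simp only [hg]
    rw [integral_add i1 (hHi z), integral_sub (integrable_const _) (hHi w),
      hρ.integral_H₁ w hα.2, hρ.integral_H₁ z hα.2, hz]
    simp [hdV]
  have hdVb : ∀ w, |dV w| ≤ 1 / (1 - α) := by
    intro w
    rw [hdV, abs_div, abs_of_pos hα1]
    gcongr
    rw [abs_le]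
    constructor <;> linarith [cdf_nonneg ρ w, cdf_le_one ρ w, hα.1, hα.2]
  have hgb : ∀ p, |g p| ≤ 3 * (1 / (1 - α)) := by
    intro p
    have h1 := hdVb p.1
    have h2 := abs_H₁_le hα p.1 p.2
    have h3 := abs_H₁_le hα z p.2
    rw [abs_le] at *
    constructor <;> simp only [hg] <;> linarith
  have hg2 : ∀ n, MemLp (fun ω => g (X n ω, x n ω)) 2 P := fun n =>
    MemLp.of_bound (hgm.comp ((hXm' n).prodMk (hI.measurable n))).aestronglyMeasurable
      (3 * (1 / (1 - α))) (ae_of_all _ fun ω => hgb _)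
  have hgsq : ∀ w, ∫ y, g (w, y) ^ 2 ∂ρ ≤ (1 / (1 - α)) ^ 2 * C * |w - z| := by
    intro w
    have hL : MemLp (fun y => H₁ α w y - H₁ α z y) 2 ρ := by
      refine MemLp.of_bound ((hHm.comp (measurable_const.prodMk measurable_id)).sub
        hHz).aestronglyMeasurable (1 / (1 - α) + 1 / (1 - α)) (ae_of_all _ fun y => ?_)
      exact (norm_sub_le _ _).trans (add_le_add (abs_H₁_le hα w y) (abs_H₁_le hα z y))
    have h1 := integral_sub_integral_sq_le hL
    have h2 : ∫ y, (H₁ α w y - H₁ α z y) ∂ρ = dV w := by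
      rw [integral_sub (hHi w) (hHi z), hρ.integral_H₁ w hα.2, hρ.integral_H₁ z hα.2, hz]
      simp [hdV]
    rw [h2] at h1
    refine le_trans (le_of_eq ?_) (h1.trans (hρ.integral_H₁_sub_sq_le w z))
    refine integral_congr_ae (ae_of_all _ fun y => ?_)
    simp only [hg]; ring
  have hgD : ∀ n : ℕ, γ₁ ^ 2 * ∫ ω, g (X n ω, x n ω) ^ 2 ∂P ≤
      (γ₁ ^ 2 * ((1 / (1 - α)) ^ 2 * C * Real.sqrt M)) * ((n : ℝ) + 1) ^ (-(β * (1 / 2))) := by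
    intro n
    have h1 := hI.integral_comp_le (hXm n) (g := fun p => g p ^ 2) (hgm.pow_const 2)
      (hg2 n).integrable_sq (b := fun w => (1 / (1 - α)) ^ 2 * C * |w - z|) hgsq
      (fun w y => sq_nonneg _) ((hUi n).abs.const_mul _)
    rw [integral_const_mul] at h1
    have h2 := mul_le_mul_of_nonneg_left (hU1 n)
      (show (0 : ℝ) ≤ (1 / (1 - α)) ^ 2 * C by positivity)
    have h3 := mul_le_mul_of_nonneg_left (h1.trans h2) (sq_nonneg γ₁)
    linarith
  have hR := integral_linRec_sq_le (P := P) hI hK₃ (by positivity) hXm hgm hg0 hg2 hgD n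
  -- curvature
  have he₁b : ∀ k ω, |e₁ k ω| ≤ C / (1 - α) * (X k ω - z) ^ 2 := by
    intro k ω
    have h1 := hρ.abs_cdf_sub_sub_le z (X k ω)
    rw [hz] at h1
    have e : e₁ k ω = -((cdf ρ (X k ω) - α - f z * (X k ω - z)) / (1 - α)) := by
      simp only [he₁, hdV, hmh]; field_simp
    rw [e, abs_neg, abs_div, abs_of_pos hα1]
    calc _ ≤ C * (X k ω - z) ^ 2 / (1 - α) := by gcongr
      _ = _ := by ring
  have he₁m : ∀ k, Measurable (e₁ k) := fun k =>
    ((hdVm.comp (hXm' k)).sub (((hXm' k).sub_const z).const_mul mh)).neg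
  have he₁i : ∀ k, Integrable (e₁ k) P := fun k =>
    ((hU2 k).integrable_sq.const_mul (C / (1 - α))).mono' (he₁m k).aestronglyMeasurable
      (ae_of_all _ fun ω => he₁b k ω)
  have hT₁ := integral_abs_linRec_le (P := P) (D := Real.sqrt M + γ₁ * (C / (1 - α) * M)) hγ₁ hK₁
    (hUi 0) he₁i (by
      have h1 := hU1 0
      simp only [Nat.cast_zero, zero_add, Real.one_rpow, mul_one] at h1
      have : 0 ≤ γ₁ * (C / (1 - α) * M) := by positivity
      linarith) (fun k => by
      have h1 : ∫ ω, |e₁ k ω| ∂P ≤ C / (1 - α) * (M * ((k : ℝ) + 1) ^ (-β)) := by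
        calc _ ≤ ∫ ω, C / (1 - α) * (X k ω - z) ^ 2 ∂P :=
              integral_mono (he₁i k).abs ((hU2 k).integrable_sq.const_mul _) (he₁b k)
          _ = C / (1 - α) * ∫ ω, (X k ω - z) ^ 2 ∂P := integral_const_mul _ _
          _ ≤ _ := by have := hUM k; gcongr
      have h2 := mul_le_mul_of_nonneg_left h1 hγ₁.le
      have h3 : 0 ≤ Real.sqrt M * ((k : ℝ) + 1) ^ (-β) := by positivity
      rw [mul_one]; linarith) n
  have he₂i : ∀ k, Integrable (e₂ k) P := fun k => (hUi k).const_mul _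
  have hT₂ := integral_abs_linRec_le (P := P) (D := γ₁ * (|mh - m| * Real.sqrt M)) hγ₁ hK₂
    (y₀ := fun _ => 0) (integrable_const 0) he₂i (by simp; positivity) (fun k => by
      have h1 : ∫ ω, |e₂ k ω| ∂P = |mh - m| * ∫ ω, |X k ω - z| ∂P := by
        simp only [he₂, abs_mul, abs_neg]
        exact integral_const_mul _ _
      rw [h1]
      have h2 := mul_le_mul_of_nonneg_left (hU1 k) (abs_nonneg (mh - m))
      have h3 := mul_le_mul_of_nonneg_left h2 hγ₁.le
      linarith) n
  have hdecomp : ∀ n ω, X n ω - z - linRec m (step γ₁ β) 0 (fun k => -H₁ α z (x k ω)) n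
      = linRec m (step γ₁ β) 0 (fun k => g (X k ω, x k ω)) n
        + linRec m (step γ₁ β) (X 0 ω - z) (fun k => e₁ k ω) n
        + linRec m (step γ₁ β) 0 (fun k => e₂ k ω) n := by
    intro n ω
    induction n with
    | zero => simp [linRec]
    | succ n ih =>
      have hs : X (n + 1) ω = X n ω - step γ₁ β n * H₁ α (X n ω) (x n ω) := varProc_succ ξ₀ x n ω
      simp only [linRec]
      have e : ∀ a b c d : ℝ, (1 - step γ₁ β n * m) * a + step γ₁ β n * b
          + ((1 - step γ₁ β n * m) * c + step γ₁ β n * e₁ n ω)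
          + ((1 - step γ₁ β n * m) * d + step γ₁ β n * e₂ n ω)
          = (1 - step γ₁ β n * m) * (a + c + d) + step γ₁ β n * (b + e₁ n ω + e₂ n ω) := by
        intros; ring
      rw [e, ← ih, hs]
      simp only [hg, he₁, he₂]; ring
  have hTi₁ := integrable_linRec (m := m) (g := step γ₁ β) (hUi 0) he₁i n
  have hTi₂ := integrable_linRec (m := m) (g := step γ₁ β) (P := P) (y₀ := fun _ => 0)
    (integrable_const 0) he₂i n
  have hRi := hR.1.integrable one_le_two
  simp_rw [hdecomp n]
  refine ⟨(hRi.add hTi₁).add hTi₂, ?_⟩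
  have hRa := (integral_abs_le_sqrt hR.1).trans (Real.sqrt_le_sqrt hR.2)
  have hsum : ∀ ω, |linRec m (step γ₁ β) 0 (fun k => g (X k ω, x k ω)) n
        + linRec m (step γ₁ β) (X 0 ω - z) (fun k => e₁ k ω) n
        + linRec m (step γ₁ β) 0 (fun k => e₂ k ω) n|
      ≤ |linRec m (step γ₁ β) 0 (fun k => g (X k ω, x k ω)) n|
        + |linRec m (step γ₁ β) (X 0 ω - z) (fun k => e₁ k ω) n|
        + |linRec m (step γ₁ β) 0 (fun k => e₂ k ω) n| := fun ω => abs_add_three _ _ _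
  have i12 : Integrable (fun ω => |linRec m (step γ₁ β) 0 (fun k => g (X k ω, x k ω)) n|
        + |linRec m (step γ₁ β) (X 0 ω - z) (fun k => e₁ k ω) n|) P := hRi.abs.add hTi₁.abs
  refine (integral_mono ((hRi.add hTi₁).add hTi₂).abs (i12.add hTi₂.abs) hsum).trans ?_
  have e : ∫ ω, (|linRec m (step γ₁ β) 0 (fun k => g (X k ω, x k ω)) n|
        + |linRec m (step γ₁ β) (X 0 ω - z) (fun k => e₁ k ω) n|
        + |linRec m (step γ₁ β) 0 (fun k => e₂ k ω) n|) ∂P = _ := integral_add i12 hTi₂.abs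
  refine e.le.trans ?_
  rw [integral_add hRi.abs hTi₁.abs]
  exact add_le_add (add_le_add hRa hT₁) hT₂

/-- Comparison of the ES iterates with the mean of the i.i.d. variables
`z + (x k - z)⁺ / (1 - α)`. -/
theorem integral_abs_esIter_sub_le (hα : α ∈ Set.Ioo (0 : ℝ) 1) (hI : Innovations P ρ ℱ x)
    (hξ₀ : Measurable[ℱ 0] ξ₀) (hρ : RegularDensity ρ f C) (hz : cdf ρ z = α)
    (hU2 : ∀ n, MemLp (fun ω => varProc α γ₁ β ξ₀ x n ω - z) 2 P)
    (hUM : ∀ n, ∫ ω, (varProc α γ₁ β ξ₀ x n ω - z) ^ 2 ∂P ≤ M * ((n : ℝ) + 1) ^ (-β)) (n : ℕ) :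
    Integrable (fun ω => n * (esIter α (learningRate γ₁ β) (ξ₀ ω) (fun k => x k ω) n
        - objective ρ α id z) - ∑ k ∈ Finset.range n,
          (z + 1 / (1 - α) * max (x k ω - z) 0 - objective ρ α id z)) P ∧
    ∫ ω, |n * (esIter α (learningRate γ₁ β) (ξ₀ ω) (fun k => x k ω) n
        - objective ρ α id z) - ∑ k ∈ Finset.range n,
          (z + 1 / (1 - α) * max (x k ω - z) 0 - objective ρ α id z)| ∂P ≤
      Real.sqrt ((1 + 1 / (1 - α)) ^ 2 * M * ∑ k ∈ Finset.range n, ((k : ℝ) + 1) ^ (-β))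
      + C / (1 - α) * M * ∑ k ∈ Finset.range n, ((k : ℝ) + 1) ^ (-β) := by
  have hα1 : 0 < 1 - α := by linarith [hα.2]
  have := hI.isProbabilityMeasure
  set X := varProc α γ₁ β ξ₀ x with hX
  have hXm : ∀ n, Measurable[ℱ n] (X n) := measurable_varProc hI hξ₀
  have hXm' : ∀ n, Measurable (X n) := fun n => (hXm n).mono (ℱ.le n) le_rfl
  set V := objective ρ α id with hV
  have hVm : Measurable V :=
    (continuous_iff_continuousAt.2 fun w => (hρ.hasDerivAt_objective w hα.2).continuousAt).measurable
  set G : ℝ → ℝ → ℝ := fun w y =>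
    (w + 1 / (1 - α) * max (y - w) 0) - (z + 1 / (1 - α) * max (y - z) 0) with hG
  have hGb : ∀ w y, |G w y| ≤ (1 + 1 / (1 - α)) * |w - z| := by
    intro w y
    have h1 : |max (y - w) 0 - max (y - z) 0| ≤ |w - z| := by
      refine (abs_max_sub_max_le_abs _ _ _).trans_eq ?_
      rw [show y - w - (y - z) = -(w - z) by ring, abs_neg]
    have e : G w y = (w - z) + 1 / (1 - α) * (max (y - w) 0 - max (y - z) 0) := by
      simp only [hG]; ring
    rw [e]
    refine (abs_add_le _ _).trans ?_
    rw [abs_mul, abs_of_pos (show 0 < 1 / (1 - α) by positivity)]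
    have : 1 / (1 - α) * |max (y - w) 0 - max (y - z) 0| ≤ 1 / (1 - α) * |w - z| := by gcongr
    linarith
  have hGm : Measurable (fun p : ℝ × ℝ => G p.1 p.2) := by
    simp only [hG]; fun_prop
  have hGi : ∀ w, ∫ y, G w y ∂ρ = V w - V z := by
    intro w
    have hi : ∀ w, Integrable (fun y => w + 1 / (1 - α) * max (y - w) 0) ρ := fun w =>
      (integrable_const w).add ((hρ.integrable_max_sub w).const_mul _)
    have h1 : ∀ w, ∫ y, (w + 1 / (1 - α) * max (y - w) 0) ∂ρ = V w := fun w => by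
      rw [integral_add (integrable_const w) ((hρ.integrable_max_sub w).const_mul _),
        integral_const_mul]
      simp [hV, objective]
    simp only [hG]
    rw [integral_sub (hi w) (hi z), h1, h1]
  set g : ℝ × ℝ → ℝ := fun p => G p.1 p.2 - (V p.1 - V z) with hg
  have hgm : Measurable g := hGm.sub ((hVm.comp measurable_fst).sub_const _)
  have hGL : ∀ w, MemLp (fun y => G w y) 2 ρ := fun w =>
    MemLp.of_bound (hGm.comp (measurable_const.prodMk measurable_id)).aestronglyMeasurable
      ((1 + 1 / (1 - α)) * |w - z|) (ae_of_all _ fun y => hGb w y)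
  have hg0 : ∀ w, ∫ y, g (w, y) ∂ρ = 0 := by
    intro w
    simp only [hg]
    rw [integral_sub ((hGL w).integrable one_le_two) (integrable_const _), hGi]
    simp
  have hgsq : ∀ w, ∫ y, g (w, y) ^ 2 ∂ρ ≤ (1 + 1 / (1 - α)) ^ 2 * (w - z) ^ 2 := by
    intro w
    have h1 := integral_sub_integral_sq_le (hGL w)
    rw [hGi] at h1
    refine h1.trans ?_
    have h2 := integral_mono (hGL w).integrable_sq
      (integrable_const ((1 + 1 / (1 - α)) ^ 2 * (w - z) ^ 2)) (fun y => by
        have := hGb w y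
        change G w y ^ 2 ≤ _
        rw [← sq_abs (G w y), ← sq_abs (w - z), ← mul_pow]
        gcongr)
    simpa using h2
  -- pointwise bounds of the mean increments
  have hVlo : ∀ w, 0 ≤ V w - V z := fun w => sub_nonneg.2 (hρ.mem_Argmin hz hα.2 w)
  have hVhi : ∀ w, V w - V z ≤ C / (1 - α) * (w - z) ^ 2 := fun w => hρ.objective_sub_le hz hα.2 w
  have hVi : ∀ k, Integrable (fun ω => V (X k ω) - V z) P := fun k =>
    ((hU2 k).integrable_sq.const_mul (C / (1 - α))).mono'
      ((hVm.comp (hXm' k)).sub_const _).aestronglyMeasurable (ae_of_all _ fun ω => by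
        rw [Real.norm_of_nonneg (hVlo _)]; exact hVhi _)
  have hGL' : ∀ k, MemLp (fun ω => G (X k ω) (x k ω)) 2 P := fun k =>
    ((hU2 k).const_mul (1 + 1 / (1 - α))).mono
      (hGm.comp ((hXm' k).prodMk (hI.measurable k))).aestronglyMeasurable (ae_of_all _ fun ω => by
        rw [Real.norm_eq_abs, Real.norm_eq_abs, abs_mul, abs_of_pos (show 0 < 1 + 1 / (1 - α) by
          positivity)]
        exact hGb _ _)
  have hVL : ∀ w, |V w - V z| ≤ (1 + 1 / (1 - α)) * |w - z| := by
    intro w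
    rw [← hGi]
    refine (norm_integral_le_of_norm_le_const (f := fun y => G w y)
      (C := (1 + 1 / (1 - α)) * |w - z|) (ae_of_all _ fun y => hGb w y)).trans ?_
    simp
  have hVL' : ∀ k, MemLp (fun ω => V (X k ω) - V z) 2 P := fun k =>
    ((hU2 k).const_mul (1 + 1 / (1 - α))).mono
      ((hVm.comp (hXm' k)).sub_const _).aestronglyMeasurable (ae_of_all _ fun ω => by
        rw [Real.norm_eq_abs, Real.norm_eq_abs, abs_mul, abs_of_pos (show 0 < 1 + 1 / (1 - α) by
          positivity)]
        exact hVL _)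
  have hg2 : ∀ k, MemLp (fun ω => g (X k ω, x k ω)) 2 P := fun k => (hGL' k).sub (hVL' k)
  have hsq := hI.integral_sum_sq hXm hgm hg0 hg2 n
  have hbd : ∑ k ∈ Finset.range n, ∫ ω, g (X k ω, x k ω) ^ 2 ∂P
      ≤ (1 + 1 / (1 - α)) ^ 2 * M * ∑ k ∈ Finset.range n, ((k : ℝ) + 1) ^ (-β) := by
    rw [Finset.mul_sum]
    refine Finset.sum_le_sum fun k _ => ?_
    have h1 := hI.integral_comp_le (hXm k) (g := fun p => g p ^ 2) (hgm.pow_const 2)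
      (hg2 k).integrable_sq (b := fun w => (1 + 1 / (1 - α)) ^ 2 * (w - z) ^ 2) hgsq
      (fun w y => sq_nonneg _) ((hU2 k).integrable_sq.const_mul _)
    rw [integral_const_mul] at h1
    refine h1.trans ?_
    rw [mul_assoc]
    have := hUM k
    gcongr
  have hdecomp : ∀ ω, n * (esIter α (learningRate γ₁ β) (ξ₀ ω) (fun k => x k ω) n - V z)
      - ∑ k ∈ Finset.range n, (z + 1 / (1 - α) * max (x k ω - z) 0 - V z)
      = ∑ k ∈ Finset.range n, g (X k ω, x k ω) + ∑ k ∈ Finset.range n, (V (X k ω) - V z) := by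
    intro ω
    rw [mul_sub, mul_esIter, ← Finset.sum_add_distrib]
    have e : (n : ℝ) * V z = ∑ k ∈ Finset.range n, V z := by simp
    rw [e, ← Finset.sum_sub_distrib, ← Finset.sum_sub_distrib]
    refine Finset.sum_congr rfl fun k _ => ?_
    simp only [hg, hG, hX, varProc]; ring
  have hs1 : MemLp (fun ω => ∑ k ∈ Finset.range n, g (X k ω, x k ω)) 2 P :=
    memLp_finsetSum _ fun k _ => hg2 k
  have hs2 : Integrable (fun ω => ∑ k ∈ Finset.range n, (V (X k ω) - V z)) P :=
    integrable_finsetSum _ fun k _ => hVi k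
  simp_rw [hdecomp]
  refine ⟨(hs1.integrable one_le_two).add hs2, ?_⟩
  have h3 : ∫ ω, |∑ k ∈ Finset.range n, g (X k ω, x k ω)| ∂P ≤ Real.sqrt
      ((1 + 1 / (1 - α)) ^ 2 * M * ∑ k ∈ Finset.range n, ((k : ℝ) + 1) ^ (-β)) := by
    refine (integral_abs_le_sqrt hs1).trans (Real.sqrt_le_sqrt ?_)
    rw [hsq]; exact hbd
  have h4 : ∫ ω, |∑ k ∈ Finset.range n, (V (X k ω) - V z)| ∂P
      ≤ C / (1 - α) * M * ∑ k ∈ Finset.range n, ((k : ℝ) + 1) ^ (-β) := by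
    have e : ∀ ω, |∑ k ∈ Finset.range n, (V (X k ω) - V z)|
        = ∑ k ∈ Finset.range n, (V (X k ω) - V z) := fun ω =>
      abs_of_nonneg (Finset.sum_nonneg fun k _ => hVlo _)
    simp_rw [e]
    rw [integral_finsetSum _ fun k _ => hVi k, Finset.mul_sum]
    refine Finset.sum_le_sum fun k _ => ?_
    calc ∫ ω, (V (X k ω) - V z) ∂P ≤ ∫ ω, C / (1 - α) * (X k ω - z) ^ 2 ∂P :=
          integral_mono (hVi k) ((hU2 k).integrable_sq.const_mul _) fun ω => hVhi _
      _ = C / (1 - α) * ∫ ω, (X k ω - z) ^ 2 ∂P := integral_const_mul _ _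
      _ ≤ C / (1 - α) * (M * ((k : ℝ) + 1) ^ (-β)) := by have := hUM k; gcongr
      _ = _ := by ring
  calc _ ≤ ∫ ω, (|∑ k ∈ Finset.range n, g (X k ω, x k ω)|
        + |∑ k ∈ Finset.range n, (V (X k ω) - V z)|) ∂P :=
        integral_mono ((hs1.integrable one_le_two).add hs2).abs
          ((hs1.integrable one_le_two).abs.add hs2.abs) fun ω => abs_add_le _ _
    _ = _ := integral_add (hs1.integrable one_le_two).abs hs2.abs
    _ ≤ _ := add_le_add h3 h4

end Linearization

/-! ### A central limit theorem for weighted sums of i.i.d. vectors -/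

section CharFun

open Complex (I)

lemma norm_cexp_mul_I_sub_one_le (x : ℝ) : ‖Complex.exp (x * I) - 1‖ ≤ |x| := by
  have := Real.norm_exp_I_mul_ofReal_sub_one_le (x := x)
  rwa [mul_comm, Real.norm_eq_abs] at this

lemma norm_cexp_mul_I_sub_le (x : ℝ) : ‖Complex.exp (x * I) - 1 - x * I‖ ≤ 2 * x ^ 2 := by
  have hn : ‖(x * I : ℂ)‖ = |x| := by simp
  rcases le_total |x| 1 with h | h
  · have := Complex.norm_exp_sub_one_sub_id_le (x := x * I) (by rwa [hn])
    rw [hn, sq_abs] at this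
    nlinarith [sq_nonneg x]
  · have h1 := norm_sub_le (Complex.exp (x * I) - 1) (x * I)
    have h2 := norm_cexp_mul_I_sub_one_le x
    rw [hn] at h1
    have : |x| ≤ x ^ 2 := by rw [← sq_abs]; nlinarith
    linarith

lemma norm_cexp_mul_I_taylor_two_le (x : ℝ) :
    ‖Complex.exp (x * I) - 1 - x * I + (x ^ 2 / 2 : ℝ)‖ ≤ 3 * (x ^ 2 * min 1 |x|) := by
  have hn : ‖(x * I : ℂ)‖ = |x| := by simp
  rcases le_total |x| 1 with h | h
  · rw [min_eq_right h]
    have h1 := Complex.exp_bound (x := x * I) (by rwa [hn]) (n := 3) (by norm_num)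
    have e : ∑ m ∈ Finset.range 3, (x * I : ℂ) ^ m / (m.factorial : ℂ)
        = 1 + x * I - (x ^ 2 / 2 : ℝ) := by
      simp only [Finset.sum_range_succ, Finset.sum_range_zero, Nat.factorial]
      push_cast
      rw [mul_pow (x : ℂ) I 2, Complex.I_sq]; ring
    rw [e, hn] at h1
    have e2 : Complex.exp (x * I) - (1 + x * I - (x ^ 2 / 2 : ℝ))
        = Complex.exp (x * I) - 1 - x * I + (x ^ 2 / 2 : ℝ) := by ring
    rw [e2] at h1
    refine h1.trans ?_
    have e3 : |x| ^ 3 = x ^ 2 * |x| := by rw [pow_succ, sq_abs]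
    rw [e3]
    have : 0 ≤ x ^ 2 * |x| := by positivity
    norm_num [Nat.factorial]
    nlinarith
  · rw [min_eq_left h]
    have h1 := norm_add_le (Complex.exp (x * I) - 1 - x * I) ((x ^ 2 / 2 : ℝ) : ℂ)
    have h2 := norm_cexp_mul_I_sub_le x
    rw [Complex.norm_real, Real.norm_of_nonneg (by positivity)] at h1
    nlinarith [sq_nonneg x]

lemma norm_cexp_remainder_sub_le (x y : ℝ) :
    ‖(Complex.exp (x * I) - 1 - x * I) - (Complex.exp (y * I) - 1 - y * I)‖
      ≤ 2 * (x - y) ^ 2 + |x - y| * |y| := by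
  have e : (Complex.exp (x * I) - 1 - x * I) - (Complex.exp (y * I) - 1 - y * I)
      = Complex.exp (y * I) * (Complex.exp ((x - y : ℝ) * I) - 1 - (x - y : ℝ) * I)
        + (x - y : ℝ) * I * (Complex.exp (y * I) - 1) := by
    have : Complex.exp (x * I) = Complex.exp (y * I) * Complex.exp ((x - y : ℝ) * I) := by
      rw [← Complex.exp_add]; congr 1; push_cast; ring
    rw [this]; push_cast; ring
  rw [e]
  refine (norm_add_le _ _).trans ?_
  rw [norm_mul, norm_mul, Complex.norm_exp_ofReal_mul_I, one_mul]
  have h1 := norm_cexp_mul_I_sub_le (x - y)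
  have h2 := norm_cexp_mul_I_sub_one_le y
  have h3 : ‖((x - y : ℝ) * I : ℂ)‖ = |x - y| := by
    rw [norm_mul, Complex.norm_I, mul_one, Complex.norm_real, Real.norm_eq_abs]
  rw [h3]
  gcongr

lemma abs_exp_neg_sub_le {q : ℝ} (hq : 0 ≤ q) : |Real.exp (-q) - 1 + q| ≤ q ^ 2 := by
  have h1 := Real.add_one_le_exp (-q)
  have h2 : Real.exp (-q) ≤ 1 / (1 + q) := by
    rw [Real.exp_neg, ← one_div]
    exact one_div_le_one_div_of_le (by positivity) (by linarith [Real.add_one_le_exp q])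
  have h3 : 1 / (1 + q) ≤ 1 - q + q ^ 2 := by
    rw [div_le_iff₀ (by positivity)]
    have : 0 ≤ q ^ 3 := by positivity
    nlinarith
  rw [abs_le]; constructor <;> nlinarith [sq_nonneg q]

variable {Ω : Type*} {mΩ : MeasurableSpace Ω} {P : Measure Ω} [IsProbabilityMeasure P]

omit [IsProbabilityMeasure P] in
lemma integrable_cexp [IsFiniteMeasure P] {X : Ω → ℝ} (hX : AEStronglyMeasurable X P) :
    Integrable (fun ω => Complex.exp (X ω * I)) P := by
  refine Integrable.of_bound ?_ 1 (ae_of_all _ fun ω => by rw [Complex.norm_exp_ofReal_mul_I])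
  exact (Complex.continuous_exp.comp
    (Complex.continuous_ofReal.mul continuous_const)).comp_aestronglyMeasurable hX

/-- Second order expansion of the characteristic function of the centred square integrable vector
`(A, B)`. -/
lemma charFun_taylor {A B : Ω → ℝ} (hA : MemLp A 2 P) (hB : MemLp B 2 P) (hA0 : ∫ ω, A ω ∂P = 0)
    (hB0 : ∫ ω, B ω ∂P = 0) {ε : ℝ} (hε : 0 < ε) :
    ∃ δ > 0, ∀ s t : ℝ, |s| ≤ δ → |t| ≤ δ →
      ‖∫ ω, Complex.exp ((s * A ω + t * B ω : ℝ) * I) ∂P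
        - Real.exp (-(∫ ω, (s * A ω + t * B ω) ^ 2 ∂P) / 2)‖ ≤ ε * (s ^ 2 + t ^ 2) := by
  set Z : Ω → ℝ := fun ω => |A ω| + |B ω| with hZ
  have hZL : MemLp Z 2 P := hA.abs.add hB.abs
  have hZ0 : ∀ ω, 0 ≤ Z ω := fun ω => by positivity
  set E : ℝ := ∫ ω, Z ω ^ 2 ∂P with hE
  have hE0 : 0 ≤ E := integral_nonneg fun ω => sq_nonneg _
  have hZi := hZL.integrable_sq
  have hlim : Tendsto (fun δ : ℝ => ∫ ω, Z ω ^ 2 * min 1 (|δ| * Z ω) ∂P) (𝓝 0) (𝓝 0) := by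
    have : Tendsto (fun δ : ℝ => ∫ ω, Z ω ^ 2 * min 1 (|δ| * Z ω) ∂P) (𝓝 0)
        (𝓝 (∫ _, (0 : ℝ) ∂P)) := by
      refine tendsto_integral_filter_of_dominated_convergence (fun ω => Z ω ^ 2)
        (Eventually.of_forall fun δ => ?_) (Eventually.of_forall fun δ => ae_of_all _ fun ω => ?_)
        hZi (ae_of_all _ fun ω => ?_)
      · exact hZi.aestronglyMeasurable.mul
          (aestronglyMeasurable_const.inf (hZL.aestronglyMeasurable.const_mul _))
      · have h1 : 0 ≤ min 1 (|δ| * Z ω) := le_min zero_le_one (mul_nonneg (abs_nonneg _) (hZ0 ω))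
        rw [Real.norm_of_nonneg (mul_nonneg (sq_nonneg _) h1)]
        exact mul_le_of_le_one_right (sq_nonneg _) (min_le_left _ _)
      · have h1 : Continuous fun δ : ℝ => Z ω ^ 2 * min 1 (|δ| * Z ω) := by fun_prop
        simpa using h1.tendsto 0
    simpa using this
  have hlim2 : Tendsto (fun δ : ℝ => 3 * ∫ ω, Z ω ^ 2 * min 1 (|δ| * Z ω) ∂P + δ ^ 2 * E ^ 2 / 4)
      (𝓝 0) (𝓝 0) := by
    have h2 : Tendsto (fun δ : ℝ => δ ^ 2 * E ^ 2 / 4) (𝓝 0) (𝓝 0) := by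
      have h1 : Continuous fun δ : ℝ => δ ^ 2 * E ^ 2 / 4 := by fun_prop
      simpa using h1.tendsto 0
    simpa using (hlim.const_mul 3).add h2
  obtain ⟨δ, hδ1, hδ0⟩ := (((hlim2.eventually_lt_const hε).filter_mono nhdsWithin_le_nhds).and
    (self_mem_nhdsWithin (s := Set.Ioi (0 : ℝ)))).exists
  refine ⟨δ, hδ0, fun s t hs ht => ?_⟩
  set X : Ω → ℝ := fun ω => s * A ω + t * B ω with hX
  have hXL : MemLp X 2 P := (hA.const_mul s).add (hB.const_mul t)
  set r := max |s| |t| with hr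
  have hr0 : 0 ≤ r := (abs_nonneg s).trans (le_max_left _ _)
  have hrδ : r ≤ δ := max_le hs ht
  have hr2 : r ^ 2 ≤ s ^ 2 + t ^ 2 := by
    rcases max_choice |s| |t| with h | h
    · rw [hr, h, sq_abs]; nlinarith [sq_nonneg t]
    · rw [hr, h, sq_abs]; nlinarith [sq_nonneg s]
  have hXZ : ∀ ω, |X ω| ≤ r * Z ω := by
    intro ω
    refine (abs_add_le _ _).trans ?_
    rw [abs_mul, abs_mul, hZ, mul_add]
    gcongr
    · exact le_max_left _ _
    · exact le_max_right _ _
  have hXZ2 : ∀ ω, X ω ^ 2 ≤ r ^ 2 * Z ω ^ 2 := by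
    intro ω
    rw [← sq_abs (X ω), ← mul_pow]
    have := hXZ ω
    gcongr
  have hX0 : ∫ ω, X ω ∂P = 0 := by
    rw [integral_add ((hA.integrable one_le_two).const_mul s)
      ((hB.integrable one_le_two).const_mul t), integral_const_mul, integral_const_mul, hA0, hB0]
    ring
  set Q := ∫ ω, X ω ^ 2 ∂P with hQ
  have hQ0 : 0 ≤ Q := integral_nonneg fun ω => sq_nonneg _
  have hQE : Q ≤ r ^ 2 * E := by
    rw [hE, ← integral_const_mul]
    exact integral_mono hXL.integrable_sq (hZi.const_mul _) hXZ2
  have hXi : Integrable (fun ω => (X ω : ℂ) * I) P :=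
    ((hXL.integrable one_le_two).ofReal (𝕜 := ℂ)).mul_const I
  have hX2i : Integrable (fun ω => ((X ω ^ 2 / 2 : ℝ) : ℂ)) P :=
    (hXL.integrable_sq.div_const 2).ofReal (𝕜 := ℂ)
  have hexp := integrable_cexp (P := P) hXL.aestronglyMeasurable
  have h1 : ∫ ω, (Complex.exp (X ω * I) - 1 - X ω * I + (X ω ^ 2 / 2 : ℝ)) ∂P
      = ∫ ω, Complex.exp (X ω * I) ∂P - 1 + (Q / 2 : ℝ) := by
    have i1 : Integrable (fun ω => Complex.exp (X ω * I) - 1) P := hexp.sub (integrable_const 1)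
    have i2 : Integrable (fun ω => Complex.exp (X ω * I) - 1 - X ω * I) P := i1.sub hXi
    rw [integral_add i2 hX2i, integral_sub i1 hXi, integral_sub hexp (integrable_const 1),
      integral_mul_const, integral_complex_ofReal, integral_complex_ofReal, hX0, integral_div]
    simp [hQ]
  have h2 : ‖∫ ω, (Complex.exp (X ω * I) - 1 - X ω * I + (X ω ^ 2 / 2 : ℝ)) ∂P‖
      ≤ 3 * (r ^ 2 * ∫ ω, Z ω ^ 2 * min 1 (|δ| * Z ω) ∂P) := by
    have hi : Integrable (fun ω => Z ω ^ 2 * min 1 (|δ| * Z ω)) P := by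
      refine hZi.mono' (hZi.aestronglyMeasurable.mul
          (aestronglyMeasurable_const.inf (hZL.aestronglyMeasurable.const_mul _)))
          (ae_of_all _ fun ω => ?_)
      have h1 : 0 ≤ min 1 (|δ| * Z ω) := le_min zero_le_one (mul_nonneg (abs_nonneg _) (hZ0 ω))
      rw [Real.norm_of_nonneg (mul_nonneg (sq_nonneg _) h1)]
      exact mul_le_of_le_one_right (sq_nonneg _) (min_le_left _ _)
    rw [← integral_const_mul, ← integral_const_mul]
    refine norm_integral_le_of_norm_le ((hi.const_mul _).const_mul _) (ae_of_all _ fun ω => ?_)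
    refine (norm_cexp_mul_I_taylor_two_le (X ω)).trans ?_
    rw [← mul_assoc (r ^ 2)]
    have h3 : |X ω| ≤ |δ| * Z ω := (hXZ ω).trans (by
      rw [abs_of_pos hδ0]; exact mul_le_mul_of_nonneg_right hrδ (hZ0 ω))
    have h4 := hXZ2 ω
    gcongr
  have h3 := abs_exp_neg_sub_le (show 0 ≤ Q / 2 by positivity)
  have h4 : (Q / 2) ^ 2 ≤ r ^ 2 * (δ ^ 2 * E ^ 2 / 4) := by
    have : Q ^ 2 ≤ (r ^ 2 * E) ^ 2 := by gcongr
    have h5 : r ^ 2 * r ^ 2 * E ^ 2 ≤ r ^ 2 * δ ^ 2 * E ^ 2 := by gcongr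
    nlinarith
  have e : ∫ ω, Complex.exp ((X ω : ℝ) * I) ∂P - (Real.exp (-Q / 2) : ℂ)
      = (∫ ω, Complex.exp (X ω * I) ∂P - 1 + (Q / 2 : ℝ))
        - ((Real.exp (-(Q / 2)) - 1 + Q / 2 : ℝ) : ℂ) := by
    rw [neg_div]; push_cast; ring
  have h5 : ‖∫ ω, Complex.exp ((X ω : ℝ) * I) ∂P - (Real.exp (-Q / 2) : ℂ)‖
      ≤ r ^ 2 * (3 * ∫ ω, Z ω ^ 2 * min 1 (|δ| * Z ω) ∂P + δ ^ 2 * E ^ 2 / 4) := by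
    rw [e]
    refine (norm_sub_le _ _).trans ?_
    rw [← h1, Complex.norm_real, Real.norm_eq_abs]
    linarith
  refine h5.trans ?_
  calc _ ≤ r ^ 2 * ε := mul_le_mul_of_nonneg_left hδ1.le (sq_nonneg r)
    _ ≤ (s ^ 2 + t ^ 2) * ε := by gcongr
    _ = _ := mul_comm _ _

/-- The characteristic functions of centred square integrable vectors at distance `d` in `L²` differ
by at most `O(d |(s, t)|²)`. -/
lemma norm_charFun_sub_le {A B A' B' : Ω → ℝ} (hA : MemLp A 2 P) (hB : MemLp B 2 P)
    (hA' : MemLp A' 2 P) (hB' : MemLp B' 2 P) (hA0 : ∫ ω, A ω ∂P = 0) (hB0 : ∫ ω, B ω ∂P = 0)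
    (hA0' : ∫ ω, A' ω ∂P = 0) (hB0' : ∫ ω, B' ω ∂P = 0) {κ : ℝ} (hκ : 0 < κ) (s t : ℝ) :
    ‖∫ ω, Complex.exp ((s * A ω + t * B ω : ℝ) * I) ∂P
        - ∫ ω, Complex.exp ((s * A' ω + t * B' ω : ℝ) * I) ∂P‖ ≤
      (s ^ 2 + t ^ 2) * ((2 + 1 / κ) * (∫ ω, (A ω - A' ω) ^ 2 ∂P + ∫ ω, (B ω - B' ω) ^ 2 ∂P)
        + κ * (∫ ω, A' ω ^ 2 ∂P + ∫ ω, B' ω ^ 2 ∂P)) := by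
  set X : Ω → ℝ := fun ω => s * A ω + t * B ω with hX
  set Y : Ω → ℝ := fun ω => s * A' ω + t * B' ω with hY
  have hXL : MemLp X 2 P := (hA.const_mul s).add (hB.const_mul t)
  have hYL : MemLp Y 2 P := (hA'.const_mul s).add (hB'.const_mul t)
  have hX0 : ∫ ω, X ω ∂P = 0 := by
    rw [integral_add ((hA.integrable one_le_two).const_mul s)
      ((hB.integrable one_le_two).const_mul t), integral_const_mul, integral_const_mul, hA0, hB0]
    ring
  have hY0 : ∫ ω, Y ω ∂P = 0 := by
    rw [integral_add ((hA'.integrable one_le_two).const_mul s)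
      ((hB'.integrable one_le_two).const_mul t), integral_const_mul, integral_const_mul, hA0', hB0']
    ring
  have key : ∀ {X : Ω → ℝ}, MemLp X 2 P → ∫ ω, X ω ∂P = 0 →
      Integrable (fun ω => Complex.exp (X ω * I) - 1 - X ω * I) P ∧
      ∫ ω, (Complex.exp (X ω * I) - 1 - X ω * I) ∂P = ∫ ω, Complex.exp (X ω * I) ∂P - 1 := by
    intro X hXL hX0
    have hXi : Integrable (fun ω => (X ω : ℂ) * I) P :=
      ((hXL.integrable one_le_two).ofReal (𝕜 := ℂ)).mul_const I
    have hexp := integrable_cexp (P := P) hXL.aestronglyMeasurable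
    have i1 : Integrable (fun ω => Complex.exp (X ω * I) - 1) P := hexp.sub (integrable_const 1)
    refine ⟨i1.sub hXi, ?_⟩
    rw [integral_sub i1 hXi, integral_sub hexp (integrable_const 1),
      integral_mul_const, integral_complex_ofReal, hX0]
    simp
  obtain ⟨iX, eX⟩ := key hXL hX0
  obtain ⟨iY, eY⟩ := key hYL hY0
  have e : ∫ ω, Complex.exp ((X ω : ℝ) * I) ∂P - ∫ ω, Complex.exp ((Y ω : ℝ) * I) ∂P
      = ∫ ω, ((Complex.exp (X ω * I) - 1 - X ω * I) - (Complex.exp (Y ω * I) - 1 - Y ω * I)) ∂P := by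
    rw [integral_sub iX iY, eX, eY]; ring
  rw [e]
  have hΔA := (hA.sub hA').integrable_sq
  have hΔB := (hB.sub hB').integrable_sq
  have hA2 := hA'.integrable_sq
  have hB2 := hB'.integrable_sq
  have hbound : ∀ ω, ‖(Complex.exp (X ω * I) - 1 - X ω * I) - (Complex.exp (Y ω * I) - 1 - Y ω * I)‖
      ≤ (s ^ 2 + t ^ 2) * ((2 + 1 / κ) * ((A ω - A' ω) ^ 2 + (B ω - B' ω) ^ 2)
        + κ * (A' ω ^ 2 + B' ω ^ 2)) := by
    intro ω
    refine (norm_cexp_remainder_sub_le (X ω) (Y ω)).trans ?_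
    have h1 : (X ω - Y ω) ^ 2 ≤ (s ^ 2 + t ^ 2) * ((A ω - A' ω) ^ 2 + (B ω - B' ω) ^ 2) := by
      simp only [hX, hY]
      nlinarith [sq_nonneg (s * (B ω - B' ω) - t * (A ω - A' ω))]
    have h2 : Y ω ^ 2 ≤ (s ^ 2 + t ^ 2) * (A' ω ^ 2 + B' ω ^ 2) := by
      simp only [hY]
      nlinarith [sq_nonneg (s * B' ω - t * A' ω)]
    have h3 : |X ω - Y ω| * |Y ω| ≤ 1 / κ * (X ω - Y ω) ^ 2 + κ * Y ω ^ 2 := by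
      have h4 : 0 ≤ (|X ω - Y ω| - κ * |Y ω|) ^ 2 := sq_nonneg _
      have h5 : 0 ≤ |X ω - Y ω| * |Y ω| := by positivity
      have e1 : (|X ω - Y ω| - κ * |Y ω|) ^ 2
          = (X ω - Y ω) ^ 2 + κ ^ 2 * Y ω ^ 2 - 2 * κ * (|X ω - Y ω| * |Y ω|) := by
        rw [← sq_abs (X ω - Y ω), ← sq_abs (Y ω)]; ring
      have e2 : 1 / κ * (X ω - Y ω) ^ 2 + κ * Y ω ^ 2
          = ((X ω - Y ω) ^ 2 + κ ^ 2 * Y ω ^ 2) / κ := by field_simp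
      rw [e2, le_div_iff₀ hκ]
      nlinarith
    have h6 := mul_le_mul_of_nonneg_left h1 (show 0 ≤ 2 + 1 / κ by positivity)
    have h7 := mul_le_mul_of_nonneg_left h2 hκ.le
    nlinarith
  refine (norm_integral_le_of_norm_le ?_ (ae_of_all _ hbound)).trans_eq ?_
  · exact (((hΔA.add hΔB).const_mul _).add ((hA2.add hB2).const_mul _)).const_mul _
  · have i1 : Integrable (fun ω => (A ω - A' ω) ^ 2 + (B ω - B' ω) ^ 2) P := hΔA.add hΔB
    have i2 : Integrable (fun ω => A' ω ^ 2 + B' ω ^ 2) P := hA2.add hB2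
    rw [integral_const_mul, integral_add (i1.const_mul _) (i2.const_mul _), integral_const_mul,
      integral_const_mul, integral_add hA2 hB2]
    congr 4
    exact integral_add hΔA hΔB

lemma norm_prod_sub_prod_le {ι : Type*} (S : Finset ι) {a b : ι → ℂ} (ha : ∀ i ∈ S, ‖a i‖ ≤ 1)
    (hb : ∀ i ∈ S, ‖b i‖ ≤ 1) : ‖∏ i ∈ S, a i - ∏ i ∈ S, b i‖ ≤ ∑ i ∈ S, ‖a i - b i‖ := by
  classical
  induction S using Finset.induction_on with
  | empty => simp
  | insert i S hi ih =>
    rw [Finset.prod_insert hi, Finset.prod_insert hi, Finset.sum_insert hi]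
    have e : a i * ∏ j ∈ S, a j - b i * ∏ j ∈ S, b j
        = (a i - b i) * ∏ j ∈ S, a j + b i * (∏ j ∈ S, a j - ∏ j ∈ S, b j) := by ring
    rw [e]
    refine (norm_add_le _ _).trans ?_
    rw [norm_mul, norm_mul]
    have h1 : ‖∏ j ∈ S, a j‖ ≤ 1 := by
      rw [norm_prod]
      exact Finset.prod_le_one (fun j _ => norm_nonneg _)
        fun j hj => ha j (Finset.mem_insert_of_mem hj)
    have h2 := ih (fun j hj => ha j (Finset.mem_insert_of_mem hj))
      (fun j hj => hb j (Finset.mem_insert_of_mem hj))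
    have h3 := hb i (Finset.mem_insert_self i S)
    refine add_le_add (mul_le_of_le_one_right (norm_nonneg _) h1) ?_
    exact (mul_le_of_le_one_left (norm_nonneg _) h3).trans h2

/-- Lindeberg's replacement argument: products of the characteristic functions of vectors
`(A i, B i)` that converge in `L²`, at weights that are uniformly small and square summable,
converge to the exponential of the limit of the quadratic forms. -/
theorem tendsto_prod_charFun {ι : Type*} {l : Filter ι} {A B : ι → Ω → ℝ} {A₀ B₀ : Ω → ℝ}
    (hA : ∀ᶠ i in l, MemLp (A i) 2 P ∧ ∫ ω, A i ω ∂P = 0)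
    (hB : ∀ᶠ i in l, MemLp (B i) 2 P ∧ ∫ ω, B i ω ∂P = 0)
    (hA₀ : MemLp A₀ 2 P) (hB₀ : MemLp B₀ 2 P)
    (hA₀0 : ∫ ω, A₀ ω ∂P = 0) (hB₀0 : ∫ ω, B₀ ω ∂P = 0)
    (hAl : Tendsto (fun i => ∫ ω, (A i ω - A₀ ω) ^ 2 ∂P) l (𝓝 0))
    (hBl : Tendsto (fun i => ∫ ω, (B i ω - B₀ ω) ^ 2 ∂P) l (𝓝 0))
    {n : ι → ℕ} {s t : ι → ℕ → ℝ}
    (hsmall : ∀ δ > 0, ∀ᶠ i in l, ∀ k ∈ Finset.range (n i), |s i k| ≤ δ ∧ |t i k| ≤ δ)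
    {M : ℝ} (hM : ∀ᶠ i in l, ∑ k ∈ Finset.range (n i), (s i k ^ 2 + t i k ^ 2) ≤ M) {q : ℝ}
    (hq : Tendsto (fun i => ∑ k ∈ Finset.range (n i), ∫ ω, (s i k * A₀ ω + t i k * B₀ ω) ^ 2 ∂P) l
      (𝓝 q)) :
    Tendsto (fun i => ∏ k ∈ Finset.range (n i),
      ∫ ω, Complex.exp ((s i k * A i ω + t i k * B i ω : ℝ) * I) ∂P) l
      (𝓝 (Real.exp (-q / 2) : ℂ)) := by
  set G : ι → ℕ → ℝ := fun i k =>
    Real.exp (-(∫ ω, (s i k * A₀ ω + t i k * B₀ ω) ^ 2 ∂P) / 2) with hG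
  have hGprod : Tendsto (fun i => ∏ k ∈ Finset.range (n i), (G i k : ℂ)) l
      (𝓝 (Real.exp (-q / 2) : ℂ)) := by
    have e : ∀ i, ∏ k ∈ Finset.range (n i), (G i k : ℂ) = ((Real.exp (-(∑ k ∈ Finset.range (n i),
        ∫ ω, (s i k * A₀ ω + t i k * B₀ ω) ^ 2 ∂P) / 2) : ℝ) : ℂ) := by
      intro i
      rw [← Complex.ofReal_prod, ← Real.exp_sum]
      congr 2
      rw [← Finset.sum_div, Finset.sum_neg_distrib]
    simp_rw [e]
    exact (Complex.continuous_ofReal.tendsto _).comp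
      ((Real.continuous_exp.tendsto _).comp (hq.neg.div_const 2))
  suffices h : Tendsto (fun i => ∏ k ∈ Finset.range (n i),
      ∫ ω, Complex.exp ((s i k * A i ω + t i k * B i ω : ℝ) * I) ∂P
      - ∏ k ∈ Finset.range (n i), (G i k : ℂ)) l (𝓝 0) by
    simpa using h.add hGprod
  rw [Metric.tendsto_nhds]
  intro ε hε
  set M' := |M| + 1 with hM'
  have hM'0 : 0 < M' := by positivity
  set E := ∫ ω, A₀ ω ^ 2 ∂P + ∫ ω, B₀ ω ^ 2 ∂P with hE
  have hE0 : 0 ≤ E := add_nonneg (integral_nonneg fun ω => sq_nonneg _)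
    (integral_nonneg fun ω => sq_nonneg _)
  set η := ε / (4 * M') with hη
  have hη0 : 0 < η := by positivity
  obtain ⟨δ, hδ0, hδ⟩ := charFun_taylor hA₀ hB₀ hA₀0 hB₀0 hη0
  set κ := η / (E + 1) with hκ
  have hκ0 : 0 < κ := by positivity
  have hκE : κ * E ≤ η := by
    rw [hκ, div_mul_eq_mul_div, div_le_iff₀ (by positivity)]; nlinarith
  have hd : Tendsto (fun i => (2 + 1 / κ) * (∫ ω, (A i ω - A₀ ω) ^ 2 ∂P
      + ∫ ω, (B i ω - B₀ ω) ^ 2 ∂P)) l (𝓝 0) := by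
    simpa using (hAl.add hBl).const_mul (2 + 1 / κ)
  filter_upwards [hA, hB, hsmall δ hδ0, hM, hd.eventually_lt_const hη0]
    with i hAi hBi hsi hMi hdi
  rw [dist_zero_right]
  have h1 := norm_prod_sub_prod_le (Finset.range (n i))
    (a := fun k => ∫ ω, Complex.exp ((s i k * A i ω + t i k * B i ω : ℝ) * I) ∂P)
    (b := fun k => (G i k : ℂ)) (fun k _ => by
      refine (norm_integral_le_of_norm_le_const (C := 1) (ae_of_all _ fun ω => ?_)).trans ?_
      · rw [Complex.norm_exp_ofReal_mul_I]
      · simp) (fun k _ => by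
      rw [Complex.norm_real, Real.norm_of_nonneg (Real.exp_pos _).le, Real.exp_le_one_iff]
      have : 0 ≤ ∫ ω, (s i k * A₀ ω + t i k * B₀ ω) ^ 2 ∂P := integral_nonneg fun ω => sq_nonneg _
      linarith)
  refine h1.trans_lt ?_
  have h2 : ∀ k ∈ Finset.range (n i),
      ‖∫ ω, Complex.exp ((s i k * A i ω + t i k * B i ω : ℝ) * I) ∂P - (G i k : ℂ)‖
        ≤ (s i k ^ 2 + t i k ^ 2) * (3 * η) := by
    intro k hk
    have h3 := norm_charFun_sub_le hAi.1 hBi.1 hA₀ hB₀ hAi.2 hBi.2 hA₀0 hB₀0 hκ0 (s i k) (t i k)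
    have h4 := hδ (s i k) (t i k) (hsi k hk).1 (hsi k hk).2
    have h5 : (s i k ^ 2 + t i k ^ 2) * ((2 + 1 / κ) * (∫ ω, (A i ω - A₀ ω) ^ 2 ∂P
        + ∫ ω, (B i ω - B₀ ω) ^ 2 ∂P) + κ * E) ≤ (s i k ^ 2 + t i k ^ 2) * (η + η) := by
      gcongr
    have h6 := norm_sub_le_norm_sub_add_norm_sub
      (∫ ω, Complex.exp ((s i k * A i ω + t i k * B i ω : ℝ) * I) ∂P)
      (∫ ω, Complex.exp ((s i k * A₀ ω + t i k * B₀ ω : ℝ) * I) ∂P) (G i k : ℂ)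
    linarith
  calc _ ≤ ∑ k ∈ Finset.range (n i), (s i k ^ 2 + t i k ^ 2) * (3 * η) := Finset.sum_le_sum h2
    _ = (∑ k ∈ Finset.range (n i), (s i k ^ 2 + t i k ^ 2)) * (3 * η) := by rw [Finset.sum_mul]
    _ ≤ M' * (3 * η) := by
        have : M ≤ M' := by rw [hM']; linarith [le_abs_self M]
        gcongr; linarith
    _ < ε := by
        rw [hη]
        have : M' * (3 * (ε / (4 * M'))) = 3 / 4 * ε := by field_simp
        rw [this]; linarith

end CharFun

section Levy

variable {E : Type*} [NormedAddCommGroup E] [InnerProductSpace ℝ E] [FiniteDimensional ℝ E]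
  [MeasurableSpace E] [BorelSpace E]

/-- Lévy's continuity theorem along a countably generated filter. -/
lemma tendsto_probabilityMeasure_of_charFun {ι : Type*} {l : Filter ι} [l.IsCountablyGenerated]
    {μ : ι → ProbabilityMeasure E} {μ₀ : ProbabilityMeasure E}
    (h : ∀ t : E, Tendsto (fun i => charFun (μ i : Measure E) t) l
      (𝓝 (charFun (μ₀ : Measure E) t))) : Tendsto μ l (𝓝 μ₀) := by
  refine tendsto_of_seq_tendsto fun u hu => ?_
  exact ProbabilityMeasure.tendsto_of_tendsto_charFun fun t => (h t).comp hu

end Levy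

/-! ### The nested losses converge in mean square -/

section Loss

variable {Ω : Type*} {mΩ : MeasurableSpace Ω} {P : Measure Ω} [IsProbabilityMeasure P]

/-- A conditional expectation given an independent variable is computed by freezing that
variable. -/
lemma condExp_comap_ae_eq {E F : Type*} [MeasurableSpace E] [MeasurableSpace F]
    [StandardBorelSpace F] [Nonempty F] {φ : E × F → ℝ} (hφ : Measurable φ) {Y : Ω → E}
    (hY : Measurable Y) {Z : Ω → F} (hZ : Measurable Z) (hYZ : IndepFun Y Z P)
    (hint : Integrable (fun ω => φ (Y ω, Z ω)) P) :
    P[fun ω => φ (Y ω, Z ω) | MeasurableSpace.comap Y inferInstance] =ᵐ[P]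
      fun ω => ∫ z, φ (Y ω, z) ∂P.map Z := by
  have := Measure.isProbabilityMeasure_map (μ := P) hZ.aemeasurable
  have := Measure.isProbabilityMeasure_map (μ := P) hY.aemeasurable
  have h1 := condExp_prod_ae_eq_integral_condDistrib hY hZ.aemeasurable hφ.stronglyMeasurable hint
  have h2 : condDistrib Z Y P =ᵐ[P.map Y] Kernel.const E (P.map Z) := by
    refine condDistrib_ae_eq_of_measure_eq_compProd Y hZ.aemeasurable ?_
    rw [Measure.compProd_const]
    exact (indepFun_iff_map_prod_eq_prod_map_map hY.aemeasurable hZ.aemeasurable).1 hYZ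
  filter_upwards [h1, ae_of_ae_map hY.aemeasurable h2] with ω hω1 hω2
  rw [hω1, hω2, Kernel.const_apply]

variable {d q : ℕ} {φ : (Fin d → ℝ) × (Fin q → ℝ) → ℝ} {Y : Ω → Fin d → ℝ} {Z : Ω → Fin q → ℝ}
  {Zs : ℕ → Ω → Fin q → ℝ}

omit [IsProbabilityMeasure P] in
lemma loss_zero : loss P φ Y Z Zs 0 =
    P[fun ω => φ (Y ω, Z ω) | MeasurableSpace.comap Y inferInstance] := if_pos rfl

omit [IsProbabilityMeasure P] in
lemma loss_one_div {K : ℕ} (hK : 0 < K) : loss P φ Y Z Zs (1 / K) =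
    fun ω => 1 / (K : ℝ) * ∑ k ∈ Finset.range K, φ (Y ω, Zs k ω) := by
  have h : (1 / (K : ℝ)) ≠ 0 := by positivity
  rw [loss, if_neg h]
  simp

/-- The losses are square integrable, and the squared distance in `L²` of the loss with bias
parameter `h` to the limiting loss is of order `h`, as the inner samples are conditionally
independent given `Y`. -/
theorem exists_integral_loss_sub_sq_le (hφ : Measurable φ) (hY : Measurable Y) (hZ : Measurable Z)
    (hYZ : IndepFun Y Z P) (hZs : ∀ k, IdentDistrib (Zs k) Z P P) (hind : iIndepFun Zs P)
    (hYZs : IndepFun Y (fun ω k => Zs k ω) P) (h2 : MemLp (fun ω => φ (Y ω, Z ω)) 2 P) :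
    (∀ h ∈ insert 0 biasSet, MemLp (loss P φ Y Z Zs h) 2 P) ∧
    ∃ C, ∀ h ∈ biasSet,
      ∫ ω, (loss P φ Y Z Zs h ω - loss P φ Y Z Zs 0 ω) ^ 2 ∂P ≤ C * h := by
  set μ := P.map Z with hμ
  have hμp : IsProbabilityMeasure μ := Measure.isProbabilityMeasure_map (μ := P) hZ.aemeasurable
  obtain ⟨Z', hZ'm, hZ'ae, -, ℱ, hYℱ, hI⟩ := exists_innovations hY
    (fun k => (hZs k).aemeasurable_fst) (fun k => (hZs k).map_eq) hind hYZs
  set g : (Fin d → ℝ) → ℝ := fun y => ∫ z, φ (y, z) ∂μ with hg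
  have hgm : Measurable g := hφ.stronglyMeasurable.integral_prod_right'.measurable
  have hX0 : loss P φ Y Z Zs 0 =ᵐ[P] fun ω => g (Y ω) := by
    rw [loss_zero]
    exact condExp_comap_ae_eq hφ hY hZ hYZ (h2.integrable one_le_two)
  have hX0L : MemLp (loss P φ Y Z Zs 0) 2 P := by
    rw [loss_zero]; exact h2.condExp one_le_two
  have hgL : MemLp (fun ω => g (Y ω)) 2 P := hX0L.ae_eq hX0
  have hYℱn : ∀ n, Measurable[ℱ n] Y := fun n => hYℱ.mono (ℱ.mono (Nat.zero_le n)) le_rfl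
  have hid : ∀ k, IdentDistrib (fun ω => (Y ω, Z' k ω)) (fun ω => (Y ω, Z ω)) P P := by
    intro k
    refine ⟨(hY.prodMk (hZ'm k)).aemeasurable, (hY.prodMk hZ).aemeasurable, ?_⟩
    rw [hI.map_prodMk (hYℱn k),
      (indepFun_iff_map_prod_eq_prod_map_map hY.aemeasurable hZ.aemeasurable).1 hYZ]
  have hφk : ∀ k, MemLp (fun ω => φ (Y ω, Z' k ω)) 2 P := fun k =>
    ((hid k).comp hφ).memLp_iff.2 h2
  set G : (Fin d → ℝ) × (Fin q → ℝ) → ℝ := fun p => φ p - g p.1 with hG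
  have hGm : Measurable G := hφ.sub (hgm.comp measurable_fst)
  have hG0 : ∀ y, ∫ z, G (y, z) ∂μ = 0 := by
    intro y
    by_cases hy : Integrable (fun z => φ (y, z)) μ
    · simp only [hG]
      rw [integral_sub hy (integrable_const _)]
      simp [hg]
    · have h3 : g y = 0 := integral_undef hy
      simp only [hG, h3, sub_zero]
      exact h3
  have hGL : ∀ k, MemLp (fun ω => G (Y ω, Z' k ω)) 2 P := fun k => (hφk k).sub hgL
  have hGid : ∀ k, ∫ ω, G (Y ω, Z' k ω) ^ 2 ∂P = ∫ ω, G (Y ω, Z ω) ^ 2 ∂P := fun k =>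
    ((hid k).comp (hGm.pow_const 2)).integral_eq
  have hXK : ∀ K : ℕ, 0 < K → loss P φ Y Z Zs (1 / K) =ᵐ[P]
      fun ω => 1 / (K : ℝ) * ∑ k ∈ Finset.range K, φ (Y ω, Z' k ω) := by
    intro K hK
    rw [loss_one_div hK]
    filter_upwards [ae_all_iff.2 hZ'ae] with ω hω
    simp only [hω]
  refine ⟨?_, ∫ ω, G (Y ω, Z ω) ^ 2 ∂P, ?_⟩
  · rintro h (rfl | ⟨K, hK, rfl⟩)
    · exact hX0L
    · refine MemLp.ae_eq (hXK K hK).symm ?_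
      exact (memLp_finsetSum _ fun k _ => hφk k).const_mul _
  · rintro h ⟨K, hK, rfl⟩
    have hK0 : (0 : ℝ) < K := by exact_mod_cast hK
    have e : ∫ ω, (loss P φ Y Z Zs (1 / K) ω - loss P φ Y Z Zs 0 ω) ^ 2 ∂P
        = ∫ ω, (1 / (K : ℝ)) ^ 2 * (∑ k ∈ Finset.range K, G (Y ω, Z' k ω)) ^ 2 ∂P := by
      refine integral_congr_ae ?_
      filter_upwards [hXK K hK, hX0] with ω h3 h4
      rw [h3, h4, ← mul_pow]
      congr 1
      simp only [hG, Finset.sum_sub_distrib, Finset.sum_const, Finset.card_range, nsmul_eq_mul]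
      field_simp
    rw [e, integral_const_mul, hI.integral_sum_sq (W := fun _ => Y) hYℱn hGm hG0 hGL]
    simp only [hGid, Finset.sum_const, Finset.card_range, nsmul_eq_mul]
    apply le_of_eq
    field_simp

end Loss

/-! ### Bias of the value-at-risk and of the expected shortfall -/

section Transfer

variable {Ω : Type*} {mΩ : MeasurableSpace Ω} {P : Measure Ω} {X : Ω → ℝ}

lemma cdf_map [IsProbabilityMeasure P] (hX : AEMeasurable X P) (ξ : ℝ) :
    cdf (P.map X) ξ = P.real {ω | X ω ≤ ξ} := by
  have := Measure.isProbabilityMeasure_map (μ := P) hX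
  rw [cdf_eq_real, map_measureReal_apply_of_aemeasurable hX measurableSet_Iic]
  rfl

lemma valueAtRisk_map (hX : AEMeasurable X P) : valueAtRisk (P.map X) id = valueAtRisk P X := by
  funext a
  rw [valueAtRisk, valueAtRisk]
  congr 1
  ext ξ
  have h : {y : ℝ | id y ≤ ξ} = Set.Iic ξ := rfl
  rw [Set.mem_ofPred_eq, Set.mem_ofPred_eq, h,
    map_measureReal_apply_of_aemeasurable hX measurableSet_Iic]
  rfl

lemma integral_map_max_sub (hX : AEMeasurable X P) (ξ : ℝ) :
    ∫ y, max (y - ξ) 0 ∂P.map X = ∫ ω, max (X ω - ξ) 0 ∂P :=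
  integral_map hX (by fun_prop)

lemma objective_map (hX : AEMeasurable X P) (α : ℝ) :
    objective (P.map X) α id = objective P α X := by
  funext ξ
  rw [objective, objective, ← integral_map_max_sub hX]
  rfl

lemma expectedShortfall_map (hX : AEMeasurable X P) (α : ℝ) :
    expectedShortfall (P.map X) id α = expectedShortfall P X α := by
  rw [expectedShortfall, expectedShortfall, valueAtRisk_map hX]

end Transfer

lemma eventually_mem_biasSet : ∀ᶠ h in 𝓝[biasSet] (0 : ℝ), h ∈ biasSet := self_mem_nhdsWithin

lemma pos_of_mem_biasSet {h : ℝ} (hh : h ∈ biasSet) : 0 < h := by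
  obtain ⟨K, hK, rfl⟩ := hh; positivity

lemma mem_insert_biasSet {h : ℝ} (hh : h ∈ biasSet) : h ∈ insert 0 biasSet :=
  Set.mem_insert_of_mem _ hh

lemma zero_mem_insert_biasSet : (0 : ℝ) ∈ insert 0 biasSet := Set.mem_insert _ _

lemma tendsto_id_biasSet : Tendsto (fun h : ℝ => h) (𝓝[biasSet] 0) (𝓝 0) :=
  tendsto_id.mono_left nhdsWithin_le_nhds

namespace RegularLaws

variable {Ω : Type*} {mΩ : MeasurableSpace Ω} {P : Measure Ω} [IsProbabilityMeasure P]
  {α : ℝ} {X : ℝ → Ω → ℝ} {f : ℝ → ℝ → ℝ} {v : ℝ → ℝ} {w : ℝ → ℝ → ℝ}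

omit [IsProbabilityMeasure P] in
lemma exists_regularDensity (hreg : RegularLaws P α X f v w)
    (hX : ∀ h ∈ insert 0 biasSet, Integrable (X h) P) :
    ∃ C : ℝ≥0, ∀ h ∈ insert 0 biasSet, RegularDensity (P.map (X h)) (f h) C := by
  obtain ⟨C, hC⟩ := hreg.pdf_bounded_lipschitz
  refine ⟨C, fun h hh => ⟨(hreg.pdf h hh).1, fun x => ?_, (hreg.pdf h hh).2.2, fun x => ?_,
    (hC h hh).2, ?_⟩⟩
  · obtain ⟨c, hc, hcf⟩ := hreg.pdf_lower (|x - valueAtRisk P (X 0) α| + 1) (by positivity)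
    refine hc.trans_le (hcf h hh x ?_)
    rw [Metric.mem_ball, Real.dist_eq]; linarith
  · exact (le_abs_self _).trans ((hC h hh).1 x)
  · exact (integrable_map_measure aestronglyMeasurable_id (hX h hh).aemeasurable).2 (hX h hh)

section Bias

variable {C : ℝ≥0} {z : ℝ → ℝ}

/-- The densities are bounded below near the value-at-risk, so that the value-at-risk moves at most
proportionally to the distribution function. -/
lemma exists_abs_valueAtRisk_sub_le (hreg : RegularLaws P α X f v w) (hα : α ∈ Set.Ioo (0 : ℝ) 1)
    (hX : ∀ h ∈ insert 0 biasSet, AEMeasurable (X h) P)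
    (hρ : ∀ h ∈ insert 0 biasSet, RegularDensity (P.map (X h)) (f h) C)
    (hz : ∀ h ∈ insert 0 biasSet, cdf (P.map (X h)) (z h) = α) :
    ∃ B, 0 ≤ B ∧ ∀ᶠ h in 𝓝[biasSet] 0, |z h - z 0| ≤ B * h := by
  have h0 := zero_mem_insert_biasSet
  have := Measure.isProbabilityMeasure_map (μ := P) (hX 0 h0)
  have hz0 : valueAtRisk P (X 0) α = z 0 := by
    rw [← valueAtRisk_map (hX 0 h0), ← hz 0 h0, (hρ 0 h0).valueAtRisk_cdf]
  obtain ⟨c, hc, hcf⟩ := hreg.pdf_lower 2 (by norm_num)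
  rw [hz0] at hcf
  have hmem : z 0 ∈ Argmin (objective P α (X 0)) := by
    rw [← objective_map (hX 0 h0)]; exact (hρ 0 h0).mem_Argmin (hz 0 h0) hα.2
  refine ⟨(|v (z 0)| + 1) / c, by positivity, ?_⟩
  have hw := (hreg.remainder _ hmem).abs.eventually_lt_const (u := 1) (by simp)
  have hsmall : ∀ᶠ h in 𝓝[biasSet] (0 : ℝ), (|v (z 0)| + 1) * h < c := by
    have := tendsto_id_biasSet.const_mul (|v (z 0)| + 1)
    rw [mul_zero] at this
    exact this.eventually_lt_const hc
  filter_upwards [eventually_mem_biasSet, hw, hsmall] with h hh hwh hsh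
  have hh' := mem_insert_biasSet hh
  have hpos := pos_of_mem_biasSet hh
  have := Measure.isProbabilityMeasure_map (μ := P) (hX h hh')
  set F := cdf (P.map (X h)) with hF
  have h1 : |F (z 0) - α| ≤ (|v (z 0)| + 1) * h := by
    have e := hreg.expansion h hh (z 0)
    rw [← cdf_map (hX h hh'), ← cdf_map (hX 0 h0), hz 0 h0] at e
    rw [hF, e, ← add_mul, abs_mul, abs_of_pos hpos]
    gcongr
    exact (abs_add_le _ _).trans (by linarith)
  have hmono := (hρ h hh').strictMono_cdf.monotone
  have key : c * min |z h - z 0| 1 ≤ |F (z 0) - α| := by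
    rcases le_total (z 0) (z h) with hle | hle
    · rw [abs_of_nonneg (by linarith : 0 ≤ z h - z 0)]
      set y := z 0 + min (z h - z 0) 1 with hy
      have hy0 : 0 ≤ min (z h - z 0) 1 := le_min (by linarith) zero_le_one
      have h2 := (hρ h hh').le_cdf_sub (c := c) (a := z 0) (b := y) (by linarith) (fun x hx => by
        refine hcf h hh' x ?_
        rw [Metric.mem_ball, Real.dist_eq, abs_of_nonneg (by linarith [hx.1])]
        have := min_le_right (z h - z 0) 1
        linarith [hx.2])
      have h3 : F y ≤ F (z h) := hmono (by have := min_le_left (z h - z 0) 1; linarith)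
      rw [hF, hz h hh'] at h3
      rw [hy, add_sub_cancel_left] at h2
      have := neg_abs_le (F (z 0) - α)
      linarith
    · rw [abs_of_nonpos (by linarith : z h - z 0 ≤ 0), neg_sub]
      set y := z 0 - min (z 0 - z h) 1 with hy
      have hy0 : 0 ≤ min (z 0 - z h) 1 := le_min (by linarith) zero_le_one
      have h2 := (hρ h hh').le_cdf_sub (c := c) (a := y) (b := z 0) (by linarith) (fun x hx => by
        refine hcf h hh' x ?_
        rw [Metric.mem_ball, Real.dist_eq, abs_of_nonpos (by linarith [hx.2])]
        have := min_le_right (z 0 - z h) 1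
        linarith [hx.1])
      have h3 : F (z h) ≤ F y := hmono (by have := min_le_left (z 0 - z h) 1; linarith)
      rw [hF, hz h hh'] at h3
      rw [hy, sub_sub_cancel] at h2
      have := le_abs_self (F (z 0) - α)
      linarith
  rcases min_cases |z h - z 0| 1 with ⟨hm, -⟩ | ⟨hm, -⟩
  · rw [hm] at key
    rw [div_mul_eq_mul_div, le_div_iff₀ hc]
    linarith
  · rw [hm] at key
    linarith

variable (hreg : RegularLaws P α X f v w) (hα : α ∈ Set.Ioo (0 : ℝ) 1)
    (hX : ∀ h ∈ insert 0 biasSet, AEMeasurable (X h) P)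
    (hρ : ∀ h ∈ insert 0 biasSet, RegularDensity (P.map (X h)) (f h) C)
    (hz : ∀ h ∈ insert 0 biasSet, cdf (P.map (X h)) (z h) = α)

include hreg hα hX hρ hz

lemma tendsto_valueAtRisk : Tendsto z (𝓝[biasSet] 0) (𝓝 (z 0)) := by
  obtain ⟨B, hB, h⟩ := hreg.exists_abs_valueAtRisk_sub_le hα hX hρ hz
  rw [tendsto_iff_dist_tendsto_zero]
  have := tendsto_id_biasSet.const_mul B
  rw [mul_zero] at this
  exact squeeze_zero' (Eventually.of_forall fun _ => dist_nonneg) h this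

lemma tendsto_density_valueAtRisk :
    Tendsto (fun h => f h (z h)) (𝓝[biasSet] 0) (𝓝 (f 0 (z 0))) := by
  have h1 := hreg.tendsto_valueAtRisk hα hX hρ hz
  have h2 : Tendsto (fun h => f h (z 0)) (𝓝[biasSet] 0) (𝓝 (f 0 (z 0))) :=
    hreg.pdf_tendsto.tendstoLocallyUniformlyOn.tendsto_at (Set.mem_univ (z 0))
  have h3 : Tendsto (fun h => f h (z h) - f h (z 0)) (𝓝[biasSet] 0) (𝓝 0) := by
    refine squeeze_zero_norm' (a := fun h => C * dist (z h) (z 0)) ?_ ?_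
    · filter_upwards [eventually_mem_biasSet] with h hh
      exact (hρ h (mem_insert_biasSet hh)).lipschitz.dist_le_mul _ _
    · simpa using (tendsto_iff_dist_tendsto_zero.1 h1).const_mul (C : ℝ)
  simpa using h3.add h2

/-- The bias of the value-at-risk. Since `F_h(z_h) = F_0(z_0) = α`, the increment of `F_h` between
`z_0` and `z_h` is `-(v + w) h`, evaluated at `z_0`. -/
lemma tendsto_valueAtRisk_sub_div :
    Tendsto (fun h => h⁻¹ * (z h - z 0)) (𝓝[biasSet] 0) (𝓝 (-(v (z 0) / f 0 (z 0)))) := by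
  have h0 := zero_mem_insert_biasSet
  obtain ⟨B, hB, hBh⟩ := hreg.exists_abs_valueAtRisk_sub_le hα hX hρ hz
  have hmem : z 0 ∈ Argmin (objective P α (X 0)) := by
    have := Measure.isProbabilityMeasure_map (μ := P) (hX 0 h0)
    rw [← objective_map (hX 0 h0)]; exact (hρ 0 h0).mem_Argmin (hz 0 h0) hα.2
  have h2 : Tendsto (fun h => f h (z 0)) (𝓝[biasSet] 0) (𝓝 (f 0 (z 0))) :=
    hreg.pdf_tendsto.tendstoLocallyUniformlyOn.tendsto_at (Set.mem_univ (z 0))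
  have hf0 := (hρ 0 h0).pos (z 0)
  have h3 : Tendsto (fun h => h⁻¹ * (z h - z 0) * f h (z 0)) (𝓝[biasSet] 0) (𝓝 (-v (z 0))) := by
    have h4 : Tendsto (fun h => -(v (z 0) + w (z 0) h)) (𝓝[biasSet] 0) (𝓝 (-v (z 0))) := by
      simpa using ((hreg.remainder _ hmem).const_add (v (z 0))).neg
    have h5 : Tendsto (fun h => h⁻¹ * (z h - z 0) * f h (z 0) - -(v (z 0) + w (z 0) h))
        (𝓝[biasSet] 0) (𝓝 0) := by
      refine squeeze_zero_norm' (a := fun h => C * B ^ 2 * h) ?_ ?_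
      · filter_upwards [eventually_mem_biasSet, hBh] with h hh hBh
        have hh' := mem_insert_biasSet hh
        have hpos := pos_of_mem_biasSet hh
        have := Measure.isProbabilityMeasure_map (μ := P) (hX h hh')
        have e := hreg.expansion h hh (z 0)
        rw [← cdf_map (hX h hh'), ← cdf_map (hX 0 h0), hz 0 h0] at e
        have h6 := (hρ h hh').abs_cdf_sub_sub_le (z 0) (z h)
        rw [hz h hh'] at h6
        have e2 : h⁻¹ * (z h - z 0) * f h (z 0) - -(v (z 0) + w (z 0) h)
            = -(h⁻¹ * (α - cdf (P.map (X h)) (z 0) - f h (z 0) * (z h - z 0))) := by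
          have : cdf (P.map (X h)) (z 0) = α + (v (z 0) + w (z 0) h) * h := by linarith
          rw [this]; field_simp; ring
        rw [e2, norm_neg, norm_mul, norm_inv, Real.norm_of_nonneg hpos.le, Real.norm_eq_abs,
          inv_mul_le_iff₀ hpos]
        refine h6.trans ?_
        have h7 : (z h - z 0) ^ 2 ≤ (B * h) ^ 2 := by rw [← sq_abs]; gcongr
        have := mul_le_mul_of_nonneg_left h7 C.coe_nonneg
        linarith
      · simpa using tendsto_id_biasSet.const_mul (C * B ^ 2 : ℝ)
    simpa using h5.add h4
  have h8 := h3.div h2 hf0.ne'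
  rw [neg_div] at h8
  refine h8.congr' ?_
  filter_upwards [eventually_mem_biasSet] with h hh
  have := (hρ h (mem_insert_biasSet hh)).pos (z 0)
  simp only [Pi.div_apply]
  field_simp

/-- The bias of the expected shortfall. The difference of the minima is `V_h(z_0) - V_0(z_0)`, an
integral of `F_0 - F_h` over `(z_0, ∞)`, up to `O((z_h - z_0)²) = O(h²)`. -/
lemma tendsto_objective_sub_div :
    Tendsto (fun h => h⁻¹ * (objective P α (X h) (z h) - objective P α (X 0) (z 0)))
      (𝓝[biasSet] 0) (𝓝 (-∫ x in Set.Ioi (z 0), v x / (1 - α))) := by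
  have h0 := zero_mem_insert_biasSet
  have h1α : (0 : ℝ) < 1 - α := by linarith [hα.2]
  have hp0 := Measure.isProbabilityMeasure_map (μ := P) (hX 0 h0)
  obtain ⟨B, hB, hBh⟩ := hreg.exists_abs_valueAtRisk_sub_le hα hX hρ hz
  have hmem : z 0 ∈ Argmin (objective P α (X 0)) := by
    rw [← objective_map (hX 0 h0)]; exact (hρ 0 h0).mem_Argmin (hz 0 h0) hα.2
  have h1 : Tendsto (fun h => h⁻¹ * (objective P α (X h) (z h) - objective P α (X h) (z 0)))
      (𝓝[biasSet] 0) (𝓝 0) := by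
    refine squeeze_zero_norm' (a := fun h => C / (1 - α) * B ^ 2 * h) ?_ ?_
    · filter_upwards [eventually_mem_biasSet, hBh] with h hh hBh
      have hh' := mem_insert_biasSet hh
      have hpos := pos_of_mem_biasSet hh
      have := Measure.isProbabilityMeasure_map (μ := P) (hX h hh')
      have h2 := (hρ h hh').objective_sub_le (hz h hh') hα.2 (z 0)
      have h3 := (hρ h hh').mem_Argmin (hz h hh') hα.2 (z 0)
      rw [objective_map (hX h hh')] at h2 h3
      rw [norm_mul, norm_inv, Real.norm_of_nonneg hpos.le, Real.norm_of_nonpos (by linarith),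
          inv_mul_le_iff₀ hpos, neg_sub]
      refine h2.trans ?_
      have h7 : (z 0 - z h) ^ 2 ≤ (B * h) ^ 2 := by rw [← sq_abs, abs_sub_comm]; gcongr
      have := mul_le_mul_of_nonneg_left h7 (show 0 ≤ C / (1 - α) by positivity)
      linarith
    · simpa using tendsto_id_biasSet.const_mul (C / (1 - α) * B ^ 2 : ℝ)
  have h2 : Tendsto (fun h => -(1 / (1 - α) * ((∫ x in Set.Ioi (z 0), v x)
      + ∫ x in Set.Ioi (z 0), w x h))) (𝓝[biasSet] 0)
      (𝓝 (-∫ x in Set.Ioi (z 0), v x / (1 - α))) := by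
    have := (((hreg.remainder_integral _ hmem).const_add (∫ x in Set.Ioi (z 0), v x)).const_mul
      (1 / (1 - α))).neg
    rw [add_zero, one_div_mul_eq_div, ← integral_div] at this
    exact this
  have h3 : (fun h => h⁻¹ * (objective P α (X h) (z 0) - objective P α (X 0) (z 0)))
      =ᶠ[𝓝[biasSet] 0] fun h => -(1 / (1 - α) * ((∫ x in Set.Ioi (z 0), v x)
      + ∫ x in Set.Ioi (z 0), w x h)) := by
    filter_upwards [eventually_mem_biasSet] with h hh
    have hh' := mem_insert_biasSet hh
    have hpos := pos_of_mem_biasSet hh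
    have := Measure.isProbabilityMeasure_map (μ := P) (hX h hh')
    have i1 := (hρ h hh').integrableOn_one_sub_cdf (z 0)
    have i0 := (hρ 0 h0).integrableOn_one_sub_cdf (z 0)
    have iv := hreg.integrable_v _ hmem
    have e : ∀ ξ, w ξ h = h⁻¹ * ((1 - cdf (P.map (X 0)) ξ) - (1 - cdf (P.map (X h)) ξ)) - v ξ := by
      intro ξ
      have e := hreg.expansion h hh ξ
      rw [← cdf_map (hX h hh'), ← cdf_map (hX 0 h0)] at e
      have : cdf (P.map (X h)) ξ = cdf (P.map (X 0)) ξ + (v ξ + w ξ h) * h := by linarith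
      rw [this]; field_simp; ring
    have e2 : ∫ x in Set.Ioi (z 0), w x h = h⁻¹ * ((∫ x in Set.Ioi (z 0), (1 - cdf (P.map (X 0)) x))
        - ∫ x in Set.Ioi (z 0), (1 - cdf (P.map (X h)) x)) - ∫ x in Set.Ioi (z 0), v x := by
      simp_rw [e]
      have i2 : IntegrableOn (fun ξ => (1 - cdf (P.map (X 0)) ξ) - (1 - cdf (P.map (X h)) ξ))
        (Set.Ioi (z 0)) := i0.sub i1
      rw [integral_sub (i2.const_mul _) iv, integral_const_mul, integral_sub i0 i1]
    rw [e2, ← objective_map (hX h hh'), ← objective_map (hX 0 h0), objective, objective]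
    simp only [id]
    rw [(hρ h hh').integral_max_sub_eq, (hρ 0 h0).integral_max_sub_eq]
    ring
  refine ((h1.add (h2.congr' h3.symm)).congr fun h => ?_).trans (by rw [zero_add])
  ring

end Bias

end RegularLaws

/-! ### The drift condition -/

lemma sinh_le_mul_cosh {y : ℝ} (hy : 0 ≤ y) : Real.sinh y ≤ y * Real.cosh y := by
  have h := (convex_Icc 0 y).image_sub_le_mul_sub_of_deriv_le (f := Real.sinh) (C := Real.cosh y)
    Real.continuous_sinh.continuousOn Real.differentiable_sinh.differentiableOn
    (fun x hx => by
      rw [interior_Icc] at hx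
      rw [Real.deriv_sinh, Real.cosh_le_cosh, abs_of_nonneg hy, abs_of_nonneg hx.1.le]
      exact hx.2.le) 0 ⟨le_rfl, hy⟩ y ⟨hy, le_rfl⟩ hy
  rw [Real.sinh_zero] at h
  linarith

lemma cosh_sub_one_le_mul_sinh {x : ℝ} (hx : 0 ≤ x) :
    Real.cosh x - 1 ≤ x / 2 * Real.sinh x := by
  have h1 := sinh_le_mul_cosh (y := x / 2) (by positivity)
  have h2 : 0 ≤ Real.sinh (x / 2) := Real.sinh_nonneg_iff.2 (by positivity)
  have e1 : Real.cosh x = Real.cosh (x / 2) ^ 2 + Real.sinh (x / 2) ^ 2 := by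
    rw [← Real.cosh_two_mul]; congr 1; ring
  have e2 : Real.sinh x = 2 * Real.sinh (x / 2) * Real.cosh (x / 2) := by
    rw [← Real.sinh_two_mul]; congr 1; ring
  have e3 := Real.cosh_sq (x / 2)
  rw [e1, e2, e3]
  nlinarith

lemma cosh_sub_one_le_sinh {x : ℝ} (hx : 0 ≤ x) : Real.cosh x - 1 ≤ Real.sinh x := by
  have h1 := Real.cosh_sub_sinh x
  have h2 : Real.exp (-x) ≤ 1 := Real.exp_le_one_iff.2 (by linarith)
  linarith

/-- A function whose slope at the origin is at least `κ` up to distance `r`, and which is monotone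
beyond, dominates `(cosh - 1) / sinh`. -/
lemma mul_cosh_sub_one_le {a c κ r u y : ℝ} (ha : 0 ≤ a) (hc : 0 ≤ c)
    (hc₁ : c ≤ 2 * κ) (hc₂ : c ≤ a * κ * r) (hu : 0 ≤ u) (hy : κ * min u r ≤ y) :
    c * (Real.cosh (a * u) - 1) ≤ a * y * Real.sinh (a * u) := by
  have hx : 0 ≤ a * u := mul_nonneg ha hu
  have hs : 0 ≤ Real.sinh (a * u) := Real.sinh_nonneg_iff.2 hx
  rcases min_cases u r with ⟨h, -⟩ | ⟨h, -⟩ <;> rw [h] at hy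
  · calc c * (Real.cosh (a * u) - 1) ≤ c * (a * u / 2 * Real.sinh (a * u)) :=
          mul_le_mul_of_nonneg_left (cosh_sub_one_le_mul_sinh hx) hc
      _ = c * (a * u / 2) * Real.sinh (a * u) := by ring
      _ ≤ a * y * Real.sinh (a * u) := by
          refine mul_le_mul_of_nonneg_right ?_ hs
          have h1 : c * (a * u / 2) ≤ 2 * κ * (a * u / 2) := by gcongr
          have h2 : a * (κ * u) ≤ a * y := by gcongr
          linarith
  · calc c * (Real.cosh (a * u) - 1) ≤ c * Real.sinh (a * u) :=
          mul_le_mul_of_nonneg_left (cosh_sub_one_le_sinh hx) hc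
      _ ≤ a * y * Real.sinh (a * u) := by
          refine mul_le_mul_of_nonneg_right ?_ hs
          have h2 : a * (κ * r) ≤ a * y := by gcongr
          linarith

namespace RegularDensity

variable {ρ : Measure ℝ} {f : ℝ → ℝ} {C : ℝ≥0} {α z : ℝ} [IsProbabilityMeasure ρ]

/-- The drift condition on the Lyapunov function `cosh (a (ξ - z)) - 1` holds at rate `c` as soon as
the density is bounded below by `κ` at distance at most `r` of `z`. -/
lemma drift (hρ : RegularDensity ρ f C) (hz : cdf ρ z = α) (hα : α < 1) {a c κ r : ℝ}
    (ha : 0 ≤ a) (hr : 0 ≤ r) (hc : 0 ≤ c) (hf : ∀ x, |x - z| ≤ r → κ ≤ f x)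
    (hc₁ : c ≤ 2 * (κ / (1 - α))) (hc₂ : c ≤ a * (κ / (1 - α)) * r) (ξ : ℝ) :
    c * (Real.cosh (a * (ξ - z)) - 1) ≤
      a * (∫ y, H₁ α ξ y ∂ρ) * Real.sinh (a * (ξ - z)) := by
  have h1α : 0 < 1 - α := by linarith
  have hmono := hρ.strictMono_cdf.monotone
  rw [hρ.integral_H₁ ξ hα]
  rcases le_total z ξ with hle | hle
  · refine mul_cosh_sub_one_le ha hc hc₁ hc₂ (by linarith) ?_
    set y := z + min (ξ - z) r with hy
    have hy0 : 0 ≤ min (ξ - z) r := le_min (by linarith) hr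
    have h2 := hρ.le_cdf_sub (c := κ) (a := z) (b := y) (by linarith) (fun x hx => hf x (by
      rw [abs_of_nonneg (by linarith [hx.1])]
      linarith [hx.2, min_le_right (ξ - z) r]))
    have h3 := hmono (show y ≤ ξ by linarith [min_le_left (ξ - z) r])
    rw [hz, hy, add_sub_cancel_left] at h2
    rw [div_mul_eq_mul_div]
    gcongr
    linarith
  · have key := mul_cosh_sub_one_le (y := (α - cdf ρ ξ) / (1 - α)) (u := z - ξ) ha
      hc hc₁ hc₂ (by linarith) ?_
    · have e : a * (ξ - z) = -(a * (z - ξ)) := by ring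
      rw [e, Real.cosh_neg, Real.sinh_neg]
      refine key.trans_eq ?_
      ring
    · set y := z - min (z - ξ) r with hy
      have hy0 : 0 ≤ min (z - ξ) r := le_min (by linarith) hr
      have h2 := hρ.le_cdf_sub (c := κ) (a := y) (b := z) (by linarith) (fun x hx => hf x (by
        rw [abs_of_nonpos (by linarith [hx.2])]
        linarith [hx.1, min_le_right (z - ξ) r]))
      have h3 := hmono (show ξ ≤ y by linarith [min_le_left (z - ξ) r])
      rw [hz, hy, sub_sub_cancel] at h2
      rw [div_mul_eq_mul_div]
      gcongr
      linarith

omit [IsProbabilityMeasure ρ] in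
lemma bddAbove_abs (hρ : RegularDensity ρ f C) : BddAbove (Set.range fun x => |f x|) := by
  refine ⟨C, ?_⟩
  rintro _ ⟨x, rfl⟩
  simp only [abs_of_pos (hρ.pos x)]
  exact hρ.le x

omit [IsProbabilityMeasure ρ] in
lemma le_supNorm (hρ : RegularDensity ρ f C) (x : ℝ) : f x ≤ supNorm f :=
  (le_abs_self _).trans (le_ciSup hρ.bddAbove_abs x)

omit [IsProbabilityMeasure ρ] in
lemma supNorm_le (hρ : RegularDensity ρ f C) : supNorm f ≤ C :=
  ciSup_le fun x => by rw [abs_of_pos (hρ.pos x)]; exact hρ.le x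

omit [IsProbabilityMeasure ρ] in
lemma abs_sub_le_lipConst (hρ : RegularDensity ρ f C) (hα : α < 1) (x y : ℝ) :
    |f x / (1 - α) - f y / (1 - α)| ≤ lipConst (fun x => f x / (1 - α)) * |x - y| := by
  have h1α : 0 < 1 - α := by linarith
  rcases eq_or_ne x y with rfl | hxy
  · simp
  rw [← div_le_iff₀ (abs_pos.2 (sub_ne_zero.2 hxy))]
  refine le_ciSup
    (f := fun p : ℝ × ℝ => |f p.1 / (1 - α) - f p.2 / (1 - α)| / |p.1 - p.2|) ?_ (x, y)
  refine ⟨C / (1 - α), ?_⟩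
  rintro _ ⟨p, rfl⟩
  refine div_le_of_le_mul₀ (abs_nonneg _) (by positivity) ?_
  rw [← sub_div, abs_div, abs_of_pos h1α, div_mul_eq_mul_div]
  gcongr
  exact hρ.lipschitz.dist_le_mul p.1 p.2

/-- The drift condition holds at any rate `c` that is smaller than both quantities whose minimum
enters the definition of `λ`. -/
lemma drift_of_le (hρ : RegularDensity ρ f C) (hz : cdf ρ z = α) (hα : α < 1)
    {a c : ℝ} (hc : 0 < c)
    (ha : 4 * supNorm (fun x => f x / (1 - α)) ≤ a)
    (hc₁ : c ≤ 3 / 8 * (f z / (1 - α)))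
    (hc₂ : c ≤ supNorm (fun x => f x / (1 - α)) *
      ((f z / (1 - α)) ^ 4 / (4 * lipConst (fun x => f x / (1 - α)) ^ 2))) (ξ : ℝ) :
    c * (Real.cosh (a * (ξ - z)) - 1) ≤
      a * (∫ y, H₁ α ξ y ∂ρ) * Real.sinh (a * (ξ - z)) := by
  have h1α : 0 < 1 - α := by linarith
  set g : ℝ → ℝ := fun x => f x / (1 - α) with hg
  set L := supNorm g with hL
  set ℓ := lipConst g with hℓ
  set m := f z / (1 - α) with hm
  have hm0 : 0 < m := div_pos (hρ.pos z) h1α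
  have hL0 : 0 ≤ L := Real.iSup_nonneg fun x => abs_nonneg _
  have hℓ0 : 0 ≤ ℓ := Real.iSup_nonneg fun p => by positivity
  have hℓ1 : 0 < ℓ := by
    rcases hℓ0.eq_or_lt with h | h
    · rw [← h] at hc₂; simp at hc₂; linarith
    · exact h
  have ha0 : 0 ≤ a := by linarith
  have hf : ∀ x, |x - z| ≤ m / (2 * ℓ) → f z / 2 ≤ f x := by
    intro x hx
    have h1 := hρ.abs_sub_le_lipConst hα x z
    have h2 : ℓ * |x - z| ≤ m / 2 := by
      calc ℓ * |x - z| ≤ ℓ * (m / (2 * ℓ)) := by gcongr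
        _ = m / 2 := by field_simp
    have h3 := (abs_le.1 (h1.trans h2)).1
    rw [hm, ← sub_div, neg_le, ← neg_div, neg_sub, div_div, div_le_div_iff₀ h1α (by positivity)] at h3
    nlinarith
  have hκ : f z / 2 / (1 - α) = m / 2 := by rw [hm]; ring
  refine hρ.drift hz hα ha0 (by positivity : 0 ≤ m / (2 * ℓ))
    hc.le hf (by rw [hκ]; linarith) ?_ ξ
  rw [hκ]
  -- the total variation of `V'` to the right of the minimizer is `1`, hence `m² ≤ 4 ℓ`
  have hmℓ : m ^ 2 ≤ 4 * ℓ := by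
    have h2 := hρ.le_cdf_sub (c := f z / 2) (a := z) (b := z + m / (2 * ℓ))
      (by have : 0 ≤ m / (2 * ℓ) := by positivity
          linarith) (fun x hx => hf x (by
        rw [abs_of_nonneg (by linarith [hx.1])]; linarith [hx.2]))
    rw [hz, add_sub_cancel_left] at h2
    have h3 := cdf_le_one ρ (z + m / (2 * ℓ))
    have h4 : f z = m * (1 - α) := by rw [hm]; field_simp
    rw [h4] at h2
    have h5 : m * (1 - α) / 2 * (m / (2 * ℓ)) = (1 - α) * (m ^ 2 / (4 * ℓ)) := by ring
    rw [h5] at h2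
    have h6 : m ^ 2 / (4 * ℓ) ≤ 1 := by
      by_contra! h
      nlinarith
    rwa [div_le_one (by positivity)] at h6
  calc c ≤ L * (m ^ 4 / (4 * ℓ ^ 2)) := hc₂
    _ = L * m ^ 2 / (4 * ℓ ^ 2) * m ^ 2 := by ring
    _ ≤ L * m ^ 2 / (4 * ℓ ^ 2) * (4 * ℓ) := by gcongr
    _ = 4 * L * (m / 2) * (m / (2 * ℓ)) := by field_simp; ring
    _ ≤ _ := by gcongr

end RegularDensity

namespace RegularLaws

variable {Ω : Type*} {mΩ : MeasurableSpace Ω} {P : Measure Ω} [IsProbabilityMeasure P]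
  {α : ℝ} {X : ℝ → Ω → ℝ} {f : ℝ → ℝ → ℝ} {v : ℝ → ℝ} {w : ℝ → ℝ → ℝ} {C : ℝ≥0} {z : ℝ → ℝ}

lemma one_mem_biasSet : (1 : ℝ) ∈ biasSet := ⟨1, one_pos, by norm_num⟩

/-- The exponential rate in the moment condition on the initial values. -/
def expRate (α : ℝ) (f : ℝ → ℝ → ℝ) : ℝ :=
  4 / (1 - α) * max 1 (α / (1 - α)) * ⨆ h' : biasSet, supNorm (f h')

omit [IsProbabilityMeasure P] in
lemma four_mul_supNorm_le (hα : α ∈ Set.Ioo (0 : ℝ) 1)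
    (hρ : ∀ h ∈ insert 0 biasSet, RegularDensity (P.map (X h)) (f h) C) {h : ℝ} (hh : h ∈ biasSet) :
    4 * supNorm (fun x => f h x / (1 - α)) ≤ expRate α f := by
  have h1α : 0 < 1 - α := by linarith [hα.2]
  have hρh := hρ h (mem_insert_biasSet hh)
  have h1 : supNorm (fun x => f h x / (1 - α)) ≤ supNorm (f h) / (1 - α) := by
    refine ciSup_le fun x => ?_
    rw [abs_of_pos (div_pos (hρh.pos x) h1α)]
    have := hρh.le_supNorm x
    gcongr
  have h2 : supNorm (f h) ≤ ⨆ h' : biasSet, supNorm (f h') := by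
    refine le_ciSup (f := fun h' : biasSet => supNorm (f h')) ⟨C, ?_⟩ ⟨h, hh⟩
    rintro _ ⟨h', rfl⟩
    exact (hρ h' (mem_insert_biasSet h'.2)).supNorm_le
  have h3 : 0 ≤ ⨆ h' : biasSet, supNorm (f h') :=
    Real.iSup_nonneg fun h' => Real.iSup_nonneg fun x => abs_nonneg _
  have h4 : (1 : ℝ) ≤ max 1 (α / (1 - α)) := le_max_left _ _
  calc 4 * supNorm (fun x => f h x / (1 - α))
      ≤ 4 * ((⨆ h' : biasSet, supNorm (f h')) / (1 - α)) := by
        refine mul_le_mul_of_nonneg_left (h1.trans ?_) (by norm_num)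
        gcongr
    _ = 4 / (1 - α) * 1 * ⨆ h' : biasSet, supNorm (f h') := by ring
    _ ≤ _ := by rw [expRate]; gcongr

omit [IsProbabilityMeasure P] in
lemma expRate_pos (hα : α ∈ Set.Ioo (0 : ℝ) 1)
    (hρ : ∀ h ∈ insert 0 biasSet, RegularDensity (P.map (X h)) (f h) C) : 0 < expRate α f := by
  refine lt_of_lt_of_le ?_ (four_mul_supNorm_le hα hρ one_mem_biasSet)
  have h1α : 0 < 1 - α := by linarith [hα.2]
  have hρ1 := hρ 1 (mem_insert_biasSet one_mem_biasSet)
  have h1 : f 1 0 / (1 - α) ≤ supNorm (fun x => f 1 x / (1 - α)) := by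
    refine (le_abs_self _).trans (le_ciSup (f := fun x => |f 1 x / (1 - α)|) ⟨C / (1 - α), ?_⟩ 0)
    rintro _ ⟨x, rfl⟩
    simp only [abs_of_pos (div_pos (hρ1.pos x) h1α)]
    have := hρ1.le x
    gcongr
  have h2 := div_pos (hρ1.pos 0) h1α
  linarith

/-- The two bounds that the definition of `λ` gives at each `h`, in terms of the density, as
`V_h'' = f_h / (1 - α)`. -/
lemma lam_le (hα : α ∈ Set.Ioo (0 : ℝ) 1)
    (hX : ∀ h ∈ insert 0 biasSet, AEMeasurable (X h) P)
    (hρ : ∀ h ∈ insert 0 biasSet, RegularDensity (P.map (X h)) (f h) C)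
    (hz : ∀ h ∈ insert 0 biasSet, cdf (P.map (X h)) (z h) = α) {h : ℝ} (hh : h ∈ insert 0 biasSet) :
    lam P α X ≤ 3 / 8 * (f h (z h) / (1 - α)) ∧
    lam P α X ≤ supNorm (fun x => f h x / (1 - α)) *
      ((f h (z h) / (1 - α)) ^ 4 / (4 * lipConst (fun x => f h x / (1 - α)) ^ 2)) := by
  have h1α : 0 < 1 - α := by linarith [hα.2]
  have e : ∀ h ∈ insert 0 biasSet,
      iteratedDeriv 2 (objective P α (X h)) = fun x => f h x / (1 - α) := by
    intro h hh
    have := Measure.isProbabilityMeasure_map (μ := P) (hX h hh)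
    rw [← objective_map (hX h hh)]
    funext x
    exact (hρ h hh).iteratedDeriv_two_objective hα.2 x
  rw [← le_min_iff]
  refine csInf_le ⟨0, ?_⟩ ⟨h, hh, z h, ?_, ?_⟩
  · rintro r ⟨h, hh, x, -, rfl⟩
    rw [e h hh]
    have h1 := div_pos ((hρ h hh).pos x) h1α
    refine le_min (by positivity) (mul_nonneg (Real.iSup_nonneg fun x => abs_nonneg _) ?_)
    positivity
  · have := Measure.isProbabilityMeasure_map (μ := P) (hX h hh)
    rw [← objective_map (hX h hh)]
    exact (hρ h hh).mem_Argmin (hz h hh) hα.2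
  · rw [e h hh]

/-- The drift condition holds at a rate `c` which is uniform in the bias parameter, and equal to `λ`
in the critical case `β = 1`. -/
theorem exists_drift (hreg : RegularLaws P α X f v w) (hα : α ∈ Set.Ioo (0 : ℝ) 1)
    (hX : ∀ h ∈ insert 0 biasSet, AEMeasurable (X h) P)
    (hρ : ∀ h ∈ insert 0 biasSet, RegularDensity (P.map (X h)) (f h) C)
    (hz : ∀ h ∈ insert 0 biasSet, cdf (P.map (X h)) (z h) = α) {γ₁ β : ℝ} (hγ₁ : 0 < γ₁)
    (hlam : β = 1 → 1 < lam P α X * γ₁) :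
    ∃ c > 0, (β = 1 → 1 < c * γ₁) ∧ ∀ᶠ h in 𝓝[biasSet] 0, ∀ ξ,
      c * (Real.cosh (expRate α f * (ξ - z h)) - 1) ≤
        expRate α f * (∫ y, H₁ α ξ y ∂P.map (X h)) * Real.sinh (expRate α f * (ξ - z h)) := by
  have h1α : 0 < 1 - α := by linarith [hα.2]
  have ha := expRate_pos hα hρ
  by_cases hβ : β = 1
  · have hl := hlam hβ
    have hl0 : 0 < lam P α X := by
      by_contra! h
      nlinarith
    refine ⟨lam P α X, hl0, hlam, ?_⟩
    filter_upwards [eventually_mem_biasSet] with h hh ξ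
    have hh' := mem_insert_biasSet hh
    have := Measure.isProbabilityMeasure_map (μ := P) (hX h hh')
    obtain ⟨h1, h2⟩ := lam_le hα hX hρ hz hh'
    exact (hρ h hh').drift_of_le (hz h hh') hα.2 hl0 (four_mul_supNorm_le hα hρ hh) h1 h2 ξ
  · have h0 := zero_mem_insert_biasSet
    have := Measure.isProbabilityMeasure_map (μ := P) (hX 0 h0)
    have hz0 : valueAtRisk P (X 0) α = z 0 := by
      rw [← valueAtRisk_map (hX 0 h0), ← hz 0 h0, (hρ 0 h0).valueAtRisk_cdf]
    obtain ⟨κ, hκ, hκf⟩ := hreg.pdf_lower 3 (by norm_num)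
    rw [hz0] at hκf
    have hzl := Metric.tendsto_nhds.1 (hreg.tendsto_valueAtRisk hα hX hρ hz) 1 one_pos
    refine ⟨min (2 * (κ / (1 - α))) (expRate α f * (κ / (1 - α)) * 1), by positivity,
      fun h => absurd h hβ, ?_⟩
    filter_upwards [eventually_mem_biasSet, hzl] with h hh hzh ξ
    have hh' := mem_insert_biasSet hh
    have := Measure.isProbabilityMeasure_map (μ := P) (hX h hh')
    refine (hρ h hh').drift (hz h hh') hα.2 ha.le zero_le_one (by positivity)
      (fun x hx => hκf h hh' x ?_) (min_le_left _ _) (min_le_right _ _) ξ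
    rw [Metric.mem_ball]
    have := dist_triangle x (z h) (z 0)
    rw [Real.dist_eq x (z h)] at this
    linarith

end RegularLaws

/-! ### Uniform mean square rate of the value-at-risk iterates -/

lemma cosh_le_exp_abs (t : ℝ) : Real.cosh t ≤ Real.exp |t| := by
  rw [← Real.cosh_abs, Real.cosh_eq]
  have : Real.exp (-|t|) ≤ Real.exp |t| := Real.exp_le_exp.2 (by linarith [abs_nonneg t])
  linarith

lemma cosh_mul_sub_le {a : ℝ} (ha : 0 ≤ a) (y z : ℝ) :
    Real.cosh (a * (y - z)) ≤
      Real.exp (a * |z|) * (Real.exp a + |y| ^ 2 * Real.exp (a * |y|)) := by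
  have h1 : |a * (y - z)| ≤ a * |z| + a * |y| := by
    rw [abs_mul, abs_of_nonneg ha, ← mul_add]
    have := abs_sub y z
    gcongr
    linarith
  have h2 : Real.exp (a * |y|) ≤ Real.exp a + |y| ^ 2 * Real.exp (a * |y|) := by
    rcases le_total |y| 1 with h | h
    · have : Real.exp (a * |y|) ≤ Real.exp a := Real.exp_le_exp.2 (by nlinarith)
      have := mul_nonneg (sq_nonneg |y|) (Real.exp_pos (a * |y|)).le
      linarith
    · have : 1 * Real.exp (a * |y|) ≤ |y| ^ 2 * Real.exp (a * |y|) := by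
        gcongr; nlinarith
      have := Real.exp_pos a
      linarith
  calc Real.cosh (a * (y - z)) ≤ Real.exp (a * |z| + a * |y|) :=
        (cosh_le_exp_abs _).trans (Real.exp_le_exp.2 h1)
    _ = Real.exp (a * |z|) * Real.exp (a * |y|) := Real.exp_add _ _
    _ ≤ _ := by gcongr

namespace RegularLaws

variable {Ω : Type*} {mΩ : MeasurableSpace Ω} {P : Measure Ω} [IsProbabilityMeasure P]
  {α : ℝ} {X : ℝ → Ω → ℝ} {f : ℝ → ℝ → ℝ} {v : ℝ → ℝ} {w : ℝ → ℝ → ℝ} {C : ℝ≥0} {z : ℝ → ℝ}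
  {ξ₀ : ℝ → Ω → ℝ}

omit [IsProbabilityMeasure P] in
lemma exists_integral_initial_le (hinit : InitialMoment P α f ξ₀)
    (hξ₀ : ∀ h ∈ biasSet, Measurable (ξ₀ h)) :
    ∃ D, 0 ≤ D ∧ ∀ h ∈ biasSet,
      Integrable (fun ω => |ξ₀ h ω| ^ 2 * Real.exp (expRate α f * |ξ₀ h ω|)) P ∧
      ∫ ω, |ξ₀ h ω| ^ 2 * Real.exp (expRate α f * |ξ₀ h ω|) ∂P ≤ D := by
  obtain ⟨D, hD⟩ := hinit
  refine ⟨D, D.coe_nonneg, fun h hh => ?_⟩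
  have h1 := hD h hh
  have hm : Measurable (fun ω => |ξ₀ h ω| ^ 2 * Real.exp (expRate α f * |ξ₀ h ω|)) := by
    have := hξ₀ h hh
    have h2 : Measurable fun ω => |ξ₀ h ω| := this.abs
    fun_prop
  have h0 : ∀ ω, 0 ≤ |ξ₀ h ω| ^ 2 * Real.exp (expRate α f * |ξ₀ h ω|) := fun ω => by positivity
  constructor
  · refine ⟨hm.aestronglyMeasurable, ?_⟩
    rw [hasFiniteIntegral_iff_ofReal (ae_of_all _ h0)]
    exact h1.trans_lt ENNReal.coe_lt_top
  · rw [integral_eq_lintegral_of_nonneg_ae (ae_of_all _ h0) hm.aestronglyMeasurable]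
    exact ENNReal.toReal_le_of_le_ofReal D.coe_nonneg (by rwa [ENNReal.ofReal_coe_nnreal])

/-- The mean square error of the `n`-th value-at-risk iterate is `O(n^{-β})`, uniformly in the bias
parameter. -/
theorem exists_integral_varProc_sub_sq_le (hreg : RegularLaws P α X f v w)
    (hα : α ∈ Set.Ioo (0 : ℝ) 1)
    (hX : ∀ h ∈ insert 0 biasSet, AEMeasurable (X h) P)
    (hρ : ∀ h ∈ insert 0 biasSet, RegularDensity (P.map (X h)) (f h) C)
    (hz : ∀ h ∈ insert 0 biasSet, cdf (P.map (X h)) (z h) = α) {γ₁ β : ℝ} (hγ₁ : 0 < γ₁)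
    (hβ : β ∈ Set.Ioc (0 : ℝ) 1) (hlam : β = 1 → 1 < lam P α X * γ₁)
    (hinit : InitialMoment P α f ξ₀) (hξ₀ : ∀ h ∈ biasSet, Measurable (ξ₀ h)) :
    ∃ M, 0 ≤ M ∧ ∀ᶠ h in 𝓝[biasSet] 0, ∀ (ℱ : Filtration ℕ mΩ) (x : ℕ → Ω → ℝ),
      Innovations P (P.map (X h)) ℱ x → Measurable[ℱ 0] (ξ₀ h) → ∀ n,
        MemLp (fun ω => varProc α γ₁ β (ξ₀ h) x n ω - z h) 2 P ∧
        ∫ ω, (varProc α γ₁ β (ξ₀ h) x n ω - z h) ^ 2 ∂P ≤ M * ((n : ℝ) + 1) ^ (-β) := by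
  obtain ⟨c, hc, hcβ, hdrift⟩ := hreg.exists_drift hα hX hρ hz hγ₁ hlam
  have ha := expRate_pos hα hρ
  obtain ⟨D₀, hD₀, hinit⟩ := exists_integral_initial_le hinit hξ₀
  set a := expRate α f with ha_def
  have h1α : 0 < 1 - α := by linarith [hα.2]
  set L := (a / (1 - α)) ^ 2 * Real.exp (a * γ₁ / (1 - α)) with hL
  have hL0 : 0 ≤ L := by positivity
  obtain ⟨K, hK⟩ := exists_rateBound (s := 1) hγ₁ hβ one_pos hc hL0 hcβ
  set D := Real.exp (a * (|z 0| + 1)) * (Real.exp a + D₀) + L * γ₁ ^ 2 with hD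
  have hD0 : 0 ≤ D := by positivity
  have hzl := Metric.tendsto_nhds.1 (hreg.tendsto_valueAtRisk hα hX hρ hz) 1 one_pos
  refine ⟨2 / a ^ 2 * (K * D), mul_nonneg (by positivity) (mul_nonneg hK.1 hD0), ?_⟩
  filter_upwards [eventually_mem_biasSet, hdrift, hzl] with h hh hdr hzh ℱ x hI hξℱ n
  obtain ⟨hi, hib⟩ := hinit h hh
  have hzb : |z h| ≤ |z 0| + 1 := by
    have := abs_sub_abs_le_abs_sub (z h) (z 0)
    rw [Real.dist_eq] at hzh
    linarith
  have hbi : Integrable (fun ω => Real.exp (a * |z h|) *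
      (Real.exp a + |ξ₀ h ω| ^ 2 * Real.exp (a * |ξ₀ h ω|))) P :=
    ((integrable_const _).add hi).const_mul _
  have hcm : Measurable (fun ω => Real.cosh (a * (ξ₀ h ω - z h))) :=
    Real.continuous_cosh.measurable.comp (((hξ₀ h hh).sub_const _).const_mul _)
  have h0 : Integrable (fun ω => Real.cosh (a * (ξ₀ h ω - z h))) P :=
    hbi.mono' hcm.aestronglyMeasurable (ae_of_all _ fun ω => by
      rw [Real.norm_of_nonneg (Real.cosh_pos _).le]
      exact cosh_mul_sub_le ha.le _ _)
  have h0D : ∫ ω, (Real.cosh (a * (ξ₀ h ω - z h)) - 1) ∂P ≤ D := by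
    have h1 : ∫ ω, (Real.cosh (a * (ξ₀ h ω - z h)) - 1) ∂P ≤ ∫ ω, Real.exp (a * |z h|) *
        (Real.exp a + |ξ₀ h ω| ^ 2 * Real.exp (a * |ξ₀ h ω|)) ∂P :=
      integral_mono (h0.sub (integrable_const 1)) hbi fun ω => by
        have := cosh_mul_sub_le ha.le (ξ₀ h ω) (z h)
        simp only
        linarith
    rw [integral_const_mul, integral_add (integrable_const _) hi] at h1
    simp only [integral_const, probReal_univ, one_smul] at h1
    refine h1.trans ?_
    have h2 : Real.exp (a * |z h|) ≤ Real.exp (a * (|z 0| + 1)) := by gcongr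
    have h3 : Real.exp (a * |z h|) * (Real.exp a + ∫ ω, |ξ₀ h ω| ^ 2 * Real.exp (a * |ξ₀ h ω|) ∂P)
        ≤ Real.exp (a * (|z 0| + 1)) * (Real.exp a + D₀) := by
      have : 0 ≤ ∫ ω, |ξ₀ h ω| ^ 2 * Real.exp (a * |ξ₀ h ω|) ∂P :=
        integral_nonneg fun ω => by positivity
      gcongr
    have : 0 ≤ L * γ₁ ^ 2 := by positivity
    linarith
  have hCD : L * γ₁ ^ 2 ≤ D := by
    have : 0 ≤ Real.exp (a * (|z 0| + 1)) * (Real.exp a + D₀) := by positivity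
    linarith
  obtain ⟨hci, hcb⟩ := lyapunov_bound hα hγ₁ hβ hI hξℱ ha le_rfl hK hdr h0 h0D hCD n
  have hm : Measurable (varProc α γ₁ β (ξ₀ h) x n) :=
    (measurable_varProc hI hξℱ n).mono (ℱ.le n) le_rfl
  have hpt : ∀ ω, (varProc α γ₁ β (ξ₀ h) x n ω - z h) ^ 2 ≤
      2 / a ^ 2 * (Real.cosh (a * (varProc α γ₁ β (ξ₀ h) x n ω - z h)) - 1) := by
    intro ω
    have h1 := sq_div_two_le_cosh_sub_one (a * (varProc α γ₁ β (ξ₀ h) x n ω - z h))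
    rw [mul_pow] at h1
    rw [div_mul_eq_mul_div, le_div_iff₀ (by positivity)]
    linarith
  have hi1 : Integrable (fun ω =>
      2 / a ^ 2 * (Real.cosh (a * (varProc α γ₁ β (ξ₀ h) x n ω - z h)) - 1)) P :=
    (hci.sub (integrable_const 1)).const_mul _
  have hi2 : Integrable (fun ω => (varProc α γ₁ β (ξ₀ h) x n ω - z h) ^ 2) P :=
    hi1.mono' ((hm.sub_const _).pow_const 2).aestronglyMeasurable (ae_of_all _ fun ω => by
      rw [Real.norm_of_nonneg (sq_nonneg _)]; exact hpt ω)
  refine ⟨(memLp_two_iff_integrable_sq (hm.sub_const _).aestronglyMeasurable).2 hi2, ?_⟩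
  refine (integral_mono hi2 hi1 hpt).trans ?_
  rw [integral_const_mul, mul_assoc]
  rw [mul_one] at hcb
  gcongr

end RegularLaws

/-! ### The noise of the linearized scheme -/

/-- The increment of the value-at-risk recursion frozen at `z`. -/
def varNoise (α z y : ℝ) : ℝ := -H₁ α z y

/-- The increment of the expected shortfall average frozen at `z`, centred under the law `ρ`. -/
def esNoise (ρ : Measure ℝ) (α z y : ℝ) : ℝ :=
  z + 1 / (1 - α) * max (y - z) 0 - objective ρ α id z

lemma measurable_varNoise (α z : ℝ) : Measurable (varNoise α z) :=
  ((measurable_H₁ α).comp (measurable_const.prodMk measurable_id)).neg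

lemma measurable_esNoise (ρ : Measure ℝ) (α z : ℝ) : Measurable (esNoise ρ α z) := by
  unfold esNoise; fun_prop

lemma memLp_varNoise {ρ : Measure ℝ} [IsFiniteMeasure ρ] {α : ℝ} (hα : α ∈ Set.Ioo (0 : ℝ) 1)
    (z : ℝ) : MemLp (varNoise α z) 2 ρ :=
  MemLp.of_bound (measurable_varNoise α z).aestronglyMeasurable (1 / (1 - α)) (ae_of_all _ fun y => by
    rw [varNoise, norm_neg]; exact abs_H₁_le hα z y)

lemma memLp_max_sub {ρ : Measure ℝ} [IsFiniteMeasure ρ] (h2 : MemLp (fun y : ℝ => y) 2 ρ) (z : ℝ) :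
    MemLp (fun y => max (y - z) 0) 2 ρ :=
  (h2.sub (memLp_const z)).pos_part

lemma memLp_esNoise {ρ : Measure ℝ} [IsFiniteMeasure ρ] (h2 : MemLp (fun y : ℝ => y) 2 ρ)
    (α z : ℝ) :
    MemLp (esNoise ρ α z) 2 ρ :=
  ((memLp_const z).add ((memLp_max_sub h2 z).const_mul _)).sub (memLp_const _)

lemma esNoise_eq (ρ : Measure ℝ) (α z y : ℝ) :
    esNoise ρ α z y = 1 / (1 - α) * (max (y - z) 0 - ∫ y, max (y - z) 0 ∂ρ) := by
  rw [esNoise, objective]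
  simp only [id]
  ring

/-- `H₁ ^ 2` is an affine function of `H₁`, as `H₁` takes two values. -/
lemma H₁_sq {α : ℝ} (z y : ℝ) :
    H₁ α z y ^ 2 = (1 / (1 - α) - 1) - (1 / (1 - α) - 2) * H₁ α z y := by
  unfold H₁
  split_ifs <;> ring

lemma H₁_mul_max {α : ℝ} (z y : ℝ) :
    H₁ α z y * max (y - z) 0 = (1 - 1 / (1 - α)) * max (y - z) 0 := by
  unfold H₁
  split_ifs with h
  · ring
  · rw [max_eq_right (by linarith)]; ring

namespace RegularDensity

variable {ρ : Measure ℝ} {f : ℝ → ℝ} {C : ℝ≥0} {α z : ℝ} [IsProbabilityMeasure ρ]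

lemma integral_varNoise (hρ : RegularDensity ρ f C) (hz : cdf ρ z = α) (hα : α < 1) :
    ∫ y, varNoise α z y ∂ρ = 0 := by
  simp only [varNoise]
  rw [integral_neg, hρ.integral_H₁ z hα, hz]; simp

lemma integral_esNoise (hρ : RegularDensity ρ f C) (α z : ℝ) : ∫ y, esNoise ρ α z y ∂ρ = 0 := by
  simp only [esNoise_eq]
  rw [integral_const_mul, integral_sub (hρ.integrable_max_sub z) (integrable_const _)]
  simp

lemma integral_varNoise_sq (hρ : RegularDensity ρ f C) (hz : cdf ρ z = α)
    (hα : α ∈ Set.Ioo (0 : ℝ) 1) : ∫ y, varNoise α z y ^ 2 ∂ρ = α / (1 - α) := by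
  have h1α : 1 - α ≠ 0 := by linarith [hα.2]
  have hH : Integrable (fun y => H₁ α z y) ρ := by
    have := ((memLp_varNoise (ρ := ρ) hα z).integrable one_le_two).neg
    exact this.congr (ae_of_all _ fun y => neg_neg (H₁ α z y))
  simp only [varNoise, neg_sq, H₁_sq]
  rw [integral_sub (integrable_const _) (hH.const_mul _), integral_const_mul,
    hρ.integral_H₁ z hα.2, hz]
  simp only [integral_const, probReal_univ, one_smul, sub_self, zero_div, mul_zero, sub_zero]
  field_simp; ring

lemma integral_varNoise_mul_esNoise (hρ : RegularDensity ρ f C) (hz : cdf ρ z = α)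
    (hα : α ∈ Set.Ioo (0 : ℝ) 1) : ∫ y, varNoise α z y * esNoise ρ α z y ∂ρ =
      α / (1 - α) * (objective ρ α id z - z) := by
  have h1α : 1 - α ≠ 0 := by linarith [hα.2]
  have hH : Integrable (varNoise α z) ρ := (memLp_varNoise (ρ := ρ) hα z).integrable one_le_two
  have e : ∀ y, varNoise α z y * esNoise ρ α z y = (z - objective ρ α id z) * varNoise α z y
      + (1 / (1 - α) - 1) * (1 / (1 - α)) * max (y - z) 0 := by
    intro y
    have h1 := H₁_mul_max (α := α) z y
    simp only [esNoise, varNoise]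
    linear_combination -(1 / (1 - α)) * h1
  simp only [e]
  rw [integral_add (hH.const_mul _) ((hρ.integrable_max_sub z).const_mul _), integral_const_mul,
    integral_const_mul, hρ.integral_varNoise hz hα.2]
  simp only [objective, id]
  field_simp; ring

lemma integral_esNoise_sq (hρ : RegularDensity ρ f C) (α z : ℝ) :
    ∫ y, esNoise ρ α z y ^ 2 ∂ρ = variance (fun y => max (y - z) 0) ρ / (1 - α) ^ 2 := by
  simp only [esNoise_eq, mul_pow]
  rw [integral_const_mul, variance_eq_integral (hρ.integrable_max_sub z).aemeasurable, one_div, inv_pow,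
    inv_mul_eq_div]

omit [IsProbabilityMeasure ρ] in
lemma real_Icc_le (hρ : RegularDensity ρ f C) (z : ℝ) {r : ℝ} (hr : 0 ≤ r) :
    ρ.real (Set.Icc (z - r) (z + r)) ≤ C * (2 * r) := by
  rw [hρ.real_eq_setIntegral measurableSet_Icc]
  refine (le_abs_self _).trans ?_
  refine (norm_setIntegral_le_of_norm_le_const (μ := volume) (f := f) (C := C)
    measure_Icc_lt_top (fun x _ => ?_)).trans_eq ?_
  · rw [Real.norm_of_nonneg (hρ.pos x).le]; exact hρ.le x
  · rw [Real.volume_real_Icc_of_le (by linarith)]; ring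

end RegularDensity

/-- Two indicators of `{z ≤ X}` differ only if `X` is close to `z` or the two centred variables are
far apart. -/
lemma varNoise_sub_sq_le {α : ℝ} (z z' y y' : ℝ) {r : ℝ} (hr : 0 < r) :
    (varNoise α z' y' - varNoise α z y) ^ 2 ≤ (1 / (1 - α)) ^ 2 *
      ((Set.Icc (z - r) (z + r)).indicator (fun _ => 1) y
        + 1 / r ^ 2 * ((y' - y) - (z' - z)) ^ 2) := by
  have e : (varNoise α z' y' - varNoise α z y) ^ 2 = (1 / (1 - α)) ^ 2 *
      ((if z' ≤ y' then (1 : ℝ) else 0) - (if z ≤ y then 1 else 0)) ^ 2 := by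
    simp only [varNoise, H₁]; ring
  rw [e]
  refine mul_le_mul_of_nonneg_left ?_ (sq_nonneg _)
  have h0 : 0 ≤ 1 / r ^ 2 * ((y' - y) - (z' - z)) ^ 2 := by positivity
  have hfar : ∀ t : ℝ, r < t → t ≤ |(y' - y) - (z' - z)| →
      1 ≤ 1 / r ^ 2 * ((y' - y) - (z' - z)) ^ 2 := by
    intro t h1 h2
    rw [one_div_mul_eq_div, one_le_div (by positivity), ← sq_abs ((y' - y) - (z' - z))]
    exact pow_le_pow_left₀ hr.le (h1.le.trans h2) 2
  by_cases hy : y ∈ Set.Icc (z - r) (z + r)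
  · rw [Set.indicator_of_mem hy]
    split_ifs <;> norm_num <;> positivity
  · rw [Set.indicator_of_notMem hy, zero_add]
    rw [Set.mem_Icc, not_and_or, not_le, not_le] at hy
    split_ifs with h1 h2 h2
    · simpa using h0
    · have := hfar (z - y) (by rcases hy with hy | hy <;> linarith)
        (le_trans (by linarith) (le_abs_self _))
      simpa using this
    · have := hfar (y - z) (by rcases hy with hy | hy <;> linarith)
        (le_trans (by linarith) (neg_le_abs _))
      simpa using this
    · simpa using h0

namespace RegularLaws

variable {Ω : Type*} {mΩ : MeasurableSpace Ω} {P : Measure Ω} [IsProbabilityMeasure P]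
  {α : ℝ} {X : ℝ → Ω → ℝ} {f : ℝ → ℝ → ℝ} {C : ℝ≥0} {z : ℝ → ℝ}

omit [IsProbabilityMeasure P] in
lemma memLp_map (hX2 : ∀ h ∈ insert 0 biasSet, MemLp (X h) 2 P) {h : ℝ} (hh : h ∈ insert 0 biasSet) :
    MemLp (fun y : ℝ => y) 2 (P.map (X h)) :=
  (memLp_map_measure_iff aestronglyMeasurable_id (hX2 h hh).aemeasurable).2 (hX2 h hh)

lemma tendsto_integral_centred_sub_sq (hX2 : ∀ h ∈ insert 0 biasSet, MemLp (X h) 2 P)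
    (hXl : Tendsto (fun h => ∫ ω, (X h ω - X 0 ω) ^ 2 ∂P) (𝓝[biasSet] 0) (𝓝 0))
    (hzl : Tendsto z (𝓝[biasSet] 0) (𝓝 (z 0))) :
    Tendsto (fun h => ∫ ω, ((X h ω - X 0 ω) - (z h - z 0)) ^ 2 ∂P) (𝓝[biasSet] 0) (𝓝 0) := by
  have h1 : Tendsto (fun h => 2 * (∫ ω, (X h ω - X 0 ω) ^ 2 ∂P) + 2 * (z h - z 0) ^ 2)
      (𝓝[biasSet] 0) (𝓝 0) := by
    have := (hzl.sub_const (z 0)).pow 2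
    rw [sub_self] at this
    simpa using (hXl.const_mul 2).add (this.const_mul 2)
  refine squeeze_zero' (Eventually.of_forall fun h => integral_nonneg fun ω => sq_nonneg _) ?_ h1
  filter_upwards [eventually_mem_biasSet] with h hh
  have hL := (hX2 h (mem_insert_biasSet hh)).sub (hX2 0 zero_mem_insert_biasSet)
  have hi := hL.integrable_sq
  have e : 2 * (∫ ω, (X h ω - X 0 ω) ^ 2 ∂P) + 2 * (z h - z 0) ^ 2
      = ∫ ω, (2 * (X h ω - X 0 ω) ^ 2 + 2 * (z h - z 0) ^ 2) ∂P := by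
    have hi' : Integrable (fun ω => (X h ω - X 0 ω) ^ 2) P := hi
    rw [integral_add (hi'.const_mul 2) (integrable_const _), integral_const_mul]
    simp
  rw [e]
  refine integral_mono (hL.sub (memLp_const _)).integrable_sq
    ((hi.const_mul 2).add (integrable_const _)) fun ω => ?_
  simp only
  nlinarith [sq_nonneg ((X h ω - X 0 ω) + (z h - z 0))]

/-- Mean square continuity of the indicator noise. The density of `X 0` is bounded, so little mass
lies near the discontinuity; elsewhere the two indicators differ only if `X h - z h` is far from
`X 0 - z 0`. -/
theorem tendsto_integral_varNoise_sub_sq (hα : α ∈ Set.Ioo (0 : ℝ) 1)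
    (hX2 : ∀ h ∈ insert 0 biasSet, MemLp (X h) 2 P)
    (hρ : RegularDensity (P.map (X 0)) (f 0) C)
    (hXl : Tendsto (fun h => ∫ ω, (X h ω - X 0 ω) ^ 2 ∂P) (𝓝[biasSet] 0) (𝓝 0))
    (hzl : Tendsto z (𝓝[biasSet] 0) (𝓝 (z 0))) :
    Tendsto (fun h => ∫ ω, (varNoise α (z h) (X h ω) - varNoise α (z 0) (X 0 ω)) ^ 2 ∂P)
      (𝓝[biasSet] 0) (𝓝 0) := by
  have h0 := zero_mem_insert_biasSet
  have h1α : 0 < 1 - α := by linarith [hα.2]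
  have hd := tendsto_integral_centred_sub_sq hX2 hXl hzl
  have hp := Measure.isProbabilityMeasure_map (μ := P) (hX2 0 h0).aemeasurable
  have key : ∀ r > 0, ∀ᶠ h in 𝓝[biasSet] 0,
      ∫ ω, (varNoise α (z h) (X h ω) - varNoise α (z 0) (X 0 ω)) ^ 2 ∂P ≤
        (1 / (1 - α)) ^ 2 * (C * (2 * r)
          + 1 / r ^ 2 * ∫ ω, ((X h ω - X 0 ω) - (z h - z 0)) ^ 2 ∂P) := by
    intro r hr
    filter_upwards [eventually_mem_biasSet] with h hh
    have hX0 := (hX2 0 h0).aemeasurable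
    have hXh := (hX2 h (mem_insert_biasSet hh)).aemeasurable
    have hL := ((hX2 h (mem_insert_biasSet hh)).sub (hX2 0 h0)).sub
      (memLp_const (μ := P) (p := 2) (z h - z 0))
    have i2 : Integrable (fun ω => ((X h ω - X 0 ω) - (z h - z 0)) ^ 2) P := hL.integrable_sq
    have hms : NullMeasurableSet (X 0 ⁻¹' Set.Icc (z 0 - r) (z 0 + r)) P :=
      hX0.nullMeasurableSet_preimage measurableSet_Icc
    have i1 : Integrable (fun ω => (Set.Icc (z 0 - r) (z 0 + r)).indicator
        (fun _ => (1 : ℝ)) (X 0 ω)) P :=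
      ((integrable_const (1 : ℝ)).indicator measurableSet_Icc).comp_aemeasurable hX0
    have e1 : ∫ ω, (Set.Icc (z 0 - r) (z 0 + r)).indicator (fun _ => (1 : ℝ)) (X 0 ω) ∂P
        = (P.map (X 0)).real (Set.Icc (z 0 - r) (z 0 + r)) := by
      rw [← integral_map hX0 (f := (Set.Icc (z 0 - r) (z 0 + r)).indicator (fun _ => (1 : ℝ)))
        (measurable_const.indicator measurableSet_Icc).aestronglyMeasurable,
        integral_indicator measurableSet_Icc]
      simp
    have hA : ∀ h : ℝ, AEMeasurable (X h) P → MemLp (fun ω => varNoise α (z h) (X h ω)) 2 P := by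
      intro h hXh
      refine MemLp.of_bound ((measurable_varNoise α _).comp_aemeasurable hXh).aestronglyMeasurable
        (1 / (1 - α)) (ae_of_all _ fun ω => ?_)
      rw [varNoise, norm_neg]; exact abs_H₁_le hα _ _
    refine (integral_mono ((hA h hXh).sub (hA 0 hX0)).integrable_sq
      ((i1.add (i2.const_mul (1 / r ^ 2))).const_mul ((1 / (1 - α)) ^ 2))
      fun ω => varNoise_sub_sq_le (z 0) (z h) (X 0 ω) (X h ω) hr).trans ?_
    simp only [Pi.add_apply]
    rw [integral_const_mul, integral_add i1 (i2.const_mul _), integral_const_mul, e1]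
    have := hρ.real_Icc_le (z 0) hr.le
    gcongr
  rw [Metric.tendsto_nhds]
  intro ε hε
  set κ := (1 / (1 - α)) ^ 2 with hκ
  have hκ0 : 0 < κ := by positivity
  set r := ε / (4 * κ * (C + 1)) with hr
  have hr0 : 0 < r := by positivity
  have hrb : κ * (C * (2 * r)) ≤ ε / 2 := by
    have h1 : κ * ((C + 1) * (2 * r)) = ε / 2 := by rw [hr]; field_simp; norm_num
    rw [← h1]
    gcongr
    linarith
  have h2 : Tendsto (fun h => κ * (1 / r ^ 2 * ∫ ω, ((X h ω - X 0 ω) - (z h - z 0)) ^ 2 ∂P))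
      (𝓝[biasSet] 0) (𝓝 0) := by
    have := (hd.const_mul (1 / r ^ 2)).const_mul κ
    rwa [mul_zero, mul_zero] at this
  filter_upwards [key r hr0, h2.eventually_lt_const (half_pos hε)] with h h3 h4
  rw [Real.dist_0_eq_abs, abs_of_nonneg (integral_nonneg fun ω => sq_nonneg _)]
  rw [mul_add] at h3
  linarith

theorem tendsto_integral_esNoise_sub_sq
    (hX2 : ∀ h ∈ insert 0 biasSet, MemLp (X h) 2 P)
    (hXl : Tendsto (fun h => ∫ ω, (X h ω - X 0 ω) ^ 2 ∂P) (𝓝[biasSet] 0) (𝓝 0))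
    (hzl : Tendsto z (𝓝[biasSet] 0) (𝓝 (z 0))) :
    Tendsto (fun h => ∫ ω, (esNoise (P.map (X h)) α (z h) (X h ω)
      - esNoise (P.map (X 0)) α (z 0) (X 0 ω)) ^ 2 ∂P) (𝓝[biasSet] 0) (𝓝 0) := by
  have h0 := zero_mem_insert_biasSet
  have hd := (tendsto_integral_centred_sub_sq hX2 hXl hzl).const_mul ((1 / (1 - α)) ^ 2)
  rw [mul_zero] at hd
  refine squeeze_zero' (Eventually.of_forall fun h => integral_nonneg fun ω => sq_nonneg _) ?_ hd
  filter_upwards [eventually_mem_biasSet] with h hh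
  have hh' := mem_insert_biasSet hh
  have hM : ∀ h ∈ insert 0 biasSet, MemLp (fun ω => max (X h ω - z h) 0) 2 P := fun h hh =>
    ((hX2 h hh).sub (memLp_const (z h))).pos_part
  have hMi := fun h hh => (hM h hh).integrable one_le_two
  have e : ∀ ω, esNoise (P.map (X h)) α (z h) (X h ω) - esNoise (P.map (X 0)) α (z 0) (X 0 ω)
      = 1 / (1 - α) * ((max (X h ω - z h) 0 - max (X 0 ω - z 0) 0)
        - ∫ ω', (max (X h ω' - z h) 0 - max (X 0 ω' - z 0) 0) ∂P) := by
    intro ω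
    rw [esNoise_eq, esNoise_eq, integral_map_max_sub (hX2 h hh').aemeasurable,
      integral_map_max_sub (hX2 0 h0).aemeasurable, integral_sub (hMi h hh') (hMi 0 h0)]
    ring
  simp only [e, mul_pow]
  rw [integral_const_mul]
  refine mul_le_mul_of_nonneg_left ?_ (sq_nonneg _)
  refine (integral_sub_integral_sq_le ((hM h hh').sub (hM 0 h0))).trans ?_
  refine integral_mono ((hM h hh').sub (hM 0 h0)).integrable_sq
    (((hX2 h hh').sub (hX2 0 h0)).sub (memLp_const _)).integrable_sq fun ω => ?_
  simp only [Pi.sub_apply]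
  rw [sq_le_sq]
  refine (abs_max_sub_max_le_abs _ _ _).trans_eq ?_
  congr 1; ring

end RegularLaws

/-! ### The linearized scheme at the optimal number of iterations -/

/-- The number of iterations at bias parameter `h`. -/
def iters (h : ℝ) : ℕ := ⌈(h ^ 2)⁻¹⌉₊

lemma iters_eq {h : ℝ} (hh : h ∈ biasSet) : (iters h : ℝ) = (h ^ 2)⁻¹ := by
  obtain ⟨K, hK, rfl⟩ := hh
  have : ((1 / (K : ℝ)) ^ 2)⁻¹ = ((K ^ 2 : ℕ) : ℝ) := by push_cast; field_simp
  rw [iters, this, Nat.ceil_natCast]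

lemma iters_pos {h : ℝ} (hh : h ∈ biasSet) : (0 : ℝ) < iters h := by
  rw [iters_eq hh]; have := pos_of_mem_biasSet hh; positivity

lemma tendsto_iters : Tendsto iters (𝓝[biasSet] 0) atTop := by
  rw [← tendsto_natCast_atTop_iff (R := ℝ)]
  have h1 : Tendsto (fun h : ℝ => (h ^ 2)⁻¹) (𝓝[biasSet] 0) atTop := by
    refine tendsto_inv_nhdsGT_zero.comp (tendsto_nhdsWithin_iff.2 ⟨?_, ?_⟩)
    · simpa using tendsto_id_biasSet.pow 2
    · filter_upwards [eventually_mem_biasSet] with h hh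
      have := pos_of_mem_biasSet hh
      exact Set.mem_Ioi.2 (by positivity)
  refine h1.congr' ?_
  filter_upwards [eventually_mem_biasSet] with h hh
  rw [iters_eq hh]

instance : (𝓝[biasSet] (0 : ℝ)).NeBot := by
  rw [← mem_closure_iff_nhdsWithin_neBot]
  refine mem_closure_of_tendsto (tendsto_one_div_add_atTop_nhds_zero_nat (𝕜 := ℝ))
    (Eventually.of_forall fun n => ⟨n + 1, n.succ_pos, by push_cast; rfl⟩)

/-- Powers of the bias parameter are powers of the number of iterations. -/
lemma rpow_neg_eq {h : ℝ} (hh : h ∈ biasSet) (p : ℝ) : h ^ (-(2 * p)) = (iters h : ℝ) ^ p := by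
  have h0 := pos_of_mem_biasSet hh
  rw [iters_eq hh, Real.inv_rpow (by positivity), ← Real.rpow_natCast, ← Real.rpow_mul h0.le,
    ← Real.rpow_neg h0.le]
  congr 1

lemma tendsto_iters_div_succ_rpow (p : ℝ) :
    Tendsto (fun h => (iters h : ℝ) ^ p * ((iters h : ℝ) + 1) ^ (-p)) (𝓝[biasSet] 0) (𝓝 1) := by
  have h1 : Tendsto (fun n : ℕ => ((n : ℝ) / ((n : ℝ) + 1)) ^ p) atTop (𝓝 1) := by
    have := (tendsto_natCast_div_add_atTop (1 : ℝ)).rpow_const (p := p) (Or.inl one_ne_zero)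
    rwa [Real.one_rpow] at this
  refine (h1.comp tendsto_iters).congr fun h => ?_
  simp only [Function.comp]
  rw [Real.div_rpow (by positivity) (by positivity), Real.rpow_neg (by positivity), div_eq_mul_inv]

section Weights

variable {γ₁ β m : ℝ}

/-- The weight of the `k`-th innovation in the renormalized value-at-risk error. -/
def varWeight (m γ₁ β h : ℝ) (k : ℕ) : ℝ := h ^ (-β) * coeff m (step γ₁ β) (iters h) k

lemma tendsto_sum_varWeight_sq (hγ₁ : 0 < γ₁) (hβ : β ∈ Set.Ioc (0 : ℝ) 1)
    (hm : 0 < 2 * m - γ₁⁻¹ * indOne β) :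
    Tendsto (fun h => ∑ k ∈ Finset.range (iters h), varWeight m γ₁ β h k ^ 2) (𝓝[biasSet] 0)
      (𝓝 (γ₁ * (2 * m - γ₁⁻¹ * indOne β)⁻¹)) := by
  have h1 := ((tendsto_iters_div_succ_rpow β).const_mul γ₁).mul
    ((tendsto_sum_coeff_sq_div hγ₁ hβ hm).comp tendsto_iters)
  rw [mul_one] at h1
  refine h1.congr' ?_
  filter_upwards [eventually_mem_biasSet] with h hh
  have hs := (step_pos (β := β) hγ₁ (iters h)).ne'
  have h0 := pos_of_mem_biasSet hh
  have e : (h ^ (-β)) ^ 2 = (iters h : ℝ) ^ β := by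
    rw [← rpow_neg_eq hh, ← Real.rpow_natCast, ← Real.rpow_mul h0.le]
    congr 1; push_cast; ring
  simp only [Function.comp, varWeight, mul_pow, ← Finset.mul_sum]
  rw [e]
  have e2 : γ₁ * ((iters h : ℝ) ^ β * ((iters h : ℝ) + 1) ^ (-β))
      = (iters h : ℝ) ^ β * step γ₁ β (iters h) := by rw [step]; ring
  rw [e2]
  field_simp

lemma tendsto_rpow_one_sub (hβ : β ∈ Set.Ioc (0 : ℝ) 1) :
    Tendsto (fun h : ℝ => h ^ (1 - β)) (𝓝[biasSet] 0) (𝓝 (indOne β)) := by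
  by_cases hβ1 : β = 1
  · simp [hβ1, indOne]
  · have h2 : 0 < 1 - β := sub_pos.2 (lt_of_le_of_ne hβ.2 hβ1)
    have := tendsto_id_biasSet.rpow_const (p := 1 - β) (Or.inr h2.le)
    rw [show indOne β = 0 from if_neg hβ1]
    rwa [Real.zero_rpow h2.ne'] at this

lemma tendsto_sum_varWeight_mul (hγ₁ : 0 < γ₁) (hβ : β ∈ Set.Ioc (0 : ℝ) 1) (hm : 0 < m) :
    Tendsto (fun h => ∑ k ∈ Finset.range (iters h), varWeight m γ₁ β h k * h) (𝓝[biasSet] 0)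
      (𝓝 (indOne β * m⁻¹)) := by
  have h1 := tendsto_rpow_one_sub hβ
  have h2 := h1.mul ((tendsto_sum_coeff hγ₁ hβ hm).comp tendsto_iters)
  refine h2.congr' ?_
  filter_upwards [eventually_mem_biasSet] with h hh
  have h0 := pos_of_mem_biasSet hh
  simp only [Function.comp, varWeight, ← Finset.sum_mul, ← Finset.mul_sum]
  rw [sub_eq_add_neg, Real.rpow_add h0, Real.rpow_one]
  ring

/-- The weights of the linearized scheme tend to zero uniformly, by the bound on their fourth
powers. -/
lemma eventually_abs_varWeight_le (hγ₁ : 0 < γ₁) (hβ : β ∈ Set.Ioc (0 : ℝ) 1) (hm : 0 < m)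
    (hcrit : β = 1 → 3 < 4 * m * γ₁) {δ : ℝ} (hδ : 0 < δ) :
    ∀ᶠ h in 𝓝[biasSet] 0, ∀ k ∈ Finset.range (iters h), |varWeight m γ₁ β h k| ≤ δ := by
  obtain ⟨K, hK⟩ := exists_sum_coeff_pow_four_le hγ₁ hβ hm hcrit
  have h1 : Tendsto (fun h => K * (((iters h : ℝ) ^ (2 * β) * ((iters h : ℝ) + 1) ^ (-(2 * β)))
      * ((iters h : ℝ) + 1) ^ (-β))) (𝓝[biasSet] 0) (𝓝 0) := by
    have := ((tendsto_iters_div_succ_rpow (2 * β)).mul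
      ((tendsto_succ_rpow_neg hβ.1).comp tendsto_iters)).const_mul K
    simpa using this
  filter_upwards [eventually_mem_biasSet, h1.eventually_lt_const (show 0 < δ ^ 4 by positivity)]
    with h hh hlt k hk
  have h0 := pos_of_mem_biasSet hh
  have e : (h ^ (-β)) ^ 4 = (iters h : ℝ) ^ (2 * β) := by
    rw [← rpow_neg_eq hh, ← Real.rpow_natCast, ← Real.rpow_mul h0.le]
    congr 1; push_cast; ring
  have h2 : varWeight m γ₁ β h k ^ 4 ≤ δ ^ 4 := by
    rw [varWeight, mul_pow, e]
    have h3 : coeff m (step γ₁ β) (iters h) k ^ 4 ≤ K * ((iters h : ℝ) + 1) ^ (-(β * 3)) :=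
      (Finset.single_le_sum (f := fun k => coeff m (step γ₁ β) (iters h) k ^ 4)
        (fun k _ => by positivity) hk).trans (hK _)
    refine (mul_le_mul_of_nonneg_left h3 (by positivity)).trans (le_of_eq_of_le ?_ hlt.le)
    have : -(β * 3) = -(2 * β) + -β := by ring
    rw [this, Real.rpow_add (by positivity)]
    ring
  have h3 : |varWeight m γ₁ β h k| ^ 4 ≤ δ ^ 4 := by
    rwa [Even.pow_abs (by decide)]
  exact le_of_pow_le_pow_left₀ (by norm_num) hδ.le h3

/-- Limits of the quadratic forms of the weights. -/
lemma tendsto_sum_quadratic (hγ₁ : 0 < γ₁) (hβ : β ∈ Set.Ioc (0 : ℝ) 1) (hm : 0 < m)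
    (hm' : 0 < 2 * m - γ₁⁻¹ * indOne β) (a b c s t : ℝ) :
    Tendsto (fun h => ∑ k ∈ Finset.range (iters h), ((s * varWeight m γ₁ β h k) ^ 2 * a
        + 2 * ((s * varWeight m γ₁ β h k) * (t * h)) * b + (t * h) ^ 2 * c)) (𝓝[biasSet] 0)
      (𝓝 (a * (γ₁ * (2 * m - γ₁⁻¹ * indOne β)⁻¹) * s ^ 2
        + 2 * (b * (indOne β * m⁻¹)) * s * t + c * t ^ 2)) := by
  have h1 := ((tendsto_sum_varWeight_sq hγ₁ hβ hm').const_mul (a * s ^ 2)).add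
    ((tendsto_sum_varWeight_mul hγ₁ hβ hm).const_mul (2 * b * s * t))
  have h2 := h1.add_const (c * t ^ 2)
  refine (h2.congr' ?_).trans (le_of_eq (by congr 1; ring))
  filter_upwards [eventually_mem_biasSet] with h hh
  have h0 := pos_of_mem_biasSet hh
  rw [Finset.sum_add_distrib, Finset.sum_add_distrib, Finset.sum_const, Finset.card_range,
    nsmul_eq_mul, iters_eq hh, Finset.mul_sum, Finset.mul_sum]
  congr 1
  · congr 1
    · exact Finset.sum_congr rfl fun k _ => by ring
    · exact Finset.sum_congr rfl fun k _ => by ring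
  · field_simp

end Weights

lemma measurable_vec {Ω : Type*} {mΩ : MeasurableSpace Ω} {a b : Ω → ℝ} (ha : Measurable a)
    (hb : Measurable b) : Measurable fun ω => (!₂[a ω, b ω] : EuclideanSpace ℝ (Fin 2)) := by
  refine (WithLp.measurable_toLp 2 (Fin 2 → ℝ)).comp (measurable_pi_lambda _ fun i => ?_)
  fin_cases i
  · exact ha
  · exact hb

section CharFun

open Complex (I)

variable {Ω : Type*} {mΩ : MeasurableSpace Ω} {P : Measure Ω}

/-- The characteristic function of a weighted sum of i.i.d. vectors is a product. -/
lemma charFun_sum_eq_prod {x : ℕ → Ω → ℝ} {ρ : Measure ℝ} (hx : ∀ k, Measurable (x k))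
    (hρ : ∀ k, P.map (x k) = ρ) (hind : iIndepFun x P) {A B : ℝ → ℝ} (hA : Measurable A)
    (hB : Measurable B) (c : EuclideanSpace ℝ (Fin 2)) (s t : ℕ → ℝ) (n : ℕ)
    (τ : EuclideanSpace ℝ (Fin 2)) :
    charFun (P.map fun ω => c + !₂[∑ k ∈ Finset.range n, s k * A (x k ω),
        ∑ k ∈ Finset.range n, t k * B (x k ω)]) τ =
      Complex.exp ((inner ℝ c τ : ℝ) * I) * ∏ k ∈ Finset.range n,
        ∫ y, Complex.exp ((τ 0 * s k * A y + τ 1 * t k * B y : ℝ) * I) ∂ρ := by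
  have hm : Measurable fun ω => c + !₂[∑ k ∈ Finset.range n, s k * A (x k ω),
        ∑ k ∈ Finset.range n, t k * B (x k ω)] := by
    refine measurable_const.add ?_
    exact measurable_vec (Finset.measurable_sum _ fun k _ => (hA.comp (hx k)).const_mul _)
      (Finset.measurable_sum _ fun k _ => (hB.comp (hx k)).const_mul _)
  rw [charFun_apply, integral_map hm.aemeasurable (by fun_prop)]
  have e : ∀ ω, Complex.exp ((inner ℝ (c + !₂[∑ k ∈ Finset.range n, s k * A (x k ω),
        ∑ k ∈ Finset.range n, t k * B (x k ω)]) τ : ℝ) * I) = Complex.exp ((inner ℝ c τ : ℝ) * I) *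
      ∏ k : Fin n, Complex.exp ((τ 0 * s k * A (x k ω) + τ 1 * t k * B (x k ω) : ℝ) * I) := by
    intro ω
    have e1 : (inner ℝ (!₂[∑ k ∈ Finset.range n, s k * A (x k ω),
        ∑ k ∈ Finset.range n, t k * B (x k ω)] : EuclideanSpace ℝ (Fin 2)) τ : ℝ)
        = ∑ k ∈ Finset.range n, (τ 0 * s k * A (x k ω) + τ 1 * t k * B (x k ω)) := by
      simp only [PiLp.inner_apply, Fin.sum_univ_two]
      rw [Finset.sum_add_distrib]
      simp only [mul_assoc, ← Finset.mul_sum]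
      simp
    rw [inner_add_left, e1, ← Finset.prod_range
      (fun k => Complex.exp ((τ 0 * s k * A (x k ω) + τ 1 * t k * B (x k ω) : ℝ) * I)),
      ← Complex.exp_sum, ← Complex.exp_add, ← Finset.sum_mul]
    push_cast
    congr 1; ring
  simp only [e]
  rw [integral_const_mul]
  congr 1
  have hg : ∀ k : Fin n, Measurable fun y : ℝ =>
      Complex.exp ((τ 0 * s k * A y + τ 1 * t k * B y : ℝ) * I) := fun k => by fun_prop
  rw [(hind.precomp (g := fun k : Fin n => (k : ℕ)) Fin.val_injective).integral_fun_prod_comp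
    (f := fun (k : Fin n) y => Complex.exp ((τ 0 * s k * A y + τ 1 * t k * B y : ℝ) * I))
    (fun k => (hx k).aemeasurable) (fun k => (hg k).aestronglyMeasurable), Finset.prod_range]
  refine Finset.prod_congr rfl fun k _ => ?_
  rw [← hρ k, integral_map (hx k).aemeasurable (hg k).aestronglyMeasurable]

end CharFun

/-! ### Central limit theorem for the linearized scheme -/

/-- The leading term of the renormalized errors: the deterministic bias `c` plus weighted sums of
i.i.d. centred vectors. -/
def linearized (ρ : Measure ℝ) (α z m γ₁ β : ℝ) (c : EuclideanSpace ℝ (Fin 2)) (h : ℝ)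
    (x : ℕ → ℝ) : EuclideanSpace ℝ (Fin 2) :=
  c + !₂[∑ k ∈ Finset.range (iters h), varWeight m γ₁ β h k * varNoise α z (x k),
    ∑ k ∈ Finset.range (iters h), h * esNoise ρ α z (x k)]

lemma measurable_linearized {Ω : Type*} {mΩ : MeasurableSpace Ω} (ρ : Measure ℝ)
    (α z m γ₁ β : ℝ) (c : EuclideanSpace ℝ (Fin 2)) (h : ℝ) {x : ℕ → Ω → ℝ}
    (hx : ∀ k, Measurable (x k)) :
    Measurable fun ω => linearized ρ α z m γ₁ β c h fun k => x k ω :=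
  measurable_const.add (measurable_vec
    (Finset.measurable_sum _ fun k _ => ((measurable_varNoise α z).comp (hx k)).const_mul _)
    (Finset.measurable_sum _ fun k _ => ((measurable_esNoise ρ α z).comp (hx k)).const_mul _))

namespace RegularLaws

variable {Ω : Type*} {mΩ : MeasurableSpace Ω} {P : Measure Ω} [IsProbabilityMeasure P]
  {α γ₁ β : ℝ} {X : ℝ → Ω → ℝ} {f : ℝ → ℝ → ℝ} {C : ℝ≥0} {z : ℝ → ℝ}

/-- The quadratic form of the asymptotic covariance matrix is the limit of the variances of the
projections of the linearized scheme. -/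
lemma tendsto_sum_integral_sq (hα : α ∈ Set.Ioo (0 : ℝ) 1)
    (hX2 : ∀ h ∈ insert 0 biasSet, MemLp (X h) 2 P)
    (hρ : RegularDensity (P.map (X 0)) (f 0) C) (hz : cdf (P.map (X 0)) (z 0) = α)
    (hγ₁ : 0 < γ₁) (hβ : β ∈ Set.Ioc (0 : ℝ) 1)
    (hm' : 0 < 2 * (f 0 (z 0) / (1 - α)) - γ₁⁻¹ * indOne β) (τ : Fin 2 → ℝ) :
    Tendsto (fun h => ∑ k ∈ Finset.range (iters h),
        ∫ ω, (τ 0 * varWeight (f 0 (z 0) / (1 - α)) γ₁ β h k * varNoise α (z 0) (X 0 ω)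
          + τ 1 * h * esNoise (P.map (X 0)) α (z 0) (X 0 ω)) ^ 2 ∂P) (𝓝[biasSet] 0)
      (𝓝 (dotProduct τ (Matrix.mulVec (asympCov P α γ₁ β (X 0) (z 0)
        (objective P α (X 0) (z 0)) (f 0 (z 0))) τ))) := by
  have h0 := zero_mem_insert_biasSet
  have h1α : 0 < 1 - α := by linarith [hα.2]
  have hX0 := (hX2 0 h0).aemeasurable
  have hp := Measure.isProbabilityMeasure_map (μ := P) hX0
  have hf := hρ.pos (z 0)
  set ρ := P.map (X 0) with hρ_def
  set m := f 0 (z 0) / (1 - α) with hm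
  have hA := memLp_varNoise (ρ := ρ) hα (z 0)
  have hB : MemLp (esNoise ρ α (z 0)) 2 ρ := memLp_esNoise (memLp_map hX2 h0) α (z 0)
  have e : ∀ s t : ℝ, ∫ ω, (s * varNoise α (z 0) (X 0 ω) + t * esNoise ρ α (z 0) (X 0 ω)) ^ 2 ∂P
      = s ^ 2 * (α / (1 - α)) + 2 * (s * t) * (α / (1 - α) * (objective ρ α id (z 0) - z 0))
        + t ^ 2 * (variance (fun y => max (y - z 0) 0) ρ / (1 - α) ^ 2) := by
    intro s t
    have hmeas : Measurable fun y => (s * varNoise α (z 0) y + t * esNoise ρ α (z 0) y) ^ 2 :=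
      (((measurable_varNoise α (z 0)).const_mul s).add
        ((measurable_esNoise ρ α (z 0)).const_mul t)).pow_const 2
    rw [← integral_map hX0 (f := fun y => (s * varNoise α (z 0) y + t * esNoise ρ α (z 0) y) ^ 2)
      hmeas.aestronglyMeasurable, ← hρ_def,
      ← hρ.integral_varNoise_mul_esNoise hz hα, ← hρ.integral_varNoise_sq hz hα,
      ← hρ.integral_esNoise_sq α (z 0)]
    have i1 := hA.integrable_sq.const_mul (s ^ 2)
    have i2 : Integrable (fun y => 2 * (s * t) * (varNoise α (z 0) y * esNoise ρ α (z 0) y)) ρ :=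
      (hA.integrable_mul hB).const_mul (2 * (s * t))
    have i12 : Integrable (fun y => s ^ 2 * varNoise α (z 0) y ^ 2
      + 2 * (s * t) * (varNoise α (z 0) y * esNoise ρ α (z 0) y)) ρ := i1.add i2
    have i3 := hB.integrable_sq.const_mul (t ^ 2)
    rw [← integral_const_mul, ← integral_const_mul, ← integral_const_mul,
      ← integral_add i1 i2, ← integral_add i12 i3]
    refine integral_congr_ae (ae_of_all _ fun y => ?_)
    ring
  simp only [e]
  have hlim := tendsto_sum_quadratic hγ₁ hβ (by positivity : 0 < m) hm' (α / (1 - α))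
    (α / (1 - α) * (objective ρ α id (z 0) - z 0))
    (variance (fun y => max (y - z 0) 0) ρ / (1 - α) ^ 2) (τ 0) (τ 1)
  convert hlim using 2
  have hvar : variance (fun y => max (y - z 0) 0) ρ = variance (fun ω => max (X 0 ω - z 0) 0) P :=
    variance_map (by fun_prop) hX0
  have hden : 2 * m - γ₁⁻¹ * indOne β = (2 * f 0 (z 0) - γ₁⁻¹ * (1 - α) * indOne β) / (1 - α) := by
    rw [hm]; field_simp
  rw [hvar, hden, objective_map hX0, hm]
  simp only [asympCov, Matrix.mulVec, dotProduct, Fin.sum_univ_two, Matrix.of_apply,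
    Matrix.cons_val_zero, Matrix.cons_val_one, Matrix.cons_val', Matrix.cons_val_fin_one]
  rw [inv_div]
  field_simp
  ring

/-- The quadratic form of the covariance matrix is a limit of variances of the linearized scheme,
hence nonnegative. -/
theorem posSemidef_asympCov (hα : α ∈ Set.Ioo (0 : ℝ) 1)
    (hX2 : ∀ h ∈ insert 0 biasSet, MemLp (X h) 2 P)
    (hρ : RegularDensity (P.map (X 0)) (f 0) C) (hz : cdf (P.map (X 0)) (z 0) = α)
    (hγ₁ : 0 < γ₁) (hβ : β ∈ Set.Ioc (0 : ℝ) 1)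
    (hm' : 0 < 2 * (f 0 (z 0) / (1 - α)) - γ₁⁻¹ * indOne β) :
    (asympCov P α γ₁ β (X 0) (z 0) (objective P α (X 0) (z 0)) (f 0 (z 0))).PosSemidef := by
  refine Matrix.PosSemidef.of_dotProduct_mulVec_nonneg ?_ fun τ => ?_
  · ext i j
    fin_cases i <;> fin_cases j <;> simp [asympCov]
  · rw [star_trivial]
    exact ge_of_tendsto' (tendsto_sum_integral_sq hα hX2 hρ hz hγ₁ hβ hm' τ) fun h =>
      Finset.sum_nonneg fun k _ => integral_nonneg fun ω => sq_nonneg _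

/-- The characteristic functions of the linearized scheme converge to that of the Gaussian limit. -/
theorem tendsto_charFun_linearized (hα : α ∈ Set.Ioo (0 : ℝ) 1)
    (hX2 : ∀ h ∈ insert 0 biasSet, MemLp (X h) 2 P)
    (hρ : ∀ h ∈ insert 0 biasSet, RegularDensity (P.map (X h)) (f h) C)
    (hz : ∀ h ∈ insert 0 biasSet, cdf (P.map (X h)) (z h) = α)
    (hXl : Tendsto (fun h => ∫ ω, (X h ω - X 0 ω) ^ 2 ∂P) (𝓝[biasSet] 0) (𝓝 0))
    (hzl : Tendsto z (𝓝[biasSet] 0) (𝓝 (z 0)))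
    (hγ₁ : 0 < γ₁) (hβ : β ∈ Set.Ioc (0 : ℝ) 1)
    (hm' : 0 < 2 * (f 0 (z 0) / (1 - α)) - γ₁⁻¹ * indOne β)
    (hcrit : β = 1 → 3 < 4 * (f 0 (z 0) / (1 - α)) * γ₁)
    {x : ℝ → ℕ → Ω → ℝ} (hx : ∀ h ∈ biasSet, ∀ k, Measurable (x h k))
    (hxρ : ∀ h ∈ biasSet, ∀ k, P.map (x h k) = P.map (X h))
    (hind : ∀ h ∈ biasSet, iIndepFun (x h) P) (c τ : EuclideanSpace ℝ (Fin 2)) :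
    Tendsto (fun h => charFun (P.map fun ω => linearized (P.map (X h)) α (z h)
        (f 0 (z 0) / (1 - α)) γ₁ β c h fun k => x h k ω) τ) (𝓝[biasSet] 0)
      (𝓝 (charFun (multivariateGaussian c (asympCov P α γ₁ β (X 0) (z 0)
        (objective P α (X 0) (z 0)) (f 0 (z 0)))) τ)) := by
  have h0 := zero_mem_insert_biasSet
  have h1α : 0 < 1 - α := by linarith [hα.2]
  have hX0 := (hX2 0 h0).aemeasurable
  have hp : ∀ h ∈ insert 0 biasSet, IsProbabilityMeasure (P.map (X h)) := fun h hh =>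
    Measure.isProbabilityMeasure_map (hX2 h hh).aemeasurable
  have hp0 := hp 0 h0
  have hm : 0 < f 0 (z 0) / (1 - α) := div_pos ((hρ 0 h0).pos _) h1α
  set m := f 0 (z 0) / (1 - α) with hm_def
  rw [charFun_multivariateGaussian (posSemidef_asympCov hα hX2 (hρ 0 h0) (hz 0 h0) hγ₁ hβ hm')]
  set q := dotProduct (τ : Fin 2 → ℝ) (Matrix.mulVec (asympCov P α γ₁ β (X 0) (z 0)
        (objective P α (X 0) (z 0)) (f 0 (z 0))) τ) with hq
  have hA : ∀ h ∈ insert 0 biasSet, MemLp (fun ω => varNoise α (z h) (X h ω)) 2 P ∧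
      ∫ ω, varNoise α (z h) (X h ω) ∂P = 0 := by
    intro h hh
    have := hp h hh
    have hXh := (hX2 h hh).aemeasurable
    refine ⟨(memLp_map_measure_iff (measurable_varNoise α (z h)).aestronglyMeasurable hXh).1
      (memLp_varNoise hα (z h)), ?_⟩
    rw [← integral_map hXh (measurable_varNoise α (z h)).aestronglyMeasurable]
    exact (hρ h hh).integral_varNoise (hz h hh) hα.2
  have hB : ∀ h ∈ insert 0 biasSet, MemLp (fun ω => esNoise (P.map (X h)) α (z h) (X h ω)) 2 P ∧
      ∫ ω, esNoise (P.map (X h)) α (z h) (X h ω) ∂P = 0 := by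
    intro h hh
    have := hp h hh
    have hXh := (hX2 h hh).aemeasurable
    refine ⟨(memLp_map_measure_iff (measurable_esNoise _ α (z h)).aestronglyMeasurable hXh).1
      (memLp_esNoise (memLp_map hX2 hh) α (z h)), ?_⟩
    rw [← integral_map hXh (measurable_esNoise _ α (z h)).aestronglyMeasurable]
    exact (hρ h hh).integral_esNoise α (z h)
  have hsmall : ∀ δ > 0, ∀ᶠ h in 𝓝[biasSet] 0, ∀ k ∈ Finset.range (iters h),
      |τ 0 * varWeight m γ₁ β h k| ≤ δ ∧ |τ 1 * h| ≤ δ := by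
    intro δ hδ
    have h1 := eventually_abs_varWeight_le hγ₁ hβ hm hcrit
      (show 0 < δ / (|τ 0| + 1) by positivity)
    have h2 : Tendsto (fun h => |τ 1 * h|) (𝓝[biasSet] 0) (𝓝 0) := by
      simpa using (tendsto_id_biasSet.const_mul (τ 1)).abs
    filter_upwards [h1, h2.eventually_lt_const hδ] with h h3 h4 k hk
    refine ⟨?_, h4.le⟩
    have h5 := h3 k hk
    rw [le_div_iff₀ (by positivity)] at h5
    rw [abs_mul]
    nlinarith [abs_nonneg (τ 0), abs_nonneg (varWeight m γ₁ β h k)]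
  have hM : ∀ᶠ h in 𝓝[biasSet] 0, ∑ k ∈ Finset.range (iters h),
      ((τ 0 * varWeight m γ₁ β h k) ^ 2 + (τ 1 * h) ^ 2) ≤
        1 * (γ₁ * (2 * m - γ₁⁻¹ * indOne β)⁻¹) * τ 0 ^ 2
          + 2 * (0 * (indOne β * m⁻¹)) * τ 0 * τ 1 + 1 * τ 1 ^ 2 + 1 := by
    have h1 := tendsto_sum_quadratic hγ₁ hβ hm hm' 1 0 1 (τ 0) (τ 1)
    filter_upwards [h1.eventually_lt_const (lt_add_one _)] with h h2
    refine le_of_eq_of_le (Finset.sum_congr rfl fun k _ => ?_) h2.le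
    ring
  have key := tendsto_prod_charFun (P := P) (l := 𝓝[biasSet] (0 : ℝ)) (n := iters)
    (A := fun h ω => varNoise α (z h) (X h ω))
    (B := fun h ω => esNoise (P.map (X h)) α (z h) (X h ω))
    (s := fun h k => τ 0 * varWeight m γ₁ β h k) (t := fun h _ => τ 1 * h)
    (by filter_upwards [eventually_mem_biasSet] with h hh using hA h (mem_insert_biasSet hh))
    (by filter_upwards [eventually_mem_biasSet] with h hh using hB h (mem_insert_biasSet hh))
    (hA 0 h0).1 (hB 0 h0).1 (hA 0 h0).2 (hB 0 h0).2
    (tendsto_integral_varNoise_sub_sq hα hX2 (hρ 0 h0) hXl hzl)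
    (tendsto_integral_esNoise_sub_sq hX2 hXl hzl) hsmall hM
    (tendsto_sum_integral_sq hα hX2 (hρ 0 h0) (hz 0 h0) hγ₁ hβ hm' τ)
  have key2 := key.const_mul (Complex.exp ((inner ℝ c τ : ℝ) * Complex.I))
  have e : Complex.exp ((inner ℝ c τ : ℝ) * Complex.I) * (Real.exp (-q / 2) : ℂ)
      = Complex.exp ((inner ℝ τ c : ℝ) * Complex.I - q / 2) := by
    rw [real_inner_comm, Complex.ofReal_exp, ← Complex.exp_add]
    congr 1; push_cast; ring
  rw [e] at key2
  refine key2.congr' ?_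
  filter_upwards [eventually_mem_biasSet] with h hh
  have hXh := (hX2 h (mem_insert_biasSet hh)).aemeasurable
  have h1 := charFun_sum_eq_prod (hx h hh) (hxρ h hh) (hind h hh)
    (measurable_varNoise α (z h)) (measurable_esNoise (P.map (X h)) α (z h)) c
    (varWeight m γ₁ β h) (fun _ => h) (iters h) τ
  simp only [linearized]
  rw [h1]
  congr 1
  refine Finset.prod_congr rfl fun k _ => ?_
  have hmA := measurable_varNoise α (z h)
  have hmB := measurable_esNoise (P.map (X h)) α (z h)
  have hmeas : Measurable fun y => Complex.exp ((τ 0 * varWeight m γ₁ β h k * varNoise α (z h) y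
      + τ 1 * h * esNoise (P.map (X h)) α (z h) y : ℝ) * Complex.I) := by fun_prop
  exact (integral_map hXh hmeas.aestronglyMeasurable).symm

end RegularLaws

/-! ### The linearization error is negligible -/

lemma sum_range_sqrt_succ_sub (n : ℕ) :
    ∑ k ∈ Finset.range n, (Real.sqrt ((k : ℝ) + 1) - Real.sqrt k) = Real.sqrt n := by
  have := Finset.sum_range_sub (fun k : ℕ => Real.sqrt k) n
  simpa using this

/-- For `β > 1 / 2` the partial sums of `k^{-β}` are `o(√n)`. -/
lemma isLittleO_sum_rpow_neg {β : ℝ} (hβ : 1 / 2 < β) :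
    (fun n : ℕ => ∑ k ∈ Finset.range n, ((k : ℝ) + 1) ^ (-β)) =o[atTop]
      fun n : ℕ => Real.sqrt n := by
  have hg : ∀ k : ℕ, ((k : ℝ) + 1) ^ (-(1 / 2) : ℝ) ≤
      2 * (Real.sqrt ((k : ℝ) + 1) - Real.sqrt k) := by
    intro k
    have h1 : Real.sqrt k ≤ Real.sqrt ((k : ℝ) + 1) := Real.sqrt_le_sqrt (by linarith)
    have h0 := Real.sqrt_nonneg (k : ℝ)
    have h2 : 0 < Real.sqrt ((k : ℝ) + 1) := Real.sqrt_pos.2 (by positivity)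
    have h3 := Real.sq_sqrt (show (0 : ℝ) ≤ k by positivity)
    have h4 := Real.sq_sqrt (show (0 : ℝ) ≤ (k : ℝ) + 1 by positivity)
    rw [Real.rpow_neg (by positivity), ← Real.sqrt_eq_rpow, inv_le_iff_one_le_mul₀ h2]
    nlinarith
  have hfg : (fun k : ℕ => ((k : ℝ) + 1) ^ (-β)) =o[atTop]
      fun k : ℕ => Real.sqrt ((k : ℝ) + 1) - Real.sqrt k := by
    rw [Asymptotics.isLittleO_iff]
    intro c hc
    have h1 := (tendsto_succ_rpow_neg (p := β - 1 / 2) (by linarith)).eventually_le_const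
      (show (0 : ℝ) < c / 2 by positivity)
    filter_upwards [h1] with k hk
    have h2 := hg k
    have h3 : 0 < ((k : ℝ) + 1) ^ (-(1 / 2) : ℝ) := by positivity
    rw [Real.norm_of_nonneg (by positivity), Real.norm_of_nonneg (by linarith)]
    have e : -β = -(β - 1 / 2) + -(1 / 2) := by ring
    rw [e, Real.rpow_add (by positivity)]
    calc _ ≤ c / 2 * ((k : ℝ) + 1) ^ (-(1 / 2) : ℝ) := by gcongr
      _ ≤ c / 2 * (2 * (Real.sqrt ((k : ℝ) + 1) - Real.sqrt k)) := by gcongr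
      _ = _ := by ring
  have := hfg.sum_range (fun k => sub_nonneg.2 (Real.sqrt_le_sqrt (by linarith))) (by
    simp only [sum_range_sqrt_succ_sub]
    exact Real.tendsto_sqrt_atTop.comp tendsto_natCast_atTop_atTop)
  simpa only [sum_range_sqrt_succ_sub] using this

lemma tendsto_mul_sum_rpow_neg {β : ℝ} (hβ : 1 / 2 < β) :
    Tendsto (fun h => h * ∑ k ∈ Finset.range (iters h), ((k : ℝ) + 1) ^ (-β)) (𝓝[biasSet] 0)
      (𝓝 0) := by
  have h1 := (isLittleO_sum_rpow_neg hβ).tendsto_div_nhds_zero.comp tendsto_iters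
  refine h1.congr' ?_
  filter_upwards [eventually_mem_biasSet] with h hh
  have h0 := pos_of_mem_biasSet hh
  simp only [Function.comp]
  rw [iters_eq hh, Real.sqrt_inv, Real.sqrt_sq h0.le, div_inv_eq_mul, mul_comm]

lemma norm_vec_le (v : EuclideanSpace ℝ (Fin 2)) : ‖v‖ ≤ |v 0| + |v 1| := by
  rw [EuclideanSpace.norm_eq, Fin.sum_univ_two, Real.norm_eq_abs, Real.norm_eq_abs]
  refine Real.sqrt_le_iff.2 ⟨by positivity, ?_⟩
  nlinarith [mul_nonneg (abs_nonneg (v 0)) (abs_nonneg (v 1))]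

namespace RegularLaws

variable {Ω : Type*} {mΩ : MeasurableSpace Ω} {P : Measure Ω} [IsProbabilityMeasure P]
  {α γ₁ β : ℝ} {X : ℝ → Ω → ℝ} {f : ℝ → ℝ → ℝ} {v : ℝ → ℝ} {w : ℝ → ℝ → ℝ} {C : ℝ≥0} {z : ℝ → ℝ}
  {ξ₀ : ℝ → Ω → ℝ}

/-- The bias of the value-at-risk is of order `h`, and is therefore negligible at the scale `h^β`
unless `β = 1`. -/
lemma tendsto_rpow_mul_valueAtRisk_sub (hreg : RegularLaws P α X f v w)
    (hα : α ∈ Set.Ioo (0 : ℝ) 1)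
    (hX : ∀ h ∈ insert 0 biasSet, AEMeasurable (X h) P)
    (hρ : ∀ h ∈ insert 0 biasSet, RegularDensity (P.map (X h)) (f h) C)
    (hz : ∀ h ∈ insert 0 biasSet, cdf (P.map (X h)) (z h) = α) (hβ : β ∈ Set.Ioc (0 : ℝ) 1) :
    Tendsto (fun h => h ^ (-β) * (z h - z 0)) (𝓝[biasSet] 0)
      (𝓝 (-(v (z 0) / f 0 (z 0)) * indOne β)) := by
  have h1 := (hreg.tendsto_valueAtRisk_sub_div hα hX hρ hz).mul (tendsto_rpow_one_sub hβ)
  refine h1.congr' ?_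
  filter_upwards [eventually_mem_biasSet] with h hh
  have h0 := pos_of_mem_biasSet hh
  rw [sub_eq_add_neg 1 β, Real.rpow_add h0, Real.rpow_one]
  field_simp

/-- The renormalized errors are `L¹`-close to the linearized scheme. -/
theorem exists_scaledError_sub_linearized_le (hreg : RegularLaws P α X f v w)
    (hα : α ∈ Set.Ioo (0 : ℝ) 1)
    (hX : ∀ h ∈ insert 0 biasSet, AEMeasurable (X h) P)
    (hρ : ∀ h ∈ insert 0 biasSet, RegularDensity (P.map (X h)) (f h) C)
    (hz : ∀ h ∈ insert 0 biasSet, cdf (P.map (X h)) (z h) = α) (hγ₁ : 0 < γ₁)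
    (hβ : β ∈ Set.Ioc (1 / 2 : ℝ) 1) (hlam : β = 1 → 1 < lam P α X * γ₁)
    (hcrit : β = 1 → 1 < f 0 (z 0) / (1 - α) * γ₁)
    (hinit : InitialMoment P α f ξ₀) (hξ₀ : ∀ h ∈ biasSet, Measurable (ξ₀ h)) :
    ∃ D : ℝ → ℝ, Tendsto D (𝓝[biasSet] 0) (𝓝 0) ∧ ∀ᶠ h in 𝓝[biasSet] 0,
      ∀ (ℱ : Filtration ℕ mΩ) (x : ℕ → Ω → ℝ),
        Innovations P (P.map (X h)) ℱ x → Measurable[ℱ 0] (ξ₀ h) →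
        ∃ g : Ω → ℝ, Integrable g P ∧ (∀ ω,
          ‖scaledError α γ₁ β h (z 0) (objective P α (X 0) (z 0)) (ξ₀ h ω) (fun k => x k ω)
            - linearized (P.map (X h)) α (z h) (f 0 (z 0) / (1 - α)) γ₁ β
              (asympMean α β v (z 0) (f 0 (z 0))) h (fun k => x k ω)‖ ≤ g ω) ∧
        ∫ ω, g ω ∂P ≤ D h := by
  have h0 := zero_mem_insert_biasSet
  have h1α : 0 < 1 - α := by linarith [hα.2]
  have hβ' : β ∈ Set.Ioc (0 : ℝ) 1 := ⟨by linarith [hβ.1], hβ.2⟩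
  have hm : 0 < f 0 (z 0) / (1 - α) := div_pos ((hρ 0 h0).pos _) h1α
  set m := f 0 (z 0) / (1 - α) with hm_def
  obtain ⟨M, hM, hUM⟩ :=
    hreg.exists_integral_varProc_sub_sq_le hα hX hρ hz hγ₁ hβ' hlam hinit hξ₀
  obtain ⟨K₁, hK₁⟩ := exists_rateBound (s := 1) hγ₁ hβ' one_pos hm (sq_nonneg m) hcrit
  obtain ⟨K₂, hK₂⟩ := exists_rateBound (s := 1 / 2) hγ₁ hβ' (by norm_num) hm (sq_nonneg m)
    (fun h => by linarith [hcrit h])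
  obtain ⟨K₃, hK₃⟩ := exists_rateBound (c := 2 * m) (s := 1 + 1 / 2) hγ₁ hβ' (by norm_num)
    (by positivity) (sq_nonneg m) (fun h => by linarith [hcrit h])
  set c := asympMean α β v (z 0) (f 0 (z 0)) with hc
  set A₃ := K₃ * (γ₁ ^ 2 * ((1 / (1 - α)) ^ 2 * C * Real.sqrt M)) with hA₃
  set A₁ := K₁ * (Real.sqrt M + γ₁ * (C / (1 - α) * M)) with hA₁
  have hA₁0 : 0 ≤ A₁ := mul_nonneg hK₁.1 (by positivity)
  have hK₂0 := hK₂.1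
  set R : ℝ → ℝ := fun h => Real.sqrt A₃ * ((iters h : ℝ) + 1) ^ (-(β * (1 / 4)))
    + A₁ * ((iters h : ℝ) + 1) ^ (-(β * (1 / 2)))
    + K₂ * (γ₁ * (|f h (z h) / (1 - α) - m| * Real.sqrt M)) with hR
  set S : ℝ → ℝ := fun h => ∑ k ∈ Finset.range (iters h), ((k : ℝ) + 1) ^ (-β) with hS
  set T : ℝ → ℝ := fun h => Real.sqrt ((1 + 1 / (1 - α)) ^ 2 * M * (h * (h * S h)))
    + C / (1 - α) * M * (h * S h) with hT
  set d₀ : ℝ → ℝ := fun h => |h ^ (-β) * (z h - z 0) - c 0| with hd₀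
  set d₁ : ℝ → ℝ := fun h =>
    |h⁻¹ * (objective P α (X h) (z h) - objective P α (X 0) (z 0)) - c 1| with hd₁
  have hRl : Tendsto R (𝓝[biasSet] 0) (𝓝 0) := by
    have h1 := ((tendsto_succ_rpow_neg (p := β * (1 / 4)) (by linarith [hβ.1])).comp
      tendsto_iters).const_mul (Real.sqrt A₃)
    have h2 := ((tendsto_succ_rpow_neg (p := β * (1 / 2)) (by linarith [hβ.1])).comp
      tendsto_iters).const_mul A₁
    have h3 := (((((hreg.tendsto_density_valueAtRisk hα hX hρ hz).div_const (1 - α)).sub_const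
      m).abs.mul_const (Real.sqrt M)).const_mul γ₁).const_mul K₂
    rw [← hm_def, sub_self, abs_zero, zero_mul, mul_zero, mul_zero] at h3
    have h4 := (h1.add h2).add h3
    simp only [mul_zero, add_zero] at h4
    exact h4
  have hTl : Tendsto T (𝓝[biasSet] 0) (𝓝 0) := by
    have h1 := tendsto_mul_sum_rpow_neg hβ.1
    have h2 : Tendsto T _ _ :=
      (((tendsto_id_biasSet.mul h1).const_mul ((1 + 1 / (1 - α)) ^ 2 * M)).sqrt).add
      (h1.const_mul (C / (1 - α) * M))
    simpa only [mul_zero, Real.sqrt_zero, add_zero] using h2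
  have hd₀l : Tendsto d₀ (𝓝[biasSet] 0) (𝓝 0) := by
    have := ((hreg.tendsto_rpow_mul_valueAtRisk_sub hα hX hρ hz hβ').sub_const (c 0)).abs
    have e : c 0 = -(v (z 0) / f 0 (z 0)) * indOne β := rfl
    rwa [← e, sub_self, abs_zero] at this
  have hd₁l : Tendsto d₁ (𝓝[biasSet] 0) (𝓝 0) := by
    have := ((hreg.tendsto_objective_sub_div hα hX hρ hz).sub_const (c 1)).abs
    have e : c 1 = -∫ x in Set.Ioi (z 0), v x / (1 - α) := rfl
    rwa [← e, sub_self, abs_zero] at this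
  refine ⟨fun h => R h + d₀ h + (T h + d₁ h), by
    simpa using (hRl.add hd₀l).add (hTl.add hd₁l), ?_⟩
  filter_upwards [eventually_mem_biasSet, hUM] with h hh hUMh ℱ x hI hξℱ
  have hh' := mem_insert_biasSet hh
  have hpos := pos_of_mem_biasSet hh
  have hp := Measure.isProbabilityMeasure_map (μ := P) (hX h hh')
  have hn := iters_pos hh
  set n := iters h with hn_def
  obtain ⟨i₁, b₁⟩ := integral_abs_varProc_sub_linRec_le hα hγ₁ hI hξℱ (hρ h hh') (hz h hh') hM
    (fun n => (hUMh ℱ x hI hξℱ n).1) (fun n => (hUMh ℱ x hI hξℱ n).2) hK₁ hK₂ hK₃ n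
  obtain ⟨i₂, b₂⟩ := integral_abs_esIter_sub_le hα hI hξℱ (hρ h hh') (hz h hh')
    (fun n => (hUMh ℱ x hI hξℱ n).1) (fun n => (hUMh ℱ x hI hξℱ n).2) n
  set G₁ : Ω → ℝ := fun ω => varProc α γ₁ β (ξ₀ h) x n ω - z h
        - linRec m (step γ₁ β) 0 (fun k => -H₁ α (z h) (x k ω)) n with hG₁
  set G₂ : Ω → ℝ := fun ω => n * (esIter α (learningRate γ₁ β) (ξ₀ h ω) (fun k => x k ω) n
        - objective (P.map (X h)) α id (z h)) - ∑ k ∈ Finset.range n,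
          (z h + 1 / (1 - α) * max (x k ω - z h) 0 - objective (P.map (X h)) α id (z h)) with hG₂
  have hrp : h ^ (-β) = (n : ℝ) ^ (β / 2) := by
    rw [hn_def, ← rpow_neg_eq hh]; congr 1; ring
  refine ⟨fun ω => h ^ (-β) * |G₁ ω| + d₀ h + (h * |G₂ ω| + d₁ h),
    ((i₁.abs.const_mul _).add (integrable_const _)).add
      ((i₂.abs.const_mul _).add (integrable_const _)), fun ω => ?_, ?_⟩
  · refine (norm_vec_le _).trans (add_le_add ?_ ?_)
    · have e : (scaledError α γ₁ β h (z 0) (objective P α (X 0) (z 0)) (ξ₀ h ω) (fun k => x k ω)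
          - linearized (P.map (X h)) α (z h) m γ₁ β c h (fun k => x k ω)) 0
          = h ^ (-β) * G₁ ω + (h ^ (-β) * (z h - z 0) - c 0) := by
        have e1 : (scaledError α γ₁ β h (z 0) (objective P α (X 0) (z 0)) (ξ₀ h ω)
            (fun k => x k ω)) 0 = h ^ (-β) * (varProc α γ₁ β (ξ₀ h) x n ω - z 0) := rfl
        have e2 : (linearized (P.map (X h)) α (z h) m γ₁ β c h (fun k => x k ω)) 0
            = c 0 + ∑ k ∈ Finset.range n, varWeight m γ₁ β h k * varNoise α (z h) (x k ω) := rfl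
        have e3 : ∑ k ∈ Finset.range n, varWeight m γ₁ β h k * varNoise α (z h) (x k ω)
            = h ^ (-β) * linRec m (step γ₁ β) 0 (fun k => -H₁ α (z h) (x k ω)) n := by
          rw [linRec_zero_eq_sum, Finset.mul_sum]
          refine Finset.sum_congr rfl fun k _ => ?_
          rw [varWeight, varNoise, mul_assoc]
        rw [PiLp.sub_apply, e1, e2, e3]
        simp only [hG₁]
        ring
      rw [e]
      refine (abs_add_le _ _).trans ?_
      rw [abs_mul, abs_of_pos (Real.rpow_pos_of_pos hpos _)]
    · have e : (scaledError α γ₁ β h (z 0) (objective P α (X 0) (z 0)) (ξ₀ h ω) (fun k => x k ω)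
          - linearized (P.map (X h)) α (z h) m γ₁ β c h (fun k => x k ω)) 1
          = h * G₂ ω + (h⁻¹ * (objective P α (X h) (z h) - objective P α (X 0) (z 0)) - c 1) := by
        have e1 : (scaledError α γ₁ β h (z 0) (objective P α (X 0) (z 0)) (ξ₀ h ω)
            (fun k => x k ω)) 1 = h⁻¹ * (esIter α (learningRate γ₁ β) (ξ₀ h ω) (fun k => x k ω) n
              - objective P α (X 0) (z 0)) := rfl
        have e2 : (linearized (P.map (X h)) α (z h) m γ₁ β c h (fun k => x k ω)) 1
            = c 1 + ∑ k ∈ Finset.range n, h *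
              (z h + 1 / (1 - α) * max (x k ω - z h) 0 - objective (P.map (X h)) α id (z h)) := rfl
        have e3 : h * (n : ℝ) = h⁻¹ := by rw [hn_def, iters_eq hh]; field_simp
        rw [PiLp.sub_apply, e1, e2, ← Finset.mul_sum]
        simp only [hG₂]
        rw [← objective_map (hX h hh')]
        linear_combination -(esIter α (learningRate γ₁ β) (ξ₀ h ω) (fun k => x k ω) n
          - objective (P.map (X h)) α id (z h)) * e3
      rw [e]
      refine (abs_add_le _ _).trans ?_
      rw [abs_mul, abs_of_pos hpos]
  · have j₁ : Integrable (fun ω => h ^ (-β) * |G₁ ω| + d₀ h) P :=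
      (i₁.abs.const_mul _).add (integrable_const _)
    have j₂ : Integrable (fun ω => h * |G₂ ω| + d₁ h) P :=
      (i₂.abs.const_mul _).add (integrable_const _)
    rw [integral_add j₁ j₂, integral_add (i₁.abs.const_mul _) (integrable_const _),
      integral_add (i₂.abs.const_mul _) (integrable_const _), integral_const_mul,
      integral_const_mul]
    simp only [integral_const, probReal_univ, one_smul]
    have c₁ : h ^ (-β) * ∫ ω, |G₁ ω| ∂P ≤ R h := by
      have hle : h ^ (-β) ≤ ((n : ℝ) + 1) ^ (β / 2) := by
        rw [hrp]
        exact Real.rpow_le_rpow hn.le (by linarith) (by linarith [hβ.1])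
      have hmul : ∀ p : ℝ, ((n : ℝ) + 1) ^ (β / 2) * ((n : ℝ) + 1) ^ (-p)
          = ((n : ℝ) + 1) ^ (-(p - β / 2)) := fun p => by
        rw [← Real.rpow_add (by positivity)]; congr 1; ring
      have hsq : Real.sqrt (A₃ * ((n : ℝ) + 1) ^ (-(β * (1 + 1 / 2))))
          = Real.sqrt A₃ * ((n : ℝ) + 1) ^ (-(β * (3 / 4))) := by
        rw [Real.sqrt_mul' _ (by positivity), Real.sqrt_eq_rpow (((n : ℝ) + 1) ^ _),
          ← Real.rpow_mul (by positivity)]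
        congr 2; ring
      rw [hsq] at b₁
      refine (mul_le_mul hle b₁ (integral_nonneg fun ω => abs_nonneg _) (by positivity)).trans_eq ?_
      simp only [hR]
      have q₁ := hmul (β * (3 / 4))
      have q₂ := hmul (β * 1)
      have q₃ := hmul (β * (1 / 2))
      rw [show β * (3 / 4) - β / 2 = β * (1 / 4) by ring] at q₁
      rw [show β * 1 - β / 2 = β * (1 / 2) by ring] at q₂
      rw [show β * (1 / 2) - β / 2 = 0 by ring, neg_zero, Real.rpow_zero] at q₃
      linear_combination Real.sqrt A₃ * q₁ + A₁ * q₂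
        + K₂ * (γ₁ * (|f h (z h) / (1 - α) - m| * Real.sqrt M)) * q₃
    have c₂ : h * ∫ ω, |G₂ ω| ∂P ≤ T h := by
      refine (mul_le_mul_of_nonneg_left b₂ hpos.le).trans_eq ?_
      simp only [hT, hS]
      rw [mul_add]
      congr 1
      · have e : ∀ a b : ℝ, a * (h * (h * b)) = h ^ 2 * (a * b) := fun a b => by ring
        rw [e, Real.sqrt_mul (sq_nonneg h), Real.sqrt_sq hpos.le]
      · ring
    linarith

end RegularLaws

/-! ### Convergence in distribution -/

section Slutsky

variable {Ω ι : Type*} {mΩ : MeasurableSpace Ω} {P : Measure Ω} [IsProbabilityMeasure P]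

lemma tendstoInMeasure_zero_of_integral_le {E : Type*} [NormedAddCommGroup E] {l : Filter ι}
    {Y : ι → Ω → E} {D : ι → ℝ} (hD : Tendsto D l (𝓝 0))
    (hY : ∀ᶠ i in l, ∃ g : Ω → ℝ, Integrable g P ∧ (∀ ω, ‖Y i ω‖ ≤ g ω) ∧ ∫ ω, g ω ∂P ≤ D i) :
    TendstoInMeasure P Y l 0 := by
  rw [tendstoInMeasure_iff_measureReal_norm]
  intro ε hε
  have h1 : Tendsto (fun i => D i / ε) l (𝓝 0) := by simpa using hD.div_const ε
  refine squeeze_zero' (Eventually.of_forall fun _ => measureReal_nonneg) ?_ h1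
  filter_upwards [hY] with i hi
  obtain ⟨g, hg, hYg, hgD⟩ := hi
  rw [le_div_iff₀ hε, mul_comm]
  have h2 := mul_meas_ge_le_integral_of_nonneg
    (ae_of_all P fun ω => (norm_nonneg _).trans (hYg ω)) hg ε
  refine le_trans (mul_le_mul_of_nonneg_left (measureReal_mono fun ω hω => ?_) hε.le)
    (h2.trans hgD)
  simp only [Pi.zero_apply, sub_zero, Set.mem_ofPred_eq] at hω ⊢
  exact hω.trans (hYg ω)

end Slutsky

lemma tendsto_coe_biasSet :
    Tendsto (Subtype.val : biasSet → ℝ) (comap Subtype.val (𝓝 0)) (𝓝[biasSet] 0) :=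
  tendsto_nhdsWithin_iff.2 ⟨tendsto_comap, Eventually.of_forall fun h => h.2⟩

lemma measurable_scaledError {Ω : Type*} {mΩ : MeasurableSpace Ω} {P : Measure Ω} {ρ : Measure ℝ}
    {ℱ : Filtration ℕ mΩ} {x : ℕ → Ω → ℝ} (hI : Innovations P ρ ℱ x) {ξ₀ : Ω → ℝ}
    (hξ₀ : Measurable[ℱ 0] ξ₀) (α γ₁ β h ξ χ : ℝ) :
    Measurable fun ω => scaledError α γ₁ β h ξ χ (ξ₀ ω) fun k => x k ω := by
  have h1 : ∀ n, Measurable (varProc α γ₁ β ξ₀ x n) := fun n =>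
    (measurable_varProc hI hξ₀ n).mono (ℱ.le n) le_rfl
  have h2 : ∀ n, Measurable fun ω => esIter α (learningRate γ₁ β) (ξ₀ ω) (fun k => x k ω) n := by
    intro n
    induction n with
    | zero => exact measurable_const
    | succ n ih =>
      have h3 := h1 n
      have h4 := hI.measurable n
      have e : ∀ ω, esIter α (learningRate γ₁ β) (ξ₀ ω) (fun k => x k ω) (n + 1) =
          esIter α (learningRate γ₁ β) (ξ₀ ω) (fun k => x k ω) n - 1 / ((n : ℝ) + 1) *
            (esIter α (learningRate γ₁ β) (ξ₀ ω) (fun k => x k ω) n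
              - (varProc α γ₁ β ξ₀ x n ω
                + 1 / (1 - α) * max (x n ω - varProc α γ₁ β ξ₀ x n ω) 0)) := fun _ => rfl
      simp only [e]
      fun_prop
  exact measurable_vec (((h1 _).sub_const _).const_mul _) (((h2 _).sub_const _).const_mul _)

namespace RegularLaws

variable {Ω : Type*} {mΩ : MeasurableSpace Ω} {P : Measure Ω} [IsProbabilityMeasure P]
  {α γ₁ β : ℝ} {X : ℝ → Ω → ℝ} {f : ℝ → ℝ → ℝ} {v : ℝ → ℝ} {w : ℝ → ℝ → ℝ} {ξ₀ : ℝ → Ω → ℝ}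

/-- The central limit theorem for the scheme, for losses that converge in mean square. -/
theorem tendstoInDistribution_scaledError (hreg : RegularLaws P α X f v w)
    (hα : α ∈ Set.Ioo (0 : ℝ) 1) (hX2 : ∀ h ∈ insert 0 biasSet, MemLp (X h) 2 P)
    (hXl : Tendsto (fun h => ∫ ω, (X h ω - X 0 ω) ^ 2 ∂P) (𝓝[biasSet] 0) (𝓝 0))
    (hγ₁ : 0 < γ₁) (hβ : β ∈ Set.Ioc (1 / 2 : ℝ) 1) (hlam : β = 1 → 1 < lam P α X * γ₁)
    (hinit : InitialMoment P α f ξ₀) (hξ₀ : ∀ h ∈ biasSet, Measurable (ξ₀ h))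
    {Xi : ℝ → ℕ → Ω → ℝ} (hXi : ∀ h ∈ biasSet, ∀ n, IdentDistrib (Xi h n) (X h) P P)
    (hXi_indep : ∀ h ∈ biasSet, iIndepFun (Xi h) P)
    (hξ₀_indep : ∀ h ∈ biasSet, IndepFun (ξ₀ h) (fun ω n => Xi h n ω) P)
    {ξs χs : ℝ} (hξs : ξs = valueAtRisk P (X 0) α) (hχs : χs = expectedShortfall P (X 0) α) :
    (asympCov P α γ₁ β (X 0) ξs χs (f 0 ξs)).PosSemidef ∧
    TendstoInDistribution
      (fun (h : biasSet) ω => scaledError α γ₁ β h ξs χs (ξ₀ h ω) (fun n => Xi h n ω))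
      (comap Subtype.val (𝓝 (0 : ℝ))) id (fun _ => P)
      (multivariateGaussian (asympMean α β v ξs (f 0 ξs))
        (asympCov P α γ₁ β (X 0) ξs χs (f 0 ξs))) := by
  have h0 := zero_mem_insert_biasSet
  have h1α : 0 < 1 - α := by linarith [hα.2]
  have hβ' : β ∈ Set.Ioc (0 : ℝ) 1 := ⟨by linarith [hβ.1], hβ.2⟩
  have hX : ∀ h ∈ insert 0 biasSet, AEMeasurable (X h) P := fun h hh => (hX2 h hh).aemeasurable
  have hp : ∀ h ∈ insert 0 biasSet, IsProbabilityMeasure (P.map (X h)) := fun h hh =>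
    Measure.isProbabilityMeasure_map (hX h hh)
  obtain ⟨C, hρ⟩ := hreg.exists_regularDensity fun h hh => (hX2 h hh).integrable one_le_two
  set z : ℝ → ℝ := fun h => valueAtRisk P (X h) α with hz_def
  have hz : ∀ h ∈ insert 0 biasSet, cdf (P.map (X h)) (z h) = α := by
    intro h hh
    have := hp h hh
    simp only [hz_def]
    rw [← valueAtRisk_map (hX h hh)]
    exact (hρ h hh).cdf_valueAtRisk hα
  have hξ : ξs = z 0 := hξs
  have hχ : χs = objective P α (X 0) (z 0) := by
    have := hp 0 h0
    rw [hχs, ← expectedShortfall_map (hX 0 h0), (hρ 0 h0).expectedShortfall_eq (hz 0 h0) hα.2,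
      objective_map (hX 0 h0)]
  have hm : 0 < f 0 (z 0) / (1 - α) := div_pos ((hρ 0 h0).pos _) h1α
  -- `λ ≤ 3 / 8 V₀''(ξ₀)`, so that `V₀''(ξ₀) γ₁ > 8 / 3` in the critical case
  have hcrit : β = 1 → 8 / 3 < f 0 (z 0) / (1 - α) * γ₁ := by
    intro h
    have h1 := mul_le_mul_of_nonneg_right (lam_le hα hX hρ hz h0).1 hγ₁.le
    linarith [hlam h]
  have hm' : 0 < 2 * (f 0 (z 0) / (1 - α)) - γ₁⁻¹ * indOne β := by
    by_cases h : β = 1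
    · have h1 := hcrit h
      rw [indOne, if_pos h, mul_one, sub_pos, inv_lt_iff_one_lt_mul₀ hγ₁]
      linarith
    · rw [indOne, if_neg h]; linarith
  rw [hχ, hξ]
  have hpsd := posSemidef_asympCov hα hX2 (hρ 0 h0) (hz 0 h0) hγ₁ hβ' hm'
  refine ⟨hpsd, ?_⟩
  have hinn : ∀ h : biasSet, ∃ x' : ℕ → Ω → ℝ, (∀ n, Measurable (x' n)) ∧
      (∀ n, x' n =ᵐ[P] Xi h n) ∧ iIndepFun x' P ∧ ∃ ℱ : Filtration ℕ mΩ,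
        Measurable[ℱ 0] (ξ₀ h) ∧ Innovations P (P.map (X h)) ℱ x' := fun h =>
    exists_innovations (hξ₀ h h.2) (fun n => (hXi h h.2 n).aemeasurable_fst)
      (fun n => (hXi h h.2 n).map_eq) (hXi_indep h h.2) (hξ₀_indep h h.2)
  choose x hxm hxae hxind ℱ hξℱ hI using hinn
  set c := asympMean α β v (z 0) (f 0 (z 0)) with hc
  set V : biasSet → Ω → EuclideanSpace ℝ (Fin 2) := fun h ω =>
    linearized (P.map (X h)) α (z h) (f 0 (z 0) / (1 - α)) γ₁ β c h (fun k => x h k ω) with hV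
  have hVm : ∀ h, Measurable (V h) := fun h => measurable_linearized _ _ _ _ _ _ _ _ (hxm h)
  have hVd : TendstoInDistribution V (comap Subtype.val (𝓝 (0 : ℝ))) id (fun _ => P)
      (multivariateGaussian c (asympCov P α γ₁ β (X 0) (z 0) (objective P α (X 0) (z 0))
        (f 0 (z 0)))) := by
    refine ⟨fun h => (hVm h).aemeasurable, aemeasurable_id, ?_⟩
    refine tendsto_probabilityMeasure_of_charFun fun τ => ?_
    classical
    have h1 := (tendsto_charFun_linearized hα hX2 hρ hz hXl
      (hreg.tendsto_valueAtRisk hα hX hρ hz) hγ₁ hβ' hm'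
      (fun h => by linarith [hcrit h])
      (x := fun h => if hh : h ∈ biasSet then x ⟨h, hh⟩ else fun _ _ => 0)
      (fun h hh k => by rw [dif_pos hh]; exact hxm ⟨h, hh⟩ k)
      (fun h hh k => by rw [dif_pos hh]; exact (hI ⟨h, hh⟩).map_eq k)
      (fun h hh => by rw [dif_pos hh]; exact hxind ⟨h, hh⟩) c τ).comp tendsto_coe_biasSet
    simp only [ProbabilityMeasure.coe_mk, Measure.map_id]
    refine h1.congr fun h => ?_
    simp only [Function.comp, dif_pos h.2, hV]
  obtain ⟨D, hD, hDh⟩ := hreg.exists_scaledError_sub_linearized_le hα hX hρ hz hγ₁ hβ hlam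
    (fun h => by linarith [hcrit h]) hinit hξ₀
  have hSm : ∀ h : biasSet, Measurable fun ω => scaledError α γ₁ β h (z 0)
      (objective P α (X 0) (z 0)) (ξ₀ h ω) fun k => x h k ω := fun h =>
    measurable_scaledError (hI h) (hξℱ h) _ _ _ _ _ _
  have hSd := tendstoInDistribution_of_tendstoInMeasure_sub
    (fun (h : biasSet) ω => scaledError α γ₁ β h (z 0) (objective P α (X 0) (z 0)) (ξ₀ h ω)
      fun k => x h k ω) id hVd
    (tendstoInMeasure_zero_of_integral_le (hD.comp tendsto_coe_biasSet)
      ((tendsto_coe_biasSet.eventually hDh).mono fun h hh => hh (ℱ h) (x h) (hI h) (hξℱ h)))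
    fun h => (hSm h).aemeasurable
  refine hSd.congr (fun h => ?_) (EventuallyEq.refl _ _)
  filter_upwards [ae_all_iff.2 (hxae h)] with ω hω
  simp only [hω]

end RegularLaws

lemma memLp_two_of_integrable_rpow {Ω : Type*} {mΩ : MeasurableSpace Ω} {P : Measure Ω}
    [IsFiniteMeasure P] {g : Ω → ℝ} (hg : AEStronglyMeasurable g P) {δ : ℝ} (hδ : 0 < δ)
    (hi : Integrable (fun ω => |g ω| ^ (2 + δ : ℝ)) P) : MemLp g 2 P := by
  rw [memLp_two_iff_integrable_sq hg]
  refine ((integrable_const (1 : ℝ)).add hi).mono' (hg.pow 2) (ae_of_all _ fun ω => ?_)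
  rw [Real.norm_of_nonneg (sq_nonneg _), ← sq_abs, Pi.add_apply]
  rcases le_total |g ω| 1 with h | h
  · have : 0 ≤ |g ω| ^ (2 + δ : ℝ) := by positivity
    have := pow_le_one₀ (n := 2) (abs_nonneg (g ω)) h
    linarith
  · rw [← Real.rpow_two]
    have := Real.rpow_le_rpow_of_exponent_le h (show (2 : ℝ) ≤ 2 + δ by linarith)
    linarith

end

end NestedSA

theorem corollary1p4
    {Ω : Type*} [MeasurableSpace Ω] (P : Measure Ω) [IsProbabilityMeasure P]
    {d q : ℕ} (φ : (Fin d → ℝ) × (Fin q → ℝ) → ℝ) (hφ : Measurable φ)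
    (Y : Ω → Fin d → ℝ) (hY : Measurable Y)
    (Z : Ω → Fin q → ℝ) (hZ : Measurable Z) (hYZ : IndepFun Y Z P)
    -- the inner samples: i.i.d. copies of `Z`, jointly independent of `Y`
    (Zs : ℕ → Ω → Fin q → ℝ) (hZs : ∀ k, IdentDistrib (Zs k) Z P P)
    (hZs_indep : iIndepFun Zs P) (hYZs : IndepFun Y (fun ω k => Zs k ω) P)
    -- the losses
    (X : ℝ → Ω → ℝ) (hX : X = NestedSA.loss P φ Y Z Zs)
    -- the initial value and the i.i.d. innovations of the scheme, for each bias parameter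
    (ξ₀ : ℝ → Ω → ℝ) (hξ₀ : ∀ h ∈ NestedSA.biasSet, Measurable (ξ₀ h))
    (Xi : ℝ → ℕ → Ω → ℝ)
    (hXi : ∀ h ∈ NestedSA.biasSet, ∀ n, IdentDistrib (Xi h n) (X h) P P)
    (hXi_indep : ∀ h ∈ NestedSA.biasSet, iIndepFun (Xi h) P)
    (hξ₀_indep : ∀ h ∈ NestedSA.biasSet, IndepFun (ξ₀ h) (fun ω n => Xi h n ω) P)
    (α : ℝ) (hα : α ∈ Set.Ioo (0 : ℝ) 1)
    (f : ℝ → ℝ → ℝ) (v : ℝ → ℝ) (w : ℝ → ℝ → ℝ)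
    (hreg : NestedSA.RegularLaws P α X f v w)
    (hinit : NestedSA.InitialMoment P α f ξ₀)
    (hmoment : ∃ δ > 0, Integrable (fun ω => |φ (Y ω, Z ω)| ^ (2 + δ : ℝ)) P)
    (γ₁ : ℝ) (hγ₁ : 0 < γ₁) (β : ℝ) (hβ : β ∈ Set.Ioc (1 / 2 : ℝ) 1)
    (hlam : β = 1 → 1 < NestedSA.lam P α X * γ₁)
    (ξs χs : ℝ) (hξs : ξs = NestedSA.valueAtRisk P (X 0) α)
    (hχs : χs = NestedSA.expectedShortfall P (X 0) α) :
    (NestedSA.asympCov P α γ₁ β (X 0) ξs χs (f 0 ξs)).PosSemidef ∧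
    TendstoInDistribution
      (fun (h : NestedSA.biasSet) ω =>
        NestedSA.scaledError α γ₁ β h ξs χs (ξ₀ h ω) (fun n => Xi h n ω))
      (comap Subtype.val (𝓝 (0 : ℝ)))
      id (fun _ => P)
      (multivariateGaussian (NestedSA.asympMean α β v ξs (f 0 ξs))
        (NestedSA.asympCov P α γ₁ β (X 0) ξs χs (f 0 ξs))) := by
  subst hX
  obtain ⟨δ, hδ, hφδ⟩ := hmoment
  have hφ2 := NestedSA.memLp_two_of_integrable_rpow
    (hφ.comp (hY.prodMk hZ)).aestronglyMeasurable hδ hφδ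
  obtain ⟨hX2, C, hC⟩ :=
    NestedSA.exists_integral_loss_sub_sq_le hφ hY hZ hYZ hZs hZs_indep hYZs hφ2
  have hXl : Tendsto (fun h => ∫ ω, (NestedSA.loss P φ Y Z Zs h ω
      - NestedSA.loss P φ Y Z Zs 0 ω) ^ 2 ∂P) (𝓝[NestedSA.biasSet] 0) (𝓝 0) := by
    refine squeeze_zero' (Eventually.of_forall fun h => integral_nonneg fun ω => sq_nonneg _)
      (NestedSA.eventually_mem_biasSet.mono hC) ?_
    simpa using NestedSA.tendsto_id_biasSet.const_mul C
  exact hreg.tendstoInDistribution_scaledError hα hX2 hXl hγ₁ hβ hlam hinit hξ₀ hXi hXi_indep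
    hξ₀_indep hξs hχs
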